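/- **Setting.** A positive sequence $(v_n)_{n\ge 1}$ belongs to $\mathcal{GS}(e)$, $e\in\mathbb R$, if $\lim_{n\to\infty} n\left[1-v_{n-1}/v_n\right]=e$. Let $(X,Y),(X_1,Y_1),(X_2,Y_2),\dots$ be independent, identically distributed pairs of real random variables whose law has a density $g(s,t)$ on $\mathbb R^2$; put $f(x)=\int_{\mathbb R} g(x,t)\,dt$ and, where $f(x)\neq 0$, $r(x)=\mathbb E(Y\mid X=x)=f(x)^{-1}\int_{\mathbb R} t\,g(x,t)\,dt$. Let $K:\mathbb R\to\mathbb R$, let $(\gamma_n)$, $(h_n)$, $(q_n)$ be positive sequences, and let $r_0:\mathbb R\to\mathbb R$ be a function. For $n\ge1$ set $$r_n(x)=r_{n-1}(x)+\gamma_n\left[h_n^{-1}Y_nK\!\left(\tfrac{x-X_n}{h_n}\right)-h_n^{-1}K\!\left(\tfrac{x-X_n}{h_n}\right)r_{n-1}(x)\right],\qquad \bar r_n(x)=\frac{1}{\sum_{k=1}^n q_k}\sum_{k=1}^n q_k r_k(x).$$ **Assumptions.** Let $\alpha,a,q\in\mathbb R$. - (A1) $K$ is nonnegative, continuous and bounded,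 with $\int K(z)\,dz=1$, $\int zK(z)\,dz=0$ and $\int z^2K(z)\,dz<\infty$. - (A2) $(\gamma_n)\in\mathcal{GS}(-\alpha)$ with $\alpha\in(3/4,1]$, and $(n\gamma_n)^{-1}$ has a finite limit; $(h_n)\in\mathcal{GS}(-a)$ with $a\in\left(\frac{1-\alpha}{4},\frac{\alpha}{3}\right)$. - (A3) (at the point $x$) (i) for each $t$, $s\mapsto g(s,t)$ is twice continuously differentiable on $\mathbb R$. (ii) For $p\in\{0,1,2\}$, $s\mapsto\int t^p g(s,t)\,dt$ is a bounded function on $\mathbb R$, continuous at $s=x$; for $p\in[2,3]$, $s\mapsto\int|t|^p g(s,t)\,dt$ is a bounded function. (iii) For $p\in\{0,1\}$, $\int|t|^p\left|\frac{\partial g}{\partial s}(x,t)\right|dt<\infty$, and $s\mapsto\int t^p\frac{\partial^2 g}{\partial s^2}(s,t)\,dt$ is a bounded function, continuous at $s=x$. All these integrals converge absolutely, and moreover $\int_{-R}^{R}\int_{\mathbb R}|t|^p\left|\frac{\partial^2 g}{\partial s^2}(s,t)\right|dt\,ds<\infty$ for $p\in\{0,1\}$ and every $R>0$. - (A4) (i)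 $K$ is Lipschitz-continuous. (ii) $\mathbb E(\exp(t^*|Y|))<\infty$ for some $t^*>0$. (iii) $a\in(1-\alpha,\alpha-2/3)$. (iv) For $p\in\{0,1\}$, $x\mapsto\int|t|^p\left|\frac{\partial g}{\partial s}(x,t)\right|dt$ is bounded on $\{x: f(x)>0\}$. - (A5) $\lim_{n\to\infty} n\gamma_n\left(\ln\sum_{k=1}^n\gamma_k\right)^{-1}=\infty$ and $a\in\left(1-\alpha,\frac{4\alpha-3}{2}\right)$. - (A6) $(q_n)\in\mathcal{GS}(-q)$ with $q<\min\left\{1-2a,\frac{1+a}{2}\right\}$. **Theorem.** Let $I$ be a bounded nonempty open interval with $\inf_{x\in I}f(x)>0$, let $r_0$ be bounded on $I$, and let (A1)–(A6) hold, (A3) at every point $x\in I$. 1. If the sequence $\left(nh_n^5/(\ln n)^2\right)_{n\ge2}$ is bounded and $\alpha>\frac{3a+3}{4}$, then, almost surely, $\displaystyle\sup_{x\in I}|\bar r_n(x)-r(x)|=O\!\left(\sqrt{n^{-1}h_n^{-1}}\,\ln n\right)$. 2. If $\lim_{n\to\infty} nh_n^5/(\ln n)^2=\infty$ and if, in the case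 $a\in[\alpha/5,1/5]$, also $\alpha>\frac{4a+1}{2}$, then, almost surely, $\displaystyle\sup_{x\in I}|\bar r_n(x)-r(x)|=O\!\left(h_n^2\right)$. -/

import Mathlib

open MeasureTheory ProbabilityTheory Filter Topology Asymptotics Set

namespace Revesz

noncomputable section

/-- The class `GS(e)` of positive sequences `(v_n)_{n ≥ 1}` with
`lim n * (1 - v_{n-1} / v_n) = e`. The value at index `0` plays no role. -/
def GS (v : ℕ → ℝ) (e : ℝ) : Prop :=
  (∀ n, 1 ≤ n → 0 < v n) ∧
    Tendsto (fun n : ℕ => (n : ℝ) * (1 - v (n - 1) / v n)) atTop (𝓝 e)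

/-- Marginal density `f(x) = ∫ g(x,t) dt` of `X`, where `g` is the density of `(X,Y)`. -/
def marginal (g : ℝ → ℝ → ℝ) (x : ℝ) : ℝ := ∫ t, g x t

/-- Regression function `r(x) = E(Y | X = x) = (∫ t g(x,t) dt) / f(x)`. -/
def regression (g : ℝ → ℝ → ℝ) (x : ℝ) : ℝ := (∫ t, t * g x t) / marginal g x

/-- First partial derivative of `g(s,t)` with respect to `s`. -/
def partialS (g : ℝ → ℝ → ℝ) (s t : ℝ) : ℝ := deriv (fun u => g u t) s

/-- Second partial derivative of `g(s,t)` with respect to `s`. -/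
def partialSS (g : ℝ → ℝ → ℝ) (s t : ℝ) : ℝ := iteratedDeriv 2 (fun u => g u t) s

/-- `(X n, Y n)`, `n = 0, 1, 2, …`, are independent and identically distributed pairs, whose
common law has the density `g`; the pair of index `0` is the generic pair `(X, Y)`, and the
observations are the pairs of index `n ≥ 1`. -/
structure IIDWithDensity {Ω : Type*} [MeasurableSpace Ω] (μ : Measure Ω)
    (X Y : ℕ → Ω → ℝ) (g : ℝ → ℝ → ℝ) : Prop where
  measurable_X : ∀ n, Measurable (X n)
  measurable_Y : ∀ n, Measurable (Y n)
  indep : iIndepFun (fun n ω => (X n ω, Y n ω)) μ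
  density_measurable : Measurable (fun p : ℝ × ℝ => g p.1 p.2)
  density_nonneg : ∀ s t, 0 ≤ g s t
  law : ∀ n, μ.map (fun ω => (X n ω, Y n ω)) =
    (volume : Measure (ℝ × ℝ)).withDensity (fun p => ENNReal.ofReal (g p.1 p.2))

/-- The generalized Révész estimator computed from the data `(xs n, ys n)`, `n ≥ 1`:
`r_n(x) = r_{n-1}(x) + γ_n W_n(x)` with
`W_n(x) = h_n⁻¹ Y_n K(h_n⁻¹ (x - X_n)) - h_n⁻¹ K(h_n⁻¹ (x - X_n)) r_{n-1}(x)`. -/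
def estimator (K : ℝ → ℝ) (γ h : ℕ → ℝ) (r₀ : ℝ → ℝ) (xs ys : ℕ → ℝ) : ℕ → ℝ → ℝ
  | 0, x => r₀ x
  | n + 1, x =>
      estimator K γ h r₀ xs ys n x + γ (n + 1) *
        ((h (n + 1))⁻¹ * ys (n + 1) * K ((h (n + 1))⁻¹ * (x - xs (n + 1))) -
          (h (n + 1))⁻¹ * K ((h (n + 1))⁻¹ * (x - xs (n + 1))) *
            estimator K γ h r₀ xs ys n x)

/-- The averaged Révész estimator
`(∑_{k=1}^n q_k)⁻¹ ∑_{k=1}^n q_k r_k(x)`. -/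
def averaged (K : ℝ → ℝ) (γ h q : ℕ → ℝ) (r₀ : ℝ → ℝ) (xs ys : ℕ → ℝ) (n : ℕ) (x : ℝ) : ℝ :=
  (∑ k ∈ Finset.Icc 1 n, q k)⁻¹ * ∑ k ∈ Finset.Icc 1 n, q k * estimator K γ h r₀ xs ys k x

/-- Conditions on the kernel `K`. -/
structure A1 (K : ℝ → ℝ) : Prop where
  nonneg : ∀ z, 0 ≤ K z
  continuous : Continuous K
  bounded : ∃ C, ∀ z, K z ≤ C
  integral_eq_one : ∫ z, K z = 1
  integrable_mul : Integrable (fun z => z * K z)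
  integral_mul_eq_zero : ∫ z, z * K z = 0
  integrable_sq_mul : Integrable (fun z => z ^ 2 * K z)

/-- Conditions on the stepsize and the bandwidth. -/
structure A2 (γ h : ℕ → ℝ) (α a : ℝ) : Prop where
  stepsize : GS γ (-α)
  alpha_mem : α ∈ Ioc (3 / 4 : ℝ) 1
  limit_exists : ∃ ξ : ℝ, Tendsto (fun n : ℕ => ((n : ℝ) * γ n)⁻¹) atTop (𝓝 ξ)
  bandwidth : GS h (-a)
  a_mem : a ∈ Ioo ((1 - α) / 4) (α / 3)

/-- Regularity of the density `g`, at the point `x`. Every integral is required to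
converge absolutely. -/
structure A3 (g : ℝ → ℝ → ℝ) (x : ℝ) : Prop where
  contDiff : ∀ t, ContDiff ℝ 2 (fun s => g s t)
  moment : ∀ q : ℕ, q ≤ 2 →
    (∀ s, Integrable (fun t => t ^ q * g s t)) ∧
    (∃ C, ∀ s, |∫ t, t ^ q * g s t| ≤ C) ∧
    ContinuousAt (fun s => ∫ t, t ^ q * g s t) x
  abs_moment : ∀ q : ℝ, q ∈ Icc (2 : ℝ) 3 →
    (∀ s, Integrable (fun t => |t| ^ q * g s t)) ∧
    ∃ C, ∀ s, ∫ t, |t| ^ q * g s t ≤ C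
  first_deriv : ∀ q : ℕ, q ≤ 1 → Integrable (fun t => |t| ^ q * |partialS g x t|)
  second_deriv : ∀ q : ℕ, q ≤ 1 →
    (∀ s, Integrable (fun t => t ^ q * partialSS g s t)) ∧
    (∃ C, ∀ s, |∫ t, t ^ q * partialSS g s t| ≤ C) ∧
    ContinuousAt (fun s => ∫ t, t ^ q * partialSS g s t) x
  /-- Absolute convergence also as a double integral over `[-R, R] × ℝ`, so that the order of
  integration in `s` and `t` is immaterial. -/
  second_deriv_joint : ∀ q : ℕ, q ≤ 1 → ∀ R : ℝ,
    IntegrableOn (fun p : ℝ × ℝ => p.2 ^ q * partialSS g p.1 p.2) (Icc (-R) R ×ˢ univ)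

/-- Additional conditions for uniform results; here `Y` is the generic response variable. -/
structure A4 {Ω : Type*} [MeasurableSpace Ω] (μ : Measure Ω) (Y : Ω → ℝ) (K : ℝ → ℝ)
    (g : ℝ → ℝ → ℝ) (α a : ℝ) : Prop where
  lipschitz : ∃ L, LipschitzWith L K
  exp_moment : ∃ τ : ℝ, 0 < τ ∧ Integrable (fun ω => Real.exp (τ * |Y ω|)) μ
  a_mem : a ∈ Ioo (1 - α) (α - 2 / 3)
  first_deriv_bounded : ∀ q : ℕ, q ≤ 1 → ∃ C, ∀ x, 0 < marginal g x →
    Integrable (fun t => |t| ^ q * |partialS g x t|) ∧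
    ∫ t, |t| ^ q * |partialS g x t| ≤ C

/-- Conditions on the stepsize and the bandwidth for averaging. -/
structure A5 (γ : ℕ → ℝ) (α a : ℝ) : Prop where
  stepsize : Tendsto
    (fun n : ℕ => (n : ℝ) * γ n * (Real.log (∑ k ∈ Finset.Icc 1 n, γ k))⁻¹) atTop atTop
  a_mem : a ∈ Ioo (1 - α) ((4 * α - 3) / 2)

/-- Conditions on the averaging weights. -/
structure A6 (w : ℕ → ℝ) (q a : ℝ) : Prop where
  weights : GS w (-q)
  q_lt : q < min (1 - 2 * a) ((1 + a) / 2)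

/-- `sup_{x ∈ I} |u_n(x)| = O(v_n)` as `n → ∞` (in particular the supremum is finite for all
large `n`). -/
def SupIsBigO (I : Set ℝ) (u : ℕ → ℝ → ℝ) (v : ℕ → ℝ) : Prop :=
  (∀ᶠ n in atTop, BddAbove ((fun x => |u n x|) '' I)) ∧
    (fun n => sSup ((fun x => |u n x|) '' I)) =O[atTop] v

end

end Revesz

/-! ### Calculus of the classes `GS` and comparison of linear recursions. -/

namespace Revesz

/-! Fix `x` and let `e_n` be the error of the non-averaged estimator. Splitting the kernel terms
into mean and fluctuation gives `e_n = (1 - γ_n f(x)) e_{n-1} + γ_n (ξ_n + β_n)`. Here `ξ_n` is a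
martingale increment, of conditional variance `O(1/h_n)` while the errors stay bounded, and a Taylor
expansion of the first two moments of `g` gives `β_n = O(h_n² (1 + |e_{n-1}|))`. Since `n γ_n → ∞`,
the contraction by `1 - γ_n f` beats any variation of polynomial order, whence `e_n = O(√(γ_n/h_n)
log n + h_n²)` (`err_rate`).

Averaging gains because the recursion can be solved for `f e_{n-1} = (e_{n-1} - e_n)/γ_n + ξ_n +
β_n`. Multiply by the weight `w_n` and sum by parts. The martingale `∑ w_k ξ_k` is `O(n w_n (n
h_n)^{-1/2} log n)`, the bias sums to `O(n w_n h_n²)`, and the boundary and summation-by-parts terms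
are controlled by the rate of `e_n`. Division by `∑ w_k`, which dominates `n w_n`, leaves `O((n
h_n)^{-1/2} log n + h_n²)`, denoted `rate` (`averaged_bound_of_grid`, `averaged_rate`). Each part of
the theorem says which of the two terms dominates.

Uniformity in `x` comes from exponential moments. With `Y_k` truncated at a multiple of `log k`, a
process driven by the innovations satisfies `E exp(l U_n) ≤ exp(l² T_n²)` for `|l| T_n ≤ 1`
(`exp_moment_le`). A union bound over `n²` grid points and Borel–Cantelli follow
(`ae_eventually_grid`). Between grid points the estimator is Lipschitz with constant `O(n)`, so the
loss is `O(1/n) = O(h_n²)`.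

Two obstacles remain. The innovation contains `e_{n-1}`, which must be bounded before exponential
moments exist: it is clipped at a level `B_n`, and the rate is bootstrapped from a logarithmic a
priori bound to a constant level. Also `r₀` is only bounded: the estimator is affine in its initial
value, so `r₀(x)` is written as a convex combination of two constants. -/

/-- Eventually positive sequences `v` with `n (1 - v_{n-1} / v_n) → e`. -/
def EvGS (v : ℕ → ℝ) (e : ℝ) : Prop :=
  (∀ᶠ n in atTop, 0 < v n) ∧
    Tendsto (fun n : ℕ => (n : ℝ) * (1 - v (n - 1) / v n)) atTop (𝓝 e)

theorem GS.evGS {v : ℕ → ℝ} {e : ℝ} (hv : GS v e) : EvGS v e :=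
  ⟨(eventually_ge_atTop 1).mono fun n hn => hv.1 n hn, hv.2⟩

namespace EvGS

variable {u v : ℕ → ℝ} {e e' : ℝ}

theorem tendsto_ratio (hv : EvGS v e) :
    Tendsto (fun n : ℕ => v (n - 1) / v n) atTop (𝓝 1) := by
  have h1 : Tendsto (fun n : ℕ => ((n : ℝ))⁻¹ * ((n : ℝ) * (1 - v (n - 1) / v n))) atTop
      (𝓝 (0 * e)) := tendsto_inv_atTop_nhds_zero_nat.mul hv.2
  have h2 := (tendsto_const_nhds (x := (1 : ℝ))).sub h1
  simp only [zero_mul, sub_zero] at h2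
  refine h2.congr' ?_
  filter_upwards [eventually_gt_atTop 0] with n hn
  have : (n : ℝ) ≠ 0 := by positivity
  field_simp
  ring

theorem eventually_pos_pred (hv : EvGS v e) : ∀ᶠ n : ℕ in atTop, 0 < v (n - 1) :=
  (tendsto_sub_atTop_nat 1).eventually hv.1

theorem mul (hu : EvGS u e) (hv : EvGS v e') : EvGS (fun n => u n * v n) (e + e') := by
  refine ⟨?_, ?_⟩
  · filter_upwards [hu.1, hv.1] with n h1 h2 using mul_pos h1 h2
  · have := hu.2.add (hu.tendsto_ratio.mul hv.2)
    rw [one_mul] at this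
    refine this.congr' ?_
    filter_upwards [hu.1, hv.1] with n h1 h2
    field_simp
    ring

theorem inv (hv : EvGS v e) : EvGS (fun n => (v n)⁻¹) (-e) := by
  refine ⟨?_, ?_⟩
  · filter_upwards [hv.1] with n h1 using inv_pos.2 h1
  · have := hv.2.neg.div hv.tendsto_ratio one_ne_zero
    rw [div_one] at this
    refine this.congr' ?_
    filter_upwards [hv.1, hv.eventually_pos_pred] with n h1 h2
    simp only [Pi.div_apply]
    field_simp
    ring

/-- Follows from `1 - √x = (1 - x) / (1 + √x)` at `x = v_{n-1}/v_n`, which tends to 1. -/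
theorem sqrt (hv : EvGS v e) : EvGS (fun n => √(v n)) (e / 2) := by
  refine ⟨?_, ?_⟩
  · filter_upwards [hv.1] with n h1 using Real.sqrt_pos.2 h1
  · have h1 : Tendsto (fun n : ℕ => 1 + √(v (n - 1) / v n)) atTop (𝓝 (1 + √1)) :=
      hv.tendsto_ratio.sqrt.const_add 1
    have := hv.2.div h1 (by positivity)
    rw [Real.sqrt_one, one_add_one_eq_two] at this
    refine this.congr' ?_
    filter_upwards [hv.1, hv.eventually_pos_pred] with n h1 h2
    simp only [Pi.div_apply]
    rw [← Real.sqrt_div h2.le]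
    have h3 : 0 ≤ v (n - 1) / v n := by positivity
    have h4 := Real.sq_sqrt h3
    have h5 := Real.sqrt_nonneg (v (n - 1) / v n)
    rw [div_eq_iff (by positivity)]
    nth_rewrite 1 [← h4]
    ring

theorem const {c : ℝ} (hc : 0 < c) : EvGS (fun _ => c) 0 := by
  refine ⟨Eventually.of_forall fun _ => hc, ?_⟩
  simp [div_self hc.ne']

theorem pow (hv : EvGS v e) (m : ℕ) : EvGS (fun n => v n ^ m) (m * e) := by
  induction m with
  | zero => simpa using const one_pos
  | succ m ih =>
    have := ih.mul hv
    simp only [pow_succ]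
    convert this using 1
    push_cast
    ring

theorem natCast : EvGS (fun n => (n : ℝ)) 1 := by
  refine ⟨(eventually_gt_atTop 0).mono fun n hn => by positivity, ?_⟩
  refine tendsto_const_nhds.congr' ?_
  filter_upwards [eventually_ge_atTop 1] with n hn
  have : (n : ℝ) ≠ 0 := by positivity
  rw [Nat.cast_sub hn]
  field_simp
  simp

theorem le_of_drift (hv : EvGS v e) {δ : ℝ} (hδ : δ < e) :
    ∀ᶠ n : ℕ in atTop, v (n - 1) ≤ (1 - δ / n) * v n := by
  filter_upwards [hv.1, hv.2.eventually_const_lt hδ, eventually_gt_atTop 0] with n h1 h2 h3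
  have h3' : (0 : ℝ) < n := by positivity
  have : δ / n ≤ 1 - v (n - 1) / v n := by
    rw [div_le_iff₀ h3', mul_comm]; exact h2.le
  have h4 : v (n - 1) / v n ≤ 1 - δ / n := by linarith
  exact (div_le_iff₀ h1).1 h4

theorem abs_sub_le (hv : EvGS v e) :
    ∀ᶠ n : ℕ in atTop, |v n - v (n - 1)| ≤ (|e| + 1) * (v n / n) := by
  have h := hv.2.abs
  filter_upwards [hv.1, h.eventually_lt_const (lt_add_one |e|), eventually_gt_atTop 0]
    with n h1 h2 h3
  have h3' : (0 : ℝ) < n := by positivity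
  have : v n - v (n - 1) = (n * (1 - v (n - 1) / v n)) * (v n / n) := by field_simp
  rw [this, abs_mul, abs_of_pos (div_pos h1 h3')]
  gcongr

/-- The relative variation of `v` in one step is `O(1/n)`, hence negligible against `c γ_n` when `n
γ_n → ∞`. Half of the contraction absorbs it; the other half, `c/2 * γ_n * v_n`, is left to absorb a
forcing term. -/
theorem drift_of_tendsto (hv : EvGS v e) {γ : ℕ → ℝ} (hγ0 : ∀ᶠ n in atTop, 0 ≤ γ n)
    (hγ : Tendsto (fun n : ℕ => (n : ℝ) * γ n) atTop atTop) {c : ℝ} (hc : 0 < c)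
    (hγ1 : Tendsto γ atTop (𝓝 0)) :
    ∀ᶠ n : ℕ in atTop, (1 - c * γ n) * v (n - 1) ≤ (1 - c / 2 * γ n) * v n := by
  have hγ2 : ∀ᶠ n in atTop, γ n < c⁻¹ := hγ1.eventually_lt_const (by positivity)
  filter_upwards [hv.le_of_drift (sub_one_lt e), hv.1, hγ0, hγ2, eventually_gt_atTop 0,
    hγ.eventually_ge_atTop (2 * |e - 1| / c)] with n h1 h2 h3 h4 h5 h6
  have h5' : (0 : ℝ) < n := by positivity
  have hcg : c * γ n ≤ 1 := by
    have := mul_le_mul_of_nonneg_left h4.le hc.le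
    rwa [mul_inv_cancel₀ hc.ne'] at this
  have h7 : -((e - 1) / n) ≤ c / 2 * γ n := by
    rw [← neg_div, div_le_iff₀ h5']
    rw [div_le_iff₀ hc] at h6
    have := neg_le_abs (e - 1)
    nlinarith
  have h8 : (1 - c * γ n) * v (n - 1) ≤ (1 - c * γ n) * ((1 - (e - 1) / n) * v n) := by
    apply mul_le_mul_of_nonneg_left h1; linarith
  refine h8.trans ?_
  rw [← mul_assoc]
  apply mul_le_mul_of_nonneg_right _ h2.le
  have hx : 0 ≤ c * γ n := mul_nonneg hc.le h3
  have : (1 - c * γ n) * (1 - (e - 1) / n) ≤ (1 - c * γ n) * (1 + c / 2 * γ n) := by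
    apply mul_le_mul_of_nonneg_left <;> linarith
  nlinarith

end EvGS

/-- Discrete comparison principle: `V` is a supersolution of the recursion of which `u` is a
subsolution, with forcing `κ d` instead of `d`. The multiple `C V` is then a supersolution for `d`
itself as soon as `C κ ≥ 1`. Every deterministic rate below comes from this, with an explicit `V`.
-/
theorem le_mul_of_recursion {u V ρ d : ℕ → ℝ} {N : ℕ} {C κ : ℝ} (hκ : 0 < κ)
    (hρ : ∀ n, N < n → 0 ≤ ρ n) (hd : ∀ n, N < n → 0 ≤ d n)
    (hV : ∀ n, N < n → ρ n * V (n - 1) + κ * d n ≤ V n)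
    (hu : ∀ n, N < n → u n ≤ ρ n * u (n - 1) + d n)
    (hN : u N ≤ C * V N) (hC : κ⁻¹ ≤ C) : ∀ n, N ≤ n → u n ≤ C * V n := by
  have hC0 : 0 ≤ C := (inv_pos.2 hκ).le.trans hC
  have hCκ : 1 ≤ C * κ := by
    have := mul_le_mul_of_nonneg_right hC hκ.le
    rwa [inv_mul_cancel₀ hκ.ne'] at this
  intro n hn
  induction n, hn using Nat.le_induction with
  | base => exact hN
  | succ n hn ih =>
    have h1 := hu (n + 1) (by omega)
    have h2 := hV (n + 1) (by omega)
    have h3 := hρ (n + 1) (by omega)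
    have h4 := hd (n + 1) (by omega)
    simp only [Nat.add_sub_cancel] at h1 h2
    calc u (n + 1) ≤ ρ (n + 1) * (C * V n) + 1 * d (n + 1) := by
          rw [one_mul]; exact h1.trans (by gcongr)
      _ ≤ ρ (n + 1) * (C * V n) + (C * κ) * d (n + 1) := by gcongr
      _ = C * (ρ (n + 1) * V n + κ * d (n + 1)) := by ring
      _ ≤ C * V (n + 1) := by gcongr

namespace EvGS

variable {u v : ℕ → ℝ} {e e' : ℝ}

/-- The inverse sequence has positive exponent, so it is eventually nondecreasing. -/
theorem eventually_le_of_neg (hv : EvGS v e) (he : e < 0) :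
    ∃ C, ∀ᶠ n in atTop, v n ≤ C := by
  have h := hv.inv.le_of_drift (show (0 : ℝ) < -e by linarith)
  obtain ⟨N, hN⟩ := eventually_atTop.1 (h.and hv.inv.1)
  refine ⟨((v N)⁻¹)⁻¹, eventually_atTop.2 ⟨N, fun n hn => ?_⟩⟩
  have : (v N)⁻¹ ≤ (v n)⁻¹ := by
    induction n, hn using Nat.le_induction with
    | base => exact le_rfl
    | succ n hn ih =>
      have := (hN (n + 1) (by omega)).1
      simp only [zero_div, sub_zero, one_mul, Nat.add_sub_cancel] at this
      exact ih.trans this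
  have h0 := (hN N le_rfl).2
  rw [← inv_inv (v n)]
  exact inv_anti₀ h0 this

theorem natCast_rpow (s : ℝ) : EvGS (fun n : ℕ => (n : ℝ) ^ s) s := by
  refine ⟨(eventually_gt_atTop 0).mono fun n hn => by positivity, ?_⟩
  have hd : HasDerivAt (fun x : ℝ => (1 - x) ^ s) (-s) 0 := by
    have h1 : HasDerivAt (fun x : ℝ => 1 - x) (-1) 0 := by
      simpa using (hasDerivAt_id (0 : ℝ)).const_sub 1
    have := h1.rpow_const (p := s) (Or.inl (by norm_num))
    simpa using this
  have h2 := hd.tendsto_slope_zero_right.neg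
  simp only [sub_zero, zero_add, Real.one_rpow, neg_neg] at h2
  have h3 : Tendsto (fun n : ℕ => ((n : ℝ))⁻¹) atTop (𝓝[>] 0) :=
    tendsto_inv_atTop_nhdsGT_zero.comp tendsto_natCast_atTop_atTop
  refine (h2.comp h3).congr' ?_
  filter_upwards [eventually_ge_atTop 1] with n hn
  have h4 : (1 : ℝ) ≤ n := by exact_mod_cast hn
  have : (1 - (n : ℝ)⁻¹) = ((n - 1 : ℕ) : ℝ) / n := by
    rw [Nat.cast_sub hn]; field_simp; simp
  simp only [Function.comp_apply, inv_inv, smul_eq_mul]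
  rw [this, Real.div_rpow (by positivity) (by positivity)]
  ring

theorem tendsto_zero (hv : EvGS v e) (he : e < 0) : Tendsto v atTop (𝓝 0) := by
  -- Multiplication by `n^{-e/2}` leaves the exponent `e/2 < 0`, so the product is still bounded and
  -- `v_n = O(n^{e/2})`.
  obtain ⟨C, hC⟩ := (hv.mul (natCast_rpow (-e / 2))).eventually_le_of_neg (by linarith)
  have h0 : Tendsto (fun n : ℕ => C * (n : ℝ) ^ (-(-e / 2))) atTop (𝓝 (C * 0)) :=
    ((tendsto_rpow_neg_atTop (by linarith)).comp tendsto_natCast_atTop_atTop).const_mul C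
  rw [mul_zero] at h0
  refine squeeze_zero' (hv.1.mono fun n hn => hn.le) ?_ h0
  filter_upwards [hC, eventually_gt_atTop 0] with n h1 h2
  have : (0 : ℝ) < (n : ℝ) ^ (-e / 2) := by positivity
  rw [Real.rpow_neg (by positivity), ← div_eq_mul_inv, le_div_iff₀ this]
  exact h1

end EvGS

/-- The logarithmic factor `1 + log n`. -/
noncomputable def logFactor (n : ℕ) : ℝ := 1 + Real.log n

theorem one_le_logFactor (n : ℕ) : 1 ≤ logFactor n := by
  simp [logFactor, Real.log_natCast_nonneg]

theorem logFactor_mono : Monotone logFactor := by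
  intro m n hmn
  unfold logFactor
  rcases Nat.eq_zero_or_pos m with rfl | hm
  · simp [Real.log_natCast_nonneg]
  · gcongr

/-- `n (log n - log (n-1))` stays bounded while the denominator tends to infinity. Having exponent
0, logarithmic factors never affect the exponent conditions. -/
theorem evGS_logFactor : EvGS logFactor 0 := by
  refine ⟨Eventually.of_forall fun n => one_pos.trans_le (one_le_logFactor n), ?_⟩
  have h1 : Tendsto logFactor atTop atTop :=
    tendsto_atTop_add_const_left _ _ (Real.tendsto_log_atTop.comp tendsto_natCast_atTop_atTop)
  have h2 : Tendsto (fun n => 2 * (logFactor n)⁻¹) atTop (𝓝 (2 * 0)) :=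
    h1.inv_tendsto_atTop.const_mul 2
  rw [mul_zero] at h2
  refine squeeze_zero' ?_ ?_ h2
  · filter_upwards with n
    have h3 := logFactor_mono (Nat.sub_le n 1)
    have h4 : 0 < logFactor n := one_pos.trans_le (one_le_logFactor n)
    have : logFactor (n - 1) / logFactor n ≤ 1 := (div_le_one h4).2 h3
    exact mul_nonneg (Nat.cast_nonneg n) (by linarith)
  · filter_upwards [eventually_ge_atTop 2] with n hn
    have h4 : 0 < logFactor n := one_pos.trans_le (one_le_logFactor n)
    have hn' : (2 : ℝ) ≤ n := by exact_mod_cast hn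
    have h5 : ((n - 1 : ℕ) : ℝ) = n - 1 := by rw [Nat.cast_sub (by omega)]; simp
    have h6 : logFactor n - logFactor (n - 1) ≤ 2 / n := by
      unfold logFactor
      rw [h5]
      have h7 : (0 : ℝ) < n - 1 := by linarith
      have h8 := Real.log_le_sub_one_of_pos (show 0 < (n : ℝ) / (n - 1) by positivity)
      rw [Real.log_div (by positivity) h7.ne'] at h8
      have h9 : (n : ℝ) / (n - 1) - 1 ≤ 2 / n := by
        rw [div_sub_one h7.ne', div_le_div_iff₀ h7 (by positivity)]
        linarith
      linarith
    have h10 : (n : ℝ) * (1 - logFactor (n - 1) / logFactor n) =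
        n * (logFactor n - logFactor (n - 1)) * (logFactor n)⁻¹ := by
      field_simp
    rw [h10]
    gcongr
    calc (n : ℝ) * (logFactor n - logFactor (n - 1)) ≤ n * (2 / n) := by gcongr
      _ = 2 := by field_simp

end Revesz

/-! ### Taylor expansion in `s`, kernel bias, and expectations under the law of a pair. -/

namespace Revesz

/-- The integrand is the derivative of `v ↦ φ v + (b - v) φ' v`. -/
theorem integral_taylor {φ : ℝ → ℝ} (hφ : ContDiff ℝ 2 φ) (x b : ℝ) :
    ∫ v in x..b, (b - v) * iteratedDeriv 2 φ v = φ b - φ x - (b - x) * deriv φ x := by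
  have h2 : Continuous (iteratedDeriv 2 φ) := hφ.continuous_iteratedDeriv 2 le_rfl
  have h1 : ∀ v, HasDerivAt φ (deriv φ v) v := fun v =>
    (hφ.differentiable (by norm_num) v).hasDerivAt
  have hd : ∀ v, HasDerivAt (deriv φ) (iteratedDeriv 2 φ v) v := by
    intro v
    have h3 := hφ.differentiable_iteratedDeriv 1 (by norm_num)
    rw [iteratedDeriv_one] at h3
    rw [iteratedDeriv_succ, iteratedDeriv_one]
    exact (h3 v).hasDerivAt
  have h4 : ∀ v ∈ uIcc x b, HasDerivAt (fun v => φ v + (b - v) * deriv φ v)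
      ((b - v) * iteratedDeriv 2 φ v) v := by
    intro v _
    have := (h1 v).add (((hasDerivAt_id v).const_sub b).mul (hd v))
    refine this.congr_deriv ?_
    simp
  rw [intervalIntegral.integral_eq_sub_of_hasDerivAt h4
    (((continuous_const.sub continuous_id).mul h2).intervalIntegrable _ _)]
  ring

theorem A3.integrable_joint {g : ℝ → ℝ → ℝ} {x : ℝ} (h : A3 g x) {p : ℕ} (hp : p ≤ 1) (b : ℝ) :
    Integrable (Function.uncurry fun v t => (b - v) * (t ^ p * partialSS g v t))
      ((volume.restrict (uIoc x b)).prod volume) := by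
  have h1 := h.second_deriv_joint p hp (max |x| |b|)
  have hsub : uIoc x b ×ˢ (univ : Set ℝ) ⊆ Icc (-(max |x| |b|)) (max |x| |b|) ×ˢ univ := by
    apply prod_mono _ subset_rfl
    intro v hv
    have hv' := uIoc_subset_uIcc hv
    rw [mem_Icc, ← abs_le]
    rcases le_total x b with hxb | hxb
    · rw [uIcc_of_le hxb] at hv'
      exact abs_le_max_abs_abs hv'.1 hv'.2
    · rw [uIcc_of_ge hxb] at hv'
      rw [max_comm]
      exact abs_le_max_abs_abs hv'.1 hv'.2
  have h2 := h1.mono_set hsub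
  have h5 : (volume.restrict (uIoc x b)).prod (volume : Measure ℝ) =
      (volume : Measure (ℝ × ℝ)).restrict (uIoc x b ×ˢ univ) := by
    rw [Measure.volume_eq_prod, ← Measure.prod_restrict, Measure.restrict_univ]
  rw [h5]
  refine Integrable.bdd_mul (c := |b - x|) (f := fun q : ℝ × ℝ => b - q.1) h2
    (by fun_prop) ?_
  rw [ae_restrict_iff' (measurableSet_uIoc.prod MeasurableSet.univ)]
  refine Eventually.of_forall fun q hq => ?_
  have hv' := uIoc_subset_uIcc hq.1
  exact abs_sub_right_of_mem_uIcc hv'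

/-- Second-order expansion of `s ↦ ∫ t ^ p * g s t` at `x`. -/
theorem A3.taylor {g : ℝ → ℝ → ℝ} {x : ℝ} (h : A3 g x) {p : ℕ} (hp : p ≤ 1) {C : ℝ}
    (hC : ∀ s, |∫ t, t ^ p * partialSS g s t| ≤ C) (b : ℝ) :
    |(∫ t, t ^ p * g b t) - (∫ t, t ^ p * g x t) - (b - x) * ∫ t, t ^ p * partialS g x t| ≤
      C * (b - x) ^ 2 := by
  have key : ∀ b t, ∫ v in x..b, (b - v) * (t ^ p * partialSS g v t) =
      t ^ p * g b t - t ^ p * g x t - (b - x) * (t ^ p * partialS g x t) := by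
    intro b t
    have := integral_taylor (h.contDiff t) x b
    calc ∫ v in x..b, (b - v) * (t ^ p * partialSS g v t)
        = ∫ v in x..b, t ^ p * ((b - v) * partialSS g v t) := by
          congr 1; ext v; ring
      _ = t ^ p * ∫ v in x..b, ((b - v) * partialSS g v t) :=
          intervalIntegral.integral_const_mul _ _
      _ = _ := by
        unfold partialSS partialS
        rw [this]; ring
  have hg : ∀ s, Integrable (fun t => t ^ p * g s t) := (h.moment p (by omega)).1
  have hint : ∀ b, Integrable (fun t => ∫ v in x..b, (b - v) * (t ^ p * partialSS g v t)) := by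
    intro b
    have h1 := (h.integrable_joint hp b).integral_prod_right
    simp only [intervalIntegral]
    rcases le_total x b with hxb | hxb
    · simp only [uIoc_of_le hxb] at h1
      simpa [hxb] using h1
    · simp only [uIoc_of_ge hxb] at h1
      simpa [hxb] using h1.neg
  -- At `b = x + 1` the coefficient of the first derivative in the pointwise Taylor formula is 1, so
  -- this derivative is a combination of integrable functions.
  have hS : Integrable (fun t => t ^ p * partialS g x t) := by
    have h1 := ((hg (x + 1)).sub (hg x)).sub (hint (x + 1))
    refine h1.congr (Eventually.of_forall fun t => ?_)
    simp only [Pi.sub_apply, key]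
    ring
  -- Integrating the pointwise formula over `t` and exchanging the integrals turns the remainder
  -- into one that involves only `∫ t ^ p * partialSS g v t`, bounded by `C`.
  have hswap := intervalIntegral_integral_swap (h.integrable_joint hp b)
  simp only [key] at hswap
  have hgg : Integrable (fun t => t ^ p * g b t - t ^ p * g x t) := (hg b).sub (hg x)
  rw [integral_sub hgg (hS.const_mul _), integral_sub (hg b) (hg x),
    integral_const_mul] at hswap
  rw [← hswap]
  have hb := intervalIntegral.norm_integral_le_of_norm_le_const (a := x) (b := b)
    (f := fun v => ∫ t, (b - v) * (t ^ p * partialSS g v t)) (C := |b - x| * C) ?_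
  · rw [Real.norm_eq_abs] at hb
    refine hb.trans (le_of_eq ?_)
    rw [← sq_abs (b - x)]; ring
  · intro v hv
    rw [integral_const_mul, Real.norm_eq_abs, abs_mul]
    have hv' := uIoc_subset_uIcc hv
    have : |b - v| ≤ |b - x| := abs_sub_right_of_mem_uIcc hv'
    exact mul_le_mul this (hC v) (abs_nonneg _) (abs_nonneg _)

/-- The rescaled kernel `s⁻¹ K (s⁻¹ (x - u))` with bandwidth `s`. -/
noncomputable def scaled (K : ℝ → ℝ) (s x u : ℝ) : ℝ := s⁻¹ * K (s⁻¹ * (x - u))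

theorem integral_scaled (ψ : ℝ → ℝ) {s : ℝ} (hs : 0 < s) (x : ℝ) :
    ∫ u, scaled ψ s x u = ∫ z, ψ z := by
  unfold scaled
  rw [integral_const_mul, integral_sub_left_eq_self (fun z => ψ (s⁻¹ * z)) volume x,
    Measure.integral_comp_mul_left, inv_inv, abs_of_pos hs, smul_eq_mul, ← mul_assoc,
    inv_mul_cancel₀ hs.ne', one_mul]

theorem integrable_scaled {ψ : ℝ → ℝ} (hψ : Integrable ψ) {s : ℝ} (hs : 0 < s) (x : ℝ) :
    Integrable (scaled ψ s x) := by
  unfold scaled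
  apply Integrable.const_mul
  exact (hψ.comp_mul_left' (inv_ne_zero hs.ne')).comp_sub_left x

namespace A1

variable {K : ℝ → ℝ} (hK : A1 K)
include hK

theorem integrable : Integrable K := by
  by_contra h
  have := hK.integral_eq_one
  rw [integral_undef h] at this
  exact zero_ne_one this

theorem scaled_nonneg {s : ℝ} (hs : 0 < s) (x u : ℝ) : 0 ≤ scaled K s x u :=
  mul_nonneg (inv_pos.2 hs).le (hK.nonneg _)

/-- After the substitution `u = x - s z`, the constant term is reproduced because `K` has mass 1,
the linear term vanishes because `K` has first moment 0, and the quadratic remainder contributes `s²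
∫ z² K`. The Taylor bound is needed for all `u`, since `K` need not have compact support. -/
theorem bias_le {φ : ℝ → ℝ} (hφ : Measurable φ) {C₀ : ℝ} (hφ₀ : ∀ u, |φ u| ≤ C₀)
    {x D C : ℝ} (hT : ∀ u, |φ u - φ x - (u - x) * D| ≤ C * (u - x) ^ 2) {s : ℝ} (hs : 0 < s) :
    |(∫ u, scaled K s x u * φ u) - φ x| ≤ (C * ∫ z, z ^ 2 * K z) * s ^ 2 := by
  have e1 : ∀ u, (u - x) * scaled K s x u = -s * scaled (fun z => z * K z) s x u := by
    intro u; unfold scaled; field_simp; ring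
  have e2 : ∀ u, (u - x) ^ 2 * scaled K s x u = s ^ 2 * scaled (fun z => z ^ 2 * K z) s x u := by
    intro u; unfold scaled; field_simp; ring
  have i0 : Integrable (scaled K s x) := integrable_scaled hK.integrable hs x
  have i1 : Integrable (fun u => (u - x) * scaled K s x u) := by
    simp only [e1]; exact (integrable_scaled hK.integrable_mul hs x).const_mul _
  have i2 : Integrable (fun u => (u - x) ^ 2 * scaled K s x u) := by
    simp only [e2]; exact (integrable_scaled hK.integrable_sq_mul hs x).const_mul _
  have i3 : Integrable (fun u => scaled K s x u * φ u) :=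
    i0.mul_bdd hφ.aestronglyMeasurable (Eventually.of_forall hφ₀)
  have hm : ∫ u, scaled K s x u * (φ u - φ x - (u - x) * D) =
      (∫ u, scaled K s x u * φ u) - φ x := by
    have : (fun u => scaled K s x u * (φ u - φ x - (u - x) * D)) =
        fun u => scaled K s x u * φ u - φ x * scaled K s x u - D * ((u - x) * scaled K s x u) := by
      ext u; ring
    have i4 : Integrable (fun u => scaled K s x u * φ u - φ x * scaled K s x u) :=
      i3.sub (i0.const_mul _)
    rw [this, integral_sub i4 (i1.const_mul _),
      integral_sub i3 (i0.const_mul _), integral_const_mul, integral_const_mul,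
      integral_scaled K hs, hK.integral_eq_one]
    simp only [e1]
    rw [integral_const_mul, integral_scaled (fun z => z * K z) hs, hK.integral_mul_eq_zero]
    ring
  rw [← hm, ← Real.norm_eq_abs]
  have hle := norm_integral_le_of_norm_le (f := fun u => scaled K s x u * (φ u - φ x - (u - x) * D))
    (i2.const_mul C) (Eventually.of_forall fun u => ?_)
  · refine hle.trans (le_of_eq ?_)
    simp only [e2]
    rw [integral_const_mul, integral_const_mul, integral_scaled (fun z => z ^ 2 * K z) hs]
    ring
  · rw [Real.norm_eq_abs, abs_mul, abs_of_nonneg (hK.scaled_nonneg hs x u)]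
    calc scaled K s x u * |φ u - φ x - (u - x) * D|
        ≤ scaled K s x u * (C * (u - x) ^ 2) :=
          mul_le_mul_of_nonneg_left (hT u) (hK.scaled_nonneg hs x u)
      _ = _ := by ring

end A1

/-- The common law of the pairs. -/
noncomputable def pairLaw (g : ℝ → ℝ → ℝ) : Measure (ℝ × ℝ) :=
  (volume : Measure (ℝ × ℝ)).withDensity (fun p => ENNReal.ofReal (g p.1 p.2))

section Law

variable {g : ℝ → ℝ → ℝ} (hgm : Measurable (fun p : ℝ × ℝ => g p.1 p.2))
  (hg0 : ∀ s t, 0 ≤ g s t)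
include hgm hg0

theorem integrable_pairLaw {ψ : ℝ → ℝ} (hψm : Measurable ψ) (hψ : Integrable ψ) {p : ℕ}
    (hp : ∀ s, Integrable (fun t => t ^ p * g s t)) {C : ℝ}
    (hC : ∀ s, ∫ t, |t| ^ p * g s t ≤ C) :
    Integrable (fun z : ℝ × ℝ => z.2 ^ p * ψ z.1 * g z.1 z.2) := by
  have hmeas : Measurable (fun z : ℝ × ℝ => z.2 ^ p * ψ z.1 * g z.1 z.2) :=
    ((measurable_snd.pow_const p).mul (hψm.comp measurable_fst)).mul hgm
  rw [Measure.volume_eq_prod, integrable_prod_iff hmeas.aestronglyMeasurable]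
  have heq : ∀ s t, ‖t ^ p * ψ s * g s t‖ = |ψ s| * (|t| ^ p * g s t) := by
    intro s t
    rw [Real.norm_eq_abs, abs_mul, abs_mul, abs_pow, abs_of_nonneg (hg0 s t)]; ring
  refine ⟨Eventually.of_forall fun s => ?_, ?_⟩
  · refine ((hp s).const_mul (ψ s)).congr (Eventually.of_forall fun t => ?_)
    simp only; ring
  · refine (hψ.abs.const_mul C).mono'
      hmeas.stronglyMeasurable.norm.integral_prod_right'.aestronglyMeasurable
      (Eventually.of_forall fun s => ?_)
    simp only [heq]
    rw [integral_const_mul, Real.norm_eq_abs, abs_mul, abs_abs, mul_comm]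
    have h0 : 0 ≤ ∫ t, |t| ^ p * g s t :=
      integral_nonneg fun t => mul_nonneg (by positivity) (hg0 s t)
    rw [abs_of_nonneg h0]
    exact mul_le_mul_of_nonneg_right (hC s) (abs_nonneg _)

theorem integral_pairLaw {ψ : ℝ → ℝ} (hψm : Measurable ψ) (hψ : Integrable ψ) {p : ℕ}
    (hp : ∀ s, Integrable (fun t => t ^ p * g s t)) {C : ℝ}
    (hC : ∀ s, ∫ t, |t| ^ p * g s t ≤ C) :
    Integrable (fun z : ℝ × ℝ => z.2 ^ p * ψ z.1) (pairLaw g) ∧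
      ∫ z, z.2 ^ p * ψ z.1 ∂(pairLaw g) = ∫ s, ψ s * ∫ t, t ^ p * g s t := by
  have h1 := integrable_pairLaw hgm hg0 hψm hψ hp hC
  have ht : ∀ z : ℝ × ℝ, (ENNReal.ofReal (g z.1 z.2)).toReal = g z.1 z.2 := fun z =>
    ENNReal.toReal_ofReal (hg0 _ _)
  constructor
  · unfold pairLaw
    rw [integrable_withDensity_iff hgm.ennreal_ofReal
      (Eventually.of_forall fun _ => ENNReal.ofReal_lt_top)]
    simpa only [ht] using h1
  · unfold pairLaw
    rw [integral_withDensity_eq_integral_toReal_smul hgm.ennreal_ofReal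
      (Eventually.of_forall fun _ => ENNReal.ofReal_lt_top)]
    simp only [ht, smul_eq_mul]
    have h2 : (fun z : ℝ × ℝ => g z.1 z.2 * (z.2 ^ p * ψ z.1)) =
        fun z => z.2 ^ p * ψ z.1 * g z.1 z.2 := by ext z; ring
    rw [h2, Measure.volume_eq_prod, integral_prod _ (by rwa [← Measure.volume_eq_prod])]
    congr 1; ext s
    rw [← integral_const_mul]
    congr 1; ext t; ring

end Law

end Revesz

/-! ### Truncation of the responses and moment bounds uniform over the interval. -/

namespace Revesz

/-- Truncation of `v` at the levels `±b`. -/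
noncomputable def clip (b v : ℝ) : ℝ := max (-b) (min v b)

theorem abs_clip_le {b : ℝ} (hb : 0 ≤ b) (v : ℝ) : |clip b v| ≤ b := by
  rw [abs_le, clip]
  exact ⟨le_max_left _ _, max_le (by linarith) (min_le_right _ _)⟩

theorem clip_of_abs_le {b v : ℝ} (h : |v| ≤ b) : clip b v = v := by
  rw [abs_le] at h
  rw [clip, min_eq_left h.2, max_eq_right h.1]

theorem abs_clip_le_abs {b : ℝ} (hb : 0 ≤ b) (v : ℝ) : |clip b v| ≤ |v| := by
  rcases le_total |v| b with h | h
  · rw [clip_of_abs_le h]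
  · exact (abs_clip_le hb v).trans h

theorem measurable_clip (b : ℝ) : Measurable (clip b) :=
  measurable_const.max (measurable_id.min measurable_const)

theorem abs_sub_clip_le {b : ℝ} (hb : 0 ≤ b) (v : ℝ) : |clip b v - v| ≤ |v| := by
  rcases le_or_gt |v| b with h | h
  · simp [clip_of_abs_le h]
  · unfold clip
    rcases abs_cases v with ⟨h1, h2⟩ | ⟨h1, h2⟩
    · rw [h1] at h ⊢
      rw [min_eq_right h.le, max_eq_right (by linarith), abs_le]
      constructor <;> linarith
    · rw [h1] at h ⊢
      rw [min_eq_left (by linarith), max_eq_left (by linarith), abs_le]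
      constructor <;> linarith

/-- The error vanishes unless `|v| > b`. There it is at most `|v| ≤ (2/τ) exp(τ|v|/2)`, and the
factor `exp(τ(|v| - b)/2) ≥ 1` may be inserted. -/
theorem abs_sub_clip_le_exp {b τ : ℝ} (hb : 0 ≤ b) (hτ : 0 < τ) (v : ℝ) :
    |clip b v - v| ≤ 2 / τ * Real.exp (-(τ * b / 2)) * Real.exp (τ * |v|) := by
  rcases le_or_gt |v| b with h | h
  · rw [clip_of_abs_le h]
    simp only [sub_self, abs_zero]
    positivity
  · refine (abs_sub_clip_le hb v).trans ?_
    have h1 : τ * |v| / 2 ≤ Real.exp (τ * |v| / 2) := by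
      linarith [Real.add_one_le_exp (τ * |v| / 2)]
    have h2 : (1 : ℝ) ≤ Real.exp (τ * |v| / 2 - τ * b / 2) := by
      apply Real.one_le_exp
      nlinarith
    have h3 : Real.exp (-(τ * b / 2)) * Real.exp (τ * |v|) =
        Real.exp (τ * |v| / 2 - τ * b / 2) * Real.exp (τ * |v| / 2) := by
      rw [← Real.exp_add, ← Real.exp_add]; ring_nf
    rw [mul_assoc, h3]
    calc |v| = 2 / τ * (1 * (τ * |v| / 2)) := by field_simp
      _ ≤ _ := by gcongr

section Context

variable {K : ℝ → ℝ} {g : ℝ → ℝ → ℝ}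

/-- Bounds, uniform over the interval `I`, on the moments of the kernel terms and of the
truncated noise under the law `ν` of a pair; `f` is the marginal density and `r` the regression
function. -/
structure MomentBounds (ν : Measure (ℝ × ℝ)) (K : ℝ → ℝ) (h : ℕ → ℝ) (I : Set ℝ)
    (f r : ℝ → ℝ) (A C f₀ : ℝ) : Prop where
  pos : 0 < f₀
  le_density : ∀ x ∈ I, f₀ ≤ f x
  density_le : ∀ x ∈ I, f x ≤ C
  abs_regression_le : ∀ x ∈ I, |r x| ≤ C
  regression_lipschitz : ∀ x ∈ I, ∀ y ∈ I, |r x - r y| ≤ C * |x - y|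
  mean_kernel : ∀ᶠ k in atTop, ∀ x ∈ I,
    |(∫ z, scaled K (h k) x z.1 ∂ν) - f x| ≤ C * h k ^ 2
  mean_noise : ∀ᶠ k in atTop, ∀ x ∈ I,
    |∫ z, (clip (A * logFactor k) z.2 - r x) * scaled K (h k) x z.1 ∂ν| ≤ C * h k ^ 2
  sq_kernel : ∀ᶠ k in atTop, ∀ x ∈ I, ∫ z, scaled K (h k) x z.1 ^ 2 ∂ν ≤ C * (h k)⁻¹
  sq_noise : ∀ᶠ k in atTop, ∀ x ∈ I,
    ∫ z, ((clip (A * logFactor k) z.2 - r x) * scaled K (h k) x z.1) ^ 2 ∂ν ≤ C * (h k)⁻¹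

theorem A3.abs_moment_le {x : ℝ} (h : A3 g x) (hg0 : ∀ s t, 0 ≤ g s t) :
    ∃ C, ∀ p : ℕ, p ≤ 2 → ∀ s, ∫ t, |t| ^ p * g s t ≤ C := by
  obtain ⟨i0, ⟨C0, h0⟩, -⟩ := h.moment 0 (by norm_num)
  obtain ⟨i2, ⟨C2, h2⟩, -⟩ := h.moment 2 (by norm_num)
  refine ⟨C0 + C2, fun p hp s => ?_⟩
  have h3 : ∫ t, |t| ^ p * g s t ≤ ∫ t, (t ^ 0 * g s t + t ^ 2 * g s t) := by
    apply integral_mono_of_nonneg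
    · exact Eventually.of_forall fun t => mul_nonneg (by positivity) (hg0 s t)
    · exact (i0 s).add (i2 s)
    · refine Eventually.of_forall fun t => ?_
      simp only
      rw [← add_mul]
      apply mul_le_mul_of_nonneg_right _ (hg0 s t)
      rw [← sq_abs t]
      have := abs_nonneg t
      interval_cases p
      · simp; positivity
      · nlinarith [sq_nonneg (|t| - 1)]
      · simp
  rw [integral_add (i0 s) (i2 s)] at h3
  linarith [(abs_le.1 (h0 s)).2, (abs_le.1 (h2 s)).2]

/-- The expansion at the point `u = x + 1` bounds `D x` through the bound on `φ`; the quadratic term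
is linear in `|x - y|` on a bounded interval. -/
theorem lipschitz_of_taylor {φ : ℝ → ℝ} {D : ℝ → ℝ} {C₀ C : ℝ} {c d : ℝ}
    (h0 : ∀ u, |φ u| ≤ C₀)
    (hT : ∀ x ∈ Ioo c d, ∀ u, |φ u - φ x - (u - x) * D x| ≤ C * (u - x) ^ 2) :
    ∃ L, ∀ x ∈ Ioo c d, ∀ y ∈ Ioo c d, |φ x - φ y| ≤ L * |x - y| := by
  refine ⟨2 * C₀ + |C| + |C| * (d - c), fun x hx y hy => ?_⟩
  have hC := le_abs_self C
  have hD : |D x| ≤ 2 * C₀ + |C| := by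
    have h1 := hT x hx (x + 1)
    have h2 := abs_le.1 (h0 x)
    have h3 := abs_le.1 (h0 (x + 1))
    have h4 := abs_le.1 h1
    rw [abs_le]
    simp only [add_sub_cancel_left, one_mul, one_pow, mul_one] at h4
    constructor <;> linarith
  have h5 := hT x hx y
  have h6 : |x - y| ≤ d - c := by
    rw [abs_le]; constructor <;> linarith [hx.1, hx.2, hy.1, hy.2]
  have h7 : φ x - φ y = -(φ y - φ x - (y - x) * D x) + (x - y) * D x := by ring
  have h8 := abs_nonneg (x - y)
  calc |φ x - φ y| ≤ C * (y - x) ^ 2 + |x - y| * |D x| := by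
        rw [h7]
        refine (abs_add_le _ _).trans ?_
        rw [abs_neg, abs_mul]
        gcongr
    _ ≤ |C| * (|x - y| * (d - c)) + |x - y| * (2 * C₀ + |C|) := by
        gcongr
        rw [← sq_abs (y - x), abs_sub_comm y x, sq]
        gcongr
    _ = _ := by ring

/-- One kernel factor is bounded by `M / s`; the other integrates to 1. -/
theorem integral_sq_scaled_mul_le (hK : A1 K) {M : ℝ} (hM : ∀ z, K z ≤ M) {φ : ℝ → ℝ}
    {C : ℝ} (hφ : ∀ u, φ u ≤ C) (hφ0 : ∀ u, 0 ≤ φ u)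
    {s : ℝ} (hs : 0 < s) (x : ℝ) :
    Integrable (fun u => scaled K s x u ^ 2) ∧
      ∫ u, scaled K s x u ^ 2 * φ u ≤ C * M * s⁻¹ := by
  have i0 : Integrable (scaled K s x) := integrable_scaled hK.integrable hs x
  have hb : ∀ u, scaled K s x u ≤ M * s⁻¹ := fun u => by
    unfold scaled
    rw [mul_comm]
    exact mul_le_mul_of_nonneg_right (hM _) (inv_pos.2 hs).le
  have hn := hK.scaled_nonneg hs x
  have hC0 : 0 ≤ C := (hφ0 0).trans (hφ 0)
  have hM0 : 0 ≤ M := (hK.nonneg 0).trans (hM 0)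
  constructor
  · refine (i0.const_mul (M * s⁻¹)).mono' (i0.aestronglyMeasurable.pow 2)
      (Eventually.of_forall fun u => ?_)
    rw [Real.norm_eq_abs, abs_of_nonneg (sq_nonneg _), sq]
    exact mul_le_mul_of_nonneg_right (hb u) (hn u)
  · have : ∫ u, scaled K s x u ^ 2 * φ u ≤ ∫ u, C * M * s⁻¹ * scaled K s x u := by
      apply integral_mono_of_nonneg
      · exact Eventually.of_forall fun u => mul_nonneg (sq_nonneg _) (hφ0 u)
      · exact i0.const_mul _
      · refine Eventually.of_forall fun u => ?_
        simp only
        have h1 : scaled K s x u ^ 2 ≤ M * s⁻¹ * scaled K s x u := by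
          rw [sq]; exact mul_le_mul_of_nonneg_right (hb u) (hn u)
        calc scaled K s x u ^ 2 * φ u ≤ (M * s⁻¹ * scaled K s x u) * C :=
              mul_le_mul h1 (hφ u) (hφ0 u) (mul_nonneg (by positivity) (hn u))
          _ = _ := by ring
    refine this.trans (le_of_eq ?_)
    rw [integral_const_mul, integral_scaled K hs, hK.integral_eq_one, mul_one]

/-- Everything reduces to `φ p s = ∫ t ^ p * g s t` for `p = 0, 1, 2`. The truncation level `(4/τ)
(1 + log k)` makes the truncation error `O(h_k⁻¹ k⁻²)`, which is `O(h_k²)` because `3a < 2`. The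
bounds of `A3` taken at the midpoint serve for all `x`, since they are uniform in `s`. -/
theorem momentBounds (hK : A1 K) {h : ℕ → ℝ} {a : ℝ} (hh : GS h (-a)) (ha : 3 * a < 2)
    (hgm : Measurable (fun p : ℝ × ℝ => g p.1 p.2)) (hg0 : ∀ s t, 0 ≤ g s t)
    [IsProbabilityMeasure (pairLaw g)] {c d : ℝ} (hcd : c < d)
    (hf : 0 < ⨅ x : Set.Ioo c d, marginal g x) (hA3 : ∀ x ∈ Ioo c d, A3 g x)
    {τ : ℝ} (hτ : 0 < τ) (hexp : Integrable (fun z => Real.exp (τ * |z.2|)) (pairLaw g)) :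
    ∃ C f₀, MomentBounds (pairLaw g) K h (Ioo c d) (marginal g) (regression g) (4 / τ) C f₀ := by
  have hx₀ : (c + d) / 2 ∈ Ioo c d := ⟨by linarith, by linarith⟩
  have hA := hA3 _ hx₀
  obtain ⟨M, hM⟩ := hK.bounded
  have hM0 : 0 ≤ M := (hK.nonneg 0).trans (hM 0)
  obtain ⟨Ca, hCa⟩ := hA.abs_moment_le hg0
  obtain ⟨-, ⟨Cs0, hCs0⟩, -⟩ := hA.second_deriv 0 (by norm_num)
  obtain ⟨-, ⟨Cs1, hCs1⟩, -⟩ := hA.second_deriv 1 le_rfl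
  have hi : ∀ p : ℕ, p ≤ 2 → ∀ s, Integrable (fun t => t ^ p * g s t) := fun p hp =>
    (hA.moment p hp).1
  set φ : ℕ → ℝ → ℝ := fun p s => ∫ t, t ^ p * g s t with hφ
  have hφm : ∀ p, Measurable (φ p) := fun p => by
    have : StronglyMeasurable (fun z : ℝ × ℝ => z.2 ^ p * g z.1 z.2) :=
      ((measurable_snd.pow_const p).mul hgm).stronglyMeasurable
    exact this.integral_prod_right'.measurable
  have hφb : ∀ p : ℕ, p ≤ 2 → ∀ s, |φ p s| ≤ Ca := fun p hp s => by
    refine le_trans ?_ (hCa p hp s)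
    rw [← Real.norm_eq_abs]
    refine (norm_integral_le_integral_norm _).trans (le_of_eq ?_)
    congr 1; ext t
    rw [Real.norm_eq_abs, abs_mul, abs_pow, abs_of_nonneg (hg0 s t)]
  have hCa0 : 0 ≤ Ca := (abs_nonneg _).trans (hφb 0 (by norm_num) 0)
  have hmarg : ∀ x, marginal g x = φ 0 x := fun x => by simp [marginal, hφ]
  have hreg : ∀ x, regression g x = φ 1 x / φ 0 x := fun x => by
    rw [regression, hmarg]; simp [hφ]
  have hφ0 : ∀ p : ℕ, Even p → ∀ s, 0 ≤ φ p s := fun p hp s =>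
    integral_nonneg fun t => mul_nonneg (hp.pow_nonneg t) (hg0 s t)
  set f₀ := ⨅ x : Set.Ioo c d, marginal g x with hf₀
  have hfl : ∀ x ∈ Ioo c d, f₀ ≤ φ 0 x := fun x hx => by
    rw [← hmarg]
    refine ciInf_le (f := fun x : Set.Ioo c d => marginal g x) ⟨0, ?_⟩ ⟨x, hx⟩
    rintro _ ⟨y, rfl⟩
    simp only [hmarg]; exact hφ0 0 (by simp) _
  have hT0 : ∀ x ∈ Ioo c d, ∀ u, |φ 0 u - φ 0 x - (u - x) * ∫ t, t ^ 0 * partialS g x t| ≤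
      Cs0 * (u - x) ^ 2 := fun x hx u => (hA3 x hx).taylor (by norm_num) hCs0 u
  have hT1 : ∀ x ∈ Ioo c d, ∀ u, |φ 1 u - φ 1 x - (u - x) * ∫ t, t ^ 1 * partialS g x t| ≤
      Cs1 * (u - x) ^ 2 := fun x hx u => (hA3 x hx).taylor (by norm_num) hCs1 u
  obtain ⟨L0, hL0⟩ := lipschitz_of_taylor (hφb 0 (by norm_num)) hT0
  obtain ⟨L1, hL1⟩ := lipschitz_of_taylor (hφb 1 (by norm_num)) hT1
  set J := ∫ z, z ^ 2 * K z with hJ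
  have hJ0 : 0 ≤ J := integral_nonneg fun z => mul_nonneg (sq_nonneg _) (hK.nonneg z)
  have hr : ∀ x ∈ Ioo c d, |regression g x| ≤ Ca / f₀ := fun x hx => by
    rw [hreg, abs_div, abs_of_nonneg (hφ0 0 (by simp) x)]
    exact div_le_div₀ hCa0 (hφb 1 (by norm_num) x) hf (hfl x hx)
  -- expectations as integrals over the line
  have hsm : ∀ s x, Measurable (scaled K s x) := fun s x => by
    unfold scaled
    have := hK.continuous.measurable
    fun_prop
  have hE : ∀ p : ℕ, p ≤ 1 → ∀ s, 0 < s → ∀ x,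
      Integrable (fun z : ℝ × ℝ => z.2 ^ p * scaled K s x z.1) (pairLaw g) ∧
      ∫ z, z.2 ^ p * scaled K s x z.1 ∂(pairLaw g) = ∫ u, scaled K s x u * φ p u :=
    fun p hp s hs x => integral_pairLaw hgm hg0 (hsm s x) (integrable_scaled hK.integrable hs x)
      (hi p (by omega)) (hCa p (by omega))
  have hE2 : ∀ p : ℕ, p ≤ 2 → Even p → ∀ s, 0 < s → ∀ x,
      Integrable (fun z : ℝ × ℝ => z.2 ^ p * scaled K s x z.1 ^ 2) (pairLaw g) ∧
      ∫ z, z.2 ^ p * scaled K s x z.1 ^ 2 ∂(pairLaw g) ≤ Ca * M * s⁻¹ := fun p hp hev s hs x => by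
    obtain ⟨k1, k2⟩ := integral_sq_scaled_mul_le hK hM
      (fun u => (le_abs_self _).trans (hφb p hp u)) (hφ0 p hev) hs x
    have := integral_pairLaw hgm hg0 ((hsm s x).pow_const 2) k1 (hi p hp) (hCa p hp)
    exact ⟨this.1, this.2.trans_le k2⟩
  have hb0 : ∀ x ∈ Ioo c d, ∀ s, 0 < s →
      |(∫ z, scaled K s x z.1 ∂(pairLaw g)) - φ 0 x| ≤ (Cs0 * J) * s ^ 2 := fun x hx s hs => by
    have h1 := (hE 0 (by norm_num) s hs x).2
    simp only [pow_zero, one_mul] at h1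
    rw [h1]
    have := hK.bias_le (hφm 0) (hφb 0 (by norm_num)) (hT0 x hx) hs
    simpa [hφ] using this
  have hb1 : ∀ x ∈ Ioo c d, ∀ s, 0 < s →
      |(∫ z, z.2 * scaled K s x z.1 ∂(pairLaw g)) - φ 1 x| ≤ (Cs1 * J) * s ^ 2 :=
    fun x hx s hs => by
    have h1 := (hE 1 le_rfl s hs x).2
    simp only [pow_one] at h1
    rw [h1]
    have := hK.bias_le (hφm 1) (hφb 1 (by norm_num)) (hT1 x hx) hs
    simpa [hφ] using this
  -- the truncation error
  set m := ∫ z, Real.exp (τ * |z.2|) ∂(pairLaw g) with hm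
  have hm0 : 0 ≤ m := integral_nonneg fun z => (Real.exp_pos _).le
  have htr : ∀ x, ∀ k : ℕ, 1 ≤ k → 0 < h k →
      |∫ z, (clip (4 / τ * logFactor k) z.2 - z.2) * scaled K (h k) x z.1 ∂(pairLaw g)| ≤
        2 / τ * M * m * ((h k)⁻¹ * ((k : ℝ) ^ 2)⁻¹) := fun x k hk hhk => by
    have hk' : (0 : ℝ) < k := by positivity
    have hl := one_le_logFactor k
    rw [← Real.norm_eq_abs]
    have hle := norm_integral_le_of_norm_le (μ := pairLaw g)
      (f := fun z => (clip (4 / τ * logFactor k) z.2 - z.2) * scaled K (h k) x z.1)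
      (hexp.const_mul (2 / τ * M * ((h k)⁻¹ * ((k : ℝ) ^ 2)⁻¹)))
      (Eventually.of_forall fun z => ?_)
    · refine hle.trans (le_of_eq ?_)
      rw [integral_const_mul]; ring
    · rw [Real.norm_eq_abs, abs_mul, abs_of_nonneg (hK.scaled_nonneg hhk x z.1)]
      have h1 := abs_sub_clip_le_exp (b := 4 / τ * logFactor k) (by positivity) hτ z.2
      -- The factor 4 in the truncation level is chosen to yield `k⁻²` here and `k⁻⁴` in the tail
      -- bound for `|Y k|`.
      have h2 : Real.exp (-(τ * (4 / τ * logFactor k) / 2)) ≤ ((k : ℝ) ^ 2)⁻¹ := by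
        have h4 : -(τ * (4 / τ * logFactor k) / 2) = -(2 * logFactor k) := by field_simp; ring
        rw [h4, Real.exp_neg]
        apply inv_anti₀ (by positivity)
        have h5 : (k : ℝ) ^ 2 = Real.exp (2 * Real.log k) := by
          rw [two_mul, Real.exp_add, Real.exp_log hk']; ring
        rw [h5]
        apply Real.exp_le_exp.2
        unfold logFactor; linarith
      have h3 : scaled K (h k) x z.1 ≤ M * (h k)⁻¹ := by
        unfold scaled; rw [mul_comm]
        exact mul_le_mul_of_nonneg_right (hM _) (inv_pos.2 hhk).le
      calc _ ≤ (2 / τ * ((k : ℝ) ^ 2)⁻¹ * Real.exp (τ * |z.2|)) * (M * (h k)⁻¹) := by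
            refine mul_le_mul (h1.trans ?_) h3 (hK.scaled_nonneg hhk x z.1) (by positivity)
            gcongr
        _ = _ := by ring
  -- the truncation error is of smaller order than the squared bandwidth
  have hEh := hh.evGS
  obtain ⟨Ch, hCh⟩ := (((hEh.inv.pow 3).mul ((EvGS.natCast).pow 2).inv)).eventually_le_of_neg
    (by push_cast; linarith)
  have htr' : ∀ᶠ k : ℕ in atTop, (h k)⁻¹ * ((k : ℝ) ^ 2)⁻¹ ≤ Ch * h k ^ 2 := by
    filter_upwards [hCh, hEh.1, eventually_gt_atTop 0] with k h1 h2 h3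
    have : (h k)⁻¹ * ((k : ℝ) ^ 2)⁻¹ = ((h k)⁻¹ ^ 3 * ((k : ℝ) ^ 2)⁻¹) * h k ^ 2 := by
      field_simp
    rw [this]
    exact mul_le_mul_of_nonneg_right h1 (sq_nonneg _)
  set R := Ca / f₀ with hR
  have hR0 : 0 ≤ R := div_nonneg hCa0 hf.le
  set Cm := |Cs1 * J| + R * |Cs0 * J| + 2 / τ * M * m * |Ch|
  set Lr := (|L1| + R * |L0|) / f₀
  have hLr : 0 ≤ Lr := by positivity
  have hCm : 0 ≤ Cm := by positivity
  set Cv := 2 * (Ca * M) + 2 * R ^ 2 * (Ca * M)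
  have hCv : 0 ≤ Cv := by positivity
  refine ⟨Ca + R + Lr + |Cs0 * J| + Cm + Ca * M + Cv, f₀, ⟨hf, ?_, ?_, ?_, ?_, ?_, ?_, ?_, ?_⟩⟩
  · intro x hx; rw [hmarg]; exact hfl x hx
  · intro x hx; rw [hmarg]
    have := (le_abs_self _).trans (hφb 0 (by norm_num) x)
    linarith [abs_nonneg (Cs0 * J), mul_nonneg hCa0 hM0]
  · intro x hx
    linarith [abs_nonneg (Cs0 * J), mul_nonneg hCa0 hM0, hr x hx]
  · intro x hx y hy
    have h1 : regression g x - regression g y =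
        ((φ 1 x - φ 1 y) - regression g y * (φ 0 x - φ 0 y)) / φ 0 x := by
      have e1 : φ 0 x ≠ 0 := (hf.trans_le (hfl x hx)).ne'
      have e2 : φ 0 y ≠ 0 := (hf.trans_le (hfl y hy)).ne'
      rw [hreg, hreg]; field_simp; ring
    have h2 : |regression g x - regression g y| ≤ Lr * |x - y| := by
      rw [h1, abs_div, abs_of_nonneg (hφ0 0 (by simp) x)]
      have h3 : |(φ 1 x - φ 1 y) - regression g y * (φ 0 x - φ 0 y)| ≤
          (|L1| + R * |L0|) * |x - y| := by
        refine (abs_sub _ _).trans ?_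
        rw [abs_mul, add_mul]
        have k1 := (hL1 x hx y hy).trans
          (mul_le_mul_of_nonneg_right (le_abs_self L1) (abs_nonneg _))
        have k0 := (hL0 x hx y hy).trans
          (mul_le_mul_of_nonneg_right (le_abs_self L0) (abs_nonneg _))
        have := mul_le_mul (hr y hy) k0 (abs_nonneg _) hR0
        linarith
      calc _ ≤ (|L1| + R * |L0|) * |x - y| / f₀ :=
            div_le_div₀ (by positivity) h3 hf (hfl x hx)
        _ = _ := by ring
    refine h2.trans (mul_le_mul_of_nonneg_right ?_ (abs_nonneg _))
    linarith [abs_nonneg (Cs0 * J), mul_nonneg hCa0 hM0]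
  · filter_upwards [hEh.1] with k hk x hx
    rw [hmarg]
    refine (hb0 x hx _ hk).trans (mul_le_mul_of_nonneg_right ?_ (sq_nonneg _))
    linarith [le_abs_self (Cs0 * J), mul_nonneg hCa0 hM0]
  · filter_upwards [hEh.1, htr', eventually_ge_atTop 1] with k hk ht hk1 x hx
    have i1 := (hE 1 le_rfl _ hk x).1
    have i0 := (hE 0 (by norm_num) _ hk x).1
    simp only [pow_one, pow_zero, one_mul] at i1 i0
    have ic : Integrable (fun z : ℝ × ℝ =>
        clip (4 / τ * logFactor k) z.2 * scaled K (h k) x z.1) (pairLaw g) := by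
      have hl := one_le_logFactor k
      exact i0.bdd_mul ((measurable_clip _).comp measurable_snd).aestronglyMeasurable
        (Eventually.of_forall fun z => abs_clip_le (by positivity) z.2)
    -- Since `r φ₀ = φ₁`, the leading terms of `E[Y K_h]` and of `r E[K_h]` cancel. There remain the
    -- truncation error and two smoothing biases, each of order `h_k²`.
    have hsplit : ∫ z, (clip (4 / τ * logFactor k) z.2 - regression g x) *
          scaled K (h k) x z.1 ∂(pairLaw g) =
        (∫ z, (clip (4 / τ * logFactor k) z.2 - z.2) * scaled K (h k) x z.1 ∂(pairLaw g)) +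
        ((∫ z, z.2 * scaled K (h k) x z.1 ∂(pairLaw g)) - φ 1 x) -
        regression g x * ((∫ z, scaled K (h k) x z.1 ∂(pairLaw g)) - φ 0 x) := by
      have e0 : φ 0 x ≠ 0 := (hf.trans_le (hfl x hx)).ne'
      have e1 : regression g x * φ 0 x = φ 1 x := by rw [hreg]; field_simp
      simp only [sub_mul]
      rw [integral_sub ic (i0.const_mul _), integral_sub ic i1, integral_const_mul, mul_sub, e1]
      ring
    rw [hsplit]
    have k0 := hb0 x hx _ hk
    have k1 := hb1 x hx _ hk
    have k2 := htr x k hk1 hk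
    have hsq := sq_nonneg (h k)
    have k3 : 2 / τ * M * m * ((h k)⁻¹ * ((k : ℝ) ^ 2)⁻¹) ≤ 2 / τ * M * m * |Ch| * h k ^ 2 := by
      rw [mul_assoc (2 / τ * M * m)]
      apply mul_le_mul_of_nonneg_left _ (by positivity)
      exact ht.trans (mul_le_mul_of_nonneg_right (le_abs_self _) hsq)
    have k4 : |regression g x * ((∫ z, scaled K (h k) x z.1 ∂(pairLaw g)) - φ 0 x)| ≤
        R * |Cs0 * J| * h k ^ 2 := by
      rw [abs_mul, mul_assoc]
      refine mul_le_mul (hr x hx) (k0.trans ?_) (abs_nonneg _) hR0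
      exact mul_le_mul_of_nonneg_right (le_abs_self _) hsq
    have k5 := k1.trans (mul_le_mul_of_nonneg_right (le_abs_self (Cs1 * J)) hsq)
    refine (abs_sub _ _).trans ((add_le_add (abs_add_le _ _) le_rfl).trans ?_)
    have : Cm * h k ^ 2 ≤ (Ca + R + Lr + |Cs0 * J| + Cm + Ca * M + Cv) * h k ^ 2 := by
      apply mul_le_mul_of_nonneg_right _ hsq
      linarith [abs_nonneg (Cs0 * J), mul_nonneg hCa0 hM0]
    refine le_trans ?_ this
    have : Cm * h k ^ 2 = |Cs1 * J| * h k ^ 2 + R * |Cs0 * J| * h k ^ 2 +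
      2 / τ * M * m * |Ch| * h k ^ 2 := by ring
    linarith
  · filter_upwards [hEh.1] with k hk x hx
    have := (hE2 0 (by norm_num) (by simp) _ hk x).2
    simp only [pow_zero, one_mul] at this
    refine this.trans (mul_le_mul_of_nonneg_right ?_ (inv_pos.2 hk).le)
    linarith [abs_nonneg (Cs0 * J)]
  · filter_upwards [hEh.1] with k hk x hx
    obtain ⟨i0, k0⟩ := hE2 0 (by norm_num) (by simp) _ hk x
    obtain ⟨i2, k2⟩ := hE2 2 (by norm_num) (by simp) _ hk x
    simp only [pow_zero, one_mul] at i0 k0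
    have hl := one_le_logFactor k
    calc ∫ z, ((clip (4 / τ * logFactor k) z.2 - regression g x) * scaled K (h k) x z.1) ^ 2
          ∂(pairLaw g)
        ≤ ∫ z, (2 * (z.2 ^ 2 * scaled K (h k) x z.1 ^ 2) + 2 * R ^ 2 * scaled K (h k) x z.1 ^ 2)
          ∂(pairLaw g) := by
          apply integral_mono_of_nonneg
          · exact Eventually.of_forall fun z => sq_nonneg _
          · exact (i2.const_mul _).add (i0.const_mul _)
          · refine Eventually.of_forall fun z => ?_
            simp only
            rw [mul_pow, ← mul_assoc, ← add_mul]
            apply mul_le_mul_of_nonneg_right _ (sq_nonneg _)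
            have n1 := abs_clip_le_abs (b := 4 / τ * logFactor k) (by positivity) z.2
            have n1' := sq_le_sq.2 n1
            have n2 : regression g x ^ 2 ≤ R ^ 2 := by
              rw [← sq_abs (regression g x)]
              exact pow_le_pow_left₀ (abs_nonneg _) (hr x hx) 2
            nlinarith [sq_nonneg (clip (4 / τ * logFactor k) z.2 + regression g x)]
      _ ≤ 2 * (Ca * M * (h k)⁻¹) + 2 * R ^ 2 * (Ca * M * (h k)⁻¹) := by
          rw [integral_add (i2.const_mul _) (i0.const_mul _), integral_const_mul,
            integral_const_mul]
          gcongr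
      _ = Cv * (h k)⁻¹ := by ring
      _ ≤ _ := by
          apply mul_le_mul_of_nonneg_right _ (inv_pos.2 hk).le
          linarith [abs_nonneg (Cs0 * J), mul_nonneg hCa0 hM0]

end Context

end Revesz

/-! ### Exponential moments of processes driven by independent pairs, and Borel–Cantelli on a grid.
-/

namespace Revesz

section Exponential

variable {Ω : Type*} [mΩ : MeasurableSpace Ω] {μ : Measure Ω}
  {Z : ℕ → Ω → ℝ × ℝ} {ν : Measure (ℝ × ℝ)}

theorem indepFun_next (hZ : ∀ n, Measurable (Z n)) (hind : iIndepFun Z μ) (n : ℕ) {H : Ω → ℝ}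
    (hH : Measurable[Filtration.natural Z (fun n => (hZ n).stronglyMeasurable) n] H)
    {φ : ℝ × ℝ → ℝ} (hφ : Measurable φ) : IndepFun H (fun ω => φ (Z (n + 1) ω)) μ := by
  have h1 := hind.indep_comap_natural_of_lt (fun n => (hZ n).stronglyMeasurable)
    (Nat.lt_succ_self n)
  rw [IndepFun_iff_Indep]
  refine indep_of_indep_of_le_left (indep_of_indep_of_le_right h1.symm ?_) ?_
  · rintro _ ⟨s, hs, rfl⟩
    exact ⟨φ ⁻¹' s, hφ hs, rfl⟩
  · exact hH.comap_le

theorem integral_mul_next (hZ : ∀ n, Measurable (Z n)) (hind : iIndepFun Z μ)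
    (hlaw : ∀ n, μ.map (Z n) = ν) (n : ℕ) {H : Ω → ℝ}
    (hH : Measurable[Filtration.natural Z (fun n => (hZ n).stronglyMeasurable) n] H)
    {φ : ℝ × ℝ → ℝ} (hφ : Measurable φ) :
    ∫ ω, H ω * φ (Z (n + 1) ω) ∂μ = (∫ ω, H ω ∂μ) * ∫ z, φ z ∂ν := by
  have h1 := indepFun_next hZ hind n hH hφ
  have hH' : Measurable H := hH.mono (Filtration.le _ n) le_rfl
  rw [h1.integral_fun_mul_eq_mul_integral hH'.aestronglyMeasurable
    (hφ.comp (hZ _)).aestronglyMeasurable, ← hlaw (n + 1),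
    integral_map (hZ _).aemeasurable hφ.aestronglyMeasurable]

theorem integrable_mul_exp_step (hZ : ∀ n, Measurable (Z n)) (n : ℕ) {H p : Ω → ℝ}
    (hHi : Integrable H μ)
    (hp : Measurable[Filtration.natural Z (fun n => (hZ n).stronglyMeasurable) n] p)
    {F G : ℝ × ℝ → ℝ} (hF : Measurable F) (hG : Measurable G) {w b B : ℝ} (hpB : ∀ ω, |p ω| ≤ B)
    (hFb : ∀ z, |F z| ≤ b) (hGb : ∀ z, |G z| * B ≤ b) (hwb : 2 * (|w| * b) ≤ 1) :
    (∀ ω, |w * (F (Z (n + 1) ω) + G (Z (n + 1) ω) * p ω)| ≤ 1) ∧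
    Integrable (fun ω => H ω * Real.exp (w * (F (Z (n + 1) ω) + G (Z (n + 1) ω) * p ω))) μ := by
  have hx : ∀ ω, |w * (F (Z (n + 1) ω) + G (Z (n + 1) ω) * p ω)| ≤ 1 := by
    intro ω
    rw [abs_mul]
    have h1 : |F (Z (n + 1) ω) + G (Z (n + 1) ω) * p ω| ≤ 2 * b := by
      refine (abs_add_le _ _).trans ?_
      rw [abs_mul]
      have := mul_le_mul_of_nonneg_left (hpB ω) (abs_nonneg (G (Z (n + 1) ω)))
      linarith [hFb (Z (n + 1) ω), hGb (Z (n + 1) ω)]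
    have := mul_le_mul_of_nonneg_left h1 (abs_nonneg w)
    linarith
  have hp' : Measurable p := hp.mono (Filtration.le _ n) le_rfl
  have hFm := hF.comp (hZ (n + 1))
  have hGm := hG.comp (hZ (n + 1))
  refine ⟨hx, hHi.mul_bdd (c := Real.exp 1) ?_ (Eventually.of_forall fun ω => ?_)⟩
  · exact (((hFm.add (hGm.mul hp')).const_mul w).exp).aestronglyMeasurable
  · rw [Real.norm_eq_abs, Real.abs_exp]
    exact Real.exp_le_exp.2 ((le_abs_self _).trans (hx ω))

/-- The exponent is at most 1 in absolute value, so `exp y ≤ 1 + y + y²`. The linear terms integrate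
to zero, because `F` and `G` are centred and the next pair is independent of `H` and `p`. By `(F +
Gp)² ≤ 2F² + 2(BG)²` the quadratic term contributes at most `4 w² v`, and `1 + y ≤ exp y` closes the
bound. -/
theorem integral_mul_exp_step_le [IsProbabilityMeasure μ] (hZ : ∀ n, Measurable (Z n)) (hind : iIndepFun Z μ)
    (hlaw : ∀ n, μ.map (Z n) = ν) (n : ℕ) {H p : Ω → ℝ}
    (hH : Measurable[Filtration.natural Z (fun n => (hZ n).stronglyMeasurable) n] H)
    (hH0 : ∀ ω, 0 ≤ H ω) (hHi : Integrable H μ)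
    (hp : Measurable[Filtration.natural Z (fun n => (hZ n).stronglyMeasurable) n] p)
    {F G : ℝ × ℝ → ℝ} (hF : Measurable F) (hG : Measurable G)
    {w b B v : ℝ} (hpB : ∀ ω, |p ω| ≤ B)
    (hFb : ∀ z, |F z| ≤ b) (hGb : ∀ z, |G z| * B ≤ b) (hwb : 2 * (|w| * b) ≤ 1)
    (hF0 : ∫ z, F z ∂ν = 0) (hG0 : ∫ z, G z ∂ν = 0)
    (hF2 : ∫ z, F z ^ 2 ∂ν ≤ v) (hG2 : B ^ 2 * ∫ z, G z ^ 2 ∂ν ≤ v) :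
    ∫ ω, H ω * Real.exp (w * (F (Z (n + 1) ω) + G (Z (n + 1) ω) * p ω)) ∂μ ≤
      (∫ ω, H ω ∂μ) * Real.exp (4 * (w ^ 2 * v)) := by
  obtain ⟨hx, hint⟩ := integrable_mul_exp_step hZ n hHi hp hF hG hpB hFb hGb hwb
  have hp' : Measurable p := hp.mono (Filtration.le _ n) le_rfl
  have hFm := hF.comp (hZ (n + 1))
  have hGm := hG.comp (hZ (n + 1))
  have bdd : ∀ {φ : ℝ × ℝ → ℝ}, Measurable φ → ∀ {c : ℝ}, (∀ z, |φ z| ≤ c) → ∀ {J : Ω → ℝ},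
      Integrable J μ → Integrable (fun ω => J ω * φ (Z (n + 1) ω)) μ := fun hφ c hc J hJ =>
    hJ.mul_bdd (hφ.comp (hZ (n + 1))).aestronglyMeasurable
      (Eventually.of_forall fun ω => hc _)
  have i1 := bdd hF hFb hHi
  have iB : ∀ z, |B * G z| ≤ b := fun z => by
    by_cases hB : 0 ≤ B
    · rw [abs_mul, abs_of_nonneg hB, mul_comm]; exact hGb z
    · obtain ⟨ω⟩ : Nonempty Ω := μ.nonempty_of_neZero
      exact absurd ((abs_nonneg _).trans (hpB ω)) hB
  have i2 : Integrable (fun ω => H ω * p ω * G (Z (n + 1) ω)) μ := by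
    have hn : ∀ ω, |p ω * G (Z (n + 1) ω)| ≤ b := fun ω => by
      rw [abs_mul, mul_comm]
      exact (mul_le_mul_of_nonneg_left (hpB ω) (abs_nonneg _)).trans (hGb _)
    have : Integrable (fun ω => H ω * (p ω * G (Z (n + 1) ω))) μ := hHi.mul_bdd
      (hp'.mul hGm).aestronglyMeasurable (Eventually.of_forall hn)
    simpa only [mul_assoc] using this
  have hsq : ∀ {φ : ℝ × ℝ → ℝ}, (∀ z, |φ z| ≤ b) → ∀ z, |φ z ^ 2| ≤ b ^ 2 := fun hφ z => by
    rw [abs_pow]; exact pow_le_pow_left₀ (abs_nonneg _) (hφ z) 2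
  have i3 := bdd (hF.pow_const 2) (hsq hFb) hHi
  have i4 := bdd ((hG.const_mul B).pow_const 2) (hsq iB) hHi
  have e1 := integral_mul_next hZ hind hlaw n hH hF
  have e2 := integral_mul_next hZ hind hlaw n (hH.mul hp) hG
  have e3 := integral_mul_next hZ hind hlaw n hH (hF.pow_const 2)
  have e4 := integral_mul_next hZ hind hlaw n hH ((hG.const_mul B).pow_const 2)
  rw [hF0, mul_zero] at e1
  rw [hG0, mul_zero] at e2
  have hI0 : 0 ≤ ∫ ω, H ω ∂μ := integral_nonneg hH0
  calc ∫ ω, H ω * Real.exp (w * (F (Z (n + 1) ω) + G (Z (n + 1) ω) * p ω)) ∂μ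
      ≤ ∫ ω, (H ω + w * (H ω * F (Z (n + 1) ω)) + w * (H ω * p ω * G (Z (n + 1) ω)) +
          2 * w ^ 2 * (H ω * F (Z (n + 1) ω) ^ 2) +
          2 * w ^ 2 * (H ω * (B * G (Z (n + 1) ω)) ^ 2)) ∂μ := by
        apply integral_mono hint
        · exact (((hHi.add (i1.const_mul w)).add (i2.const_mul w)).add
            (i3.const_mul _)).add (i4.const_mul _)
        · intro ω
          simp only
          set x := w * (F (Z (n + 1) ω) + G (Z (n + 1) ω) * p ω) with hxd
          have k1 : Real.exp x ≤ 1 + x + x ^ 2 := by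
            have := (abs_le.1 (Real.abs_exp_sub_one_sub_id_le (hx ω))).2
            linarith
          have k2 : x ^ 2 ≤ 2 * w ^ 2 * F (Z (n + 1) ω) ^ 2 +
              2 * w ^ 2 * (B * G (Z (n + 1) ω)) ^ 2 := by
            have k3 : (G (Z (n + 1) ω) * p ω) ^ 2 ≤ (B * G (Z (n + 1) ω)) ^ 2 := by
              rw [mul_pow, mul_pow, mul_comm]
              apply mul_le_mul_of_nonneg_right _ (sq_nonneg _)
              rw [← sq_abs (p ω)]
              exact pow_le_pow_left₀ (abs_nonneg _) (hpB ω) 2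
            have k4 : (F (Z (n + 1) ω) + G (Z (n + 1) ω) * p ω) ^ 2 ≤
                2 * F (Z (n + 1) ω) ^ 2 + 2 * (B * G (Z (n + 1) ω)) ^ 2 := by
              nlinarith [sq_nonneg (F (Z (n + 1) ω) - G (Z (n + 1) ω) * p ω)]
            rw [hxd, mul_pow]
            have := mul_le_mul_of_nonneg_left k4 (sq_nonneg w)
            linarith
          have k5 := mul_le_mul_of_nonneg_left (k1.trans (add_le_add le_rfl k2)) (hH0 ω)
          refine k5.trans (le_of_eq ?_)
          rw [hxd]; ring
    _ = (∫ ω, H ω ∂μ) * (1 + 2 * w ^ 2 * (∫ z, F z ^ 2 ∂ν) +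
          2 * w ^ 2 * (B ^ 2 * ∫ z, G z ^ 2 ∂ν)) := by
        have j1 : Integrable (fun ω => H ω + w * (H ω * F (Z (n + 1) ω))) μ :=
          hHi.add (i1.const_mul w)
        have j2 : Integrable (fun ω => H ω + w * (H ω * F (Z (n + 1) ω)) +
          w * (H ω * p ω * G (Z (n + 1) ω))) μ := j1.add (i2.const_mul w)
        have j3 : Integrable (fun ω => H ω + w * (H ω * F (Z (n + 1) ω)) +
          w * (H ω * p ω * G (Z (n + 1) ω)) + 2 * w ^ 2 * (H ω * F (Z (n + 1) ω) ^ 2)) μ :=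
          j2.add (i3.const_mul _)
        rw [integral_add j3 (i4.const_mul _), integral_add j2 (i3.const_mul _),
          integral_add j1 (i2.const_mul _), integral_add hHi (i1.const_mul _)]
        simp only [integral_const_mul]
        simp only [Pi.mul_apply] at e2
        rw [e1, e2, e3, e4]
        simp only [mul_pow, integral_const_mul]
        ring
    _ ≤ (∫ ω, H ω ∂μ) * Real.exp (4 * (w ^ 2 * v)) := by
        apply mul_le_mul_of_nonneg_left _ hI0
        have k1 := mul_le_mul_of_nonneg_left hF2 (show 0 ≤ 2 * w ^ 2 by positivity)
        have k2 := mul_le_mul_of_nonneg_left hG2 (show 0 ≤ 2 * w ^ 2 by positivity)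
        have k3 := Real.add_one_le_exp (4 * (w ^ 2 * v))
        linarith

/-- Exponential moments of a process `U` with `U (n+1) = ρ U n + w (F + G p)`, where `F`, `G` are
centred functions of the next pair and `p` is a bounded function of the past. -/
theorem exp_moment_le [IsProbabilityMeasure μ] (hZ : ∀ n, Measurable (Z n)) (hind : iIndepFun Z μ)
    (hlaw : ∀ n, μ.map (Z n) = ν) {N : ℕ} {U p : ℕ → Ω → ℝ} {F G : ℕ → ℝ × ℝ → ℝ}
    {ρ w b B v T : ℕ → ℝ}
    (hUN : ∀ ω, U N ω = 0)
    (hU : ∀ n, N ≤ n → ∀ ω, U (n + 1) ω = ρ (n + 1) * U n ω +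
      w (n + 1) * (F (n + 1) (Z (n + 1) ω) + G (n + 1) (Z (n + 1) ω) * p n ω))
    (hp : ∀ n, Measurable[Filtration.natural Z (fun n => (hZ n).stronglyMeasurable) n] (p n))
    (hF : ∀ n, Measurable (F n)) (hG : ∀ n, Measurable (G n))
    (hpB : ∀ n, N ≤ n → ∀ ω, |p n ω| ≤ B (n + 1))
    (hFb : ∀ n, N < n → ∀ z, |F n z| ≤ b n)
    (hGb : ∀ n, N < n → ∀ z, |G n z| * B n ≤ b n)
    (hF0 : ∀ n, N < n → ∫ z, F n z ∂ν = 0) (hG0 : ∀ n, N < n → ∫ z, G n z ∂ν = 0)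
    (hF2 : ∀ n, N < n → ∫ z, F n z ^ 2 ∂ν ≤ v n)
    (hG2 : ∀ n, N < n → B n ^ 2 * ∫ z, G n z ^ 2 ∂ν ≤ v n)
    (hT0 : ∀ n, N ≤ n → 0 ≤ T n)
    (hTb : ∀ n, N ≤ n → 2 * (|w (n + 1)| * b (n + 1)) ≤ T (n + 1))
    (hT : ∀ n, N ≤ n → ρ (n + 1) ^ 2 * T n ^ 2 + 4 * (w (n + 1) ^ 2 * v (n + 1)) ≤
      T (n + 1) ^ 2)
    (hv : ∀ n, N < n → 0 ≤ v n) (n : ℕ) (hn : N ≤ n) :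
    Measurable[Filtration.natural Z (fun n => (hZ n).stronglyMeasurable) n] (U n) ∧
    ∀ l : ℝ, |l| * T n ≤ 1 → Integrable (fun ω => Real.exp (l * U n ω)) μ ∧
      ∫ ω, Real.exp (l * U n ω) ∂μ ≤ Real.exp (l ^ 2 * T n ^ 2) := by
  set ℱ := Filtration.natural Z (fun n => (hZ n).stronglyMeasurable) with hℱ
  induction n, hn using Nat.le_induction with
  | base =>
    refine ⟨?_, fun l _ => ?_⟩
    · have : U N = fun _ => 0 := funext hUN
      rw [this]; exact measurable_const
    · simp only [hUN, mul_zero, Real.exp_zero, integrable_const, true_and]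
      simp only [integral_const, probReal_univ, one_smul]
      apply Real.one_le_exp; positivity
  | succ n hn ih =>
    obtain ⟨hm, ih⟩ := ih
    have hZn : Measurable[ℱ (n + 1)] (Z (n + 1)) :=
      (Filtration.stronglyAdapted_natural (fun n => (hZ n).stronglyMeasurable) (n + 1)).measurable
    have hle : ℱ n ≤ ℱ (n + 1) := ℱ.mono n.le_succ
    refine ⟨?_, fun l hl => ?_⟩
    · have : U (n + 1) = fun ω => ρ (n + 1) * U n ω +
        w (n + 1) * (F (n + 1) (Z (n + 1) ω) + G (n + 1) (Z (n + 1) ω) * p n ω) :=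
        funext (hU n hn)
      rw [this]
      exact ((hm.mono hle le_rfl).const_mul _).add
        ((((hF _).comp hZn).add (((hG _).comp hZn).mul ((hp n).mono hle le_rfl))).const_mul _)
    · have hT1 := hT0 (n + 1) (by omega)
      have hv1 := hv (n + 1) (by omega)
      have hρT : |ρ (n + 1)| * T n ≤ T (n + 1) := by
        apply le_of_sq_le_sq _ hT1
        rw [mul_pow, sq_abs]
        have : 0 ≤ 4 * (w (n + 1) ^ 2 * v (n + 1)) := by positivity
        linarith [hT n hn]
      -- Peeling off the last increment replaces `l` by `l ρ`; the recursion for `T` keeps this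
      -- parameter admissible at the previous time.
      have hl1 : |l * ρ (n + 1)| * T n ≤ 1 := by
        rw [abs_mul, mul_assoc]
        exact (mul_le_mul_of_nonneg_left hρT (abs_nonneg l)).trans hl
      have hl2 : 2 * (|l * w (n + 1)| * b (n + 1)) ≤ 1 := by
        rw [abs_mul]
        calc 2 * (|l| * |w (n + 1)| * b (n + 1)) = |l| * (2 * (|w (n + 1)| * b (n + 1))) := by ring
          _ ≤ |l| * T (n + 1) := mul_le_mul_of_nonneg_left (hTb n hn) (abs_nonneg l)
          _ ≤ 1 := hl
      obtain ⟨hi, hle2⟩ := ih _ hl1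
      have heq : ∀ ω, Real.exp (l * U (n + 1) ω) = Real.exp (l * ρ (n + 1) * U n ω) *
          Real.exp (l * w (n + 1) * (F (n + 1) (Z (n + 1) ω) +
            G (n + 1) (Z (n + 1) ω) * p n ω)) := fun ω => by
        rw [← Real.exp_add, hU n hn]; ring_nf
      simp only [heq]
      refine ⟨(integrable_mul_exp_step hZ n hi (hp n) (hF _) (hG _) (hpB n hn)
        (hFb _ (by omega)) (hGb _ (by omega)) hl2).2, ?_⟩
      have hstep := integral_mul_exp_step_le hZ hind hlaw n
        (H := fun ω => Real.exp (l * ρ (n + 1) * U n ω)) ((hm.const_mul _).exp)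
        (fun ω => (Real.exp_pos _).le) hi (hp n) (hF _) (hG _) (hpB n hn)
        (hFb _ (by omega)) (hGb _ (by omega)) hl2 (hF0 _ (by omega)) (hG0 _ (by omega))
        (hF2 _ (by omega)) (hG2 _ (by omega))
      refine hstep.trans ((mul_le_mul_of_nonneg_right hle2 (Real.exp_pos _).le).trans ?_)
      rw [← Real.exp_add]
      apply Real.exp_le_exp.2
      calc (l * ρ (n + 1)) ^ 2 * T n ^ 2 + 4 * ((l * w (n + 1)) ^ 2 * v (n + 1)) =
          l ^ 2 * (ρ (n + 1) ^ 2 * T n ^ 2 + 4 * (w (n + 1) ^ 2 * v (n + 1))) := by ring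
        _ ≤ _ := mul_le_mul_of_nonneg_left (hT n hn) (sq_nonneg l)

/-- Chernoff's bound at the two extreme admissible parameters `±1/T`. The tail is only exponential
in `s`, which is why the almost sure bounds carry a full factor `log n`. -/
theorem tail_le [IsProbabilityMeasure μ] {U : Ω → ℝ} {T : ℝ} (hT : 0 < T)
    (hU : ∀ l : ℝ, |l| * T ≤ 1 → Integrable (fun ω => Real.exp (l * U ω)) μ ∧
      ∫ ω, Real.exp (l * U ω) ∂μ ≤ Real.exp (l ^ 2 * T ^ 2)) (s : ℝ) :
    μ.real {ω | s * T ≤ |U ω|} ≤ 2 * Real.exp (1 - s) := by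
  have hTT : T⁻¹ ^ 2 * T ^ 2 = 1 := by field_simp
  have h1 := hU T⁻¹ (by rw [abs_of_pos (inv_pos.2 hT), inv_mul_cancel₀ hT.ne'])
  have h2 := hU (-T⁻¹) (by rw [abs_neg, abs_of_pos (inv_pos.2 hT), inv_mul_cancel₀ hT.ne'])
  rw [neg_sq, hTT] at h2
  rw [hTT] at h1
  have k1 := measure_ge_le_exp_mul_mgf (μ := μ) (X := U) (s * T) (inv_pos.2 hT).le h1.1
  have k2 := measure_le_le_exp_mul_mgf (μ := μ) (X := U) (-(s * T))
    (neg_nonpos.2 (inv_pos.2 hT).le) h2.1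
  have e1 : -T⁻¹ * (s * T) = -s := by field_simp
  have e2 : - -T⁻¹ * -(s * T) = -s := by field_simp
  rw [e1] at k1
  rw [e2] at k2
  have k3 : {ω | s * T ≤ |U ω|} ⊆ {ω | s * T ≤ U ω} ∪ {ω | U ω ≤ -(s * T)} := by
    intro ω hω
    rcases le_abs.1 (show s * T ≤ |U ω| from hω) with h | h
    · exact Or.inl h
    · exact Or.inr (show U ω ≤ -(s * T) by linarith)
  refine (measureReal_mono k3).trans ((measureReal_union_le _ _).trans ?_)
  have k4 := mul_le_mul_of_nonneg_left h1.2 (Real.exp_pos (-s)).le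
  have k5 := mul_le_mul_of_nonneg_left h2.2 (Real.exp_pos (-s)).le
  rw [← Real.exp_add] at k4 k5
  have e3 : -s + 1 = 1 - s := by ring
  rw [e3] at k4 k5
  unfold mgf at k1 k2
  linarith

theorem exp_neg_four_logFactor_le {n : ℕ} (hn : 1 ≤ n) :
    Real.exp (1 - 4 * logFactor n) ≤ ((n : ℝ) ^ 4)⁻¹ := by
  have hn' : (0 : ℝ) < n := by positivity
  have h4 : (n : ℝ) ^ 4 = Real.exp (4 * Real.log n) := by
    rw [← Real.exp_log (show (0 : ℝ) < (n : ℝ) ^ 4 by positivity), Real.log_pow]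
    norm_num
  rw [h4, ← Real.exp_neg]
  apply Real.exp_le_exp.2
  unfold logFactor; linarith

/-- At the threshold `4 (1 + log n) T_n` each of the `n²` grid points fails with probability at most
`2 n⁻⁴`; the union bound `2 n⁻²` is summable. -/
theorem ae_eventually_grid [IsProbabilityMeasure μ] {I : Set ℝ} {U : ℝ → ℕ → Ω → ℝ} {T : ℕ → ℝ} {N : ℕ}
    (hT : ∀ n, N ≤ n → 0 < T n)
    (hU : ∀ x ∈ I, ∀ n, N ≤ n → ∀ l : ℝ, |l| * T n ≤ 1 →
      Integrable (fun ω => Real.exp (l * U x n ω)) μ ∧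
      ∫ ω, Real.exp (l * U x n ω) ∂μ ≤ Real.exp (l ^ 2 * T n ^ 2))
    {y : ℕ → ℕ → ℝ} (hy : ∀ n, ∀ i < n ^ 2, y n i ∈ I) :
    ∀ᵐ ω ∂μ, ∀ᶠ n in atTop, ∀ i < n ^ 2, |U (y n i) n ω| ≤ 4 * logFactor n * T n := by
  set s : ℕ → Set Ω := fun n => if N ≤ n ∧ 1 ≤ n then
    ⋃ i ∈ Finset.range (n ^ 2), {ω | 4 * logFactor n * T n ≤ |U (y n i) n ω|} else ∅ with hs
  have hsum : (∑' n, μ (s n)) ≠ ⊤ := by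
    have h1 : ∀ n, μ (s n) ≤ ENNReal.ofReal (2 * ((n : ℝ) ^ 2)⁻¹) := by
      intro n
      simp only [hs]
      split_ifs with hn
      · have hn' : (0 : ℝ) < n := by have := hn.2; positivity
        rw [← ofReal_measureReal (measure_ne_top μ _)]
        apply ENNReal.ofReal_le_ofReal
        refine (measureReal_biUnion_finset_le _ _).trans ?_
        have : ∀ i ∈ Finset.range (n ^ 2),
            μ.real {ω | 4 * logFactor n * T n ≤ |U (y n i) n ω|} ≤ 2 * ((n : ℝ) ^ 4)⁻¹ := by
          intro i hi
          refine (tail_le (hT n hn.1) (hU _ (hy n i (Finset.mem_range.1 hi)) n hn.1) _).trans ?_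
          exact mul_le_mul_of_nonneg_left (exp_neg_four_logFactor_le hn.2) two_pos.le
        refine (Finset.sum_le_sum this).trans (le_of_eq ?_)
        rw [Finset.sum_const, Finset.card_range, nsmul_eq_mul]
        push_cast
        field_simp
      · simp
    refine ne_top_of_le_ne_top ?_ (ENNReal.tsum_le_tsum h1)
    exact ((Real.summable_nat_pow_inv.2 (by norm_num)).mul_left 2).tsum_ofReal_ne_top
  filter_upwards [ae_eventually_notMem hsum] with ω hω
  filter_upwards [hω, eventually_ge_atTop N, eventually_ge_atTop 1] with n h1 h2 h3 i hi
  by_contra hcon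
  apply h1
  simp only [hs, if_pos (And.intro h2 h3)]
  simp only [mem_iUnion, Finset.mem_range]
  exact ⟨i, hi, (not_le.1 hcon).le⟩

end Exponential

end Revesz

/-! ### Pathwise properties of the estimator: dependence on the initial value, growth, modulus of
continuity. -/

namespace Revesz

section Estimator

variable {K : ℝ → ℝ} {γ h : ℕ → ℝ} {xs ys : ℕ → ℝ}

theorem estimator_succ (K : ℝ → ℝ) (γ h : ℕ → ℝ) (r₀ : ℝ → ℝ) (xs ys : ℕ → ℝ) (n : ℕ) (x : ℝ) :
    estimator K γ h r₀ xs ys (n + 1) x =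
      (1 - γ (n + 1) * scaled K (h (n + 1)) x (xs (n + 1))) * estimator K γ h r₀ xs ys n x +
        γ (n + 1) * scaled K (h (n + 1)) x (xs (n + 1)) * ys (n + 1) := by
  simp only [estimator, scaled]; ring

/-- The recursion at `x` uses only values at `x` and is affine in them. The weight `l` may vary with
`x`, so an arbitrary bounded `r₀` reduces to two constant initial values, for which the estimator is
Lipschitz in `x`. -/
theorem estimator_affine {r₀ r₁ r₂ : ℝ → ℝ} {l x : ℝ} (hx : r₀ x = l * r₁ x + (1 - l) * r₂ x)
    (n : ℕ) : estimator K γ h r₀ xs ys n x =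
      l * estimator K γ h r₁ xs ys n x + (1 - l) * estimator K γ h r₂ xs ys n x := by
  induction n with
  | zero => exact hx
  | succ n ih => rw [estimator_succ, estimator_succ, estimator_succ, ih]; ring

theorem averaged_affine {w : ℕ → ℝ} {r₀ r₁ r₂ : ℝ → ℝ} {l x : ℝ}
    (hx : r₀ x = l * r₁ x + (1 - l) * r₂ x) (n : ℕ) :
    averaged K γ h w r₀ xs ys n x =
      l * averaged K γ h w r₁ xs ys n x + (1 - l) * averaged K γ h w r₂ xs ys n x := by
  have : ∑ k ∈ Finset.Icc 1 n, w k * estimator K γ h r₀ xs ys k x =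
      l * ∑ k ∈ Finset.Icc 1 n, w k * estimator K γ h r₁ xs ys k x +
      (1 - l) * ∑ k ∈ Finset.Icc 1 n, w k * estimator K γ h r₂ xs ys k x := by
    rw [Finset.mul_sum, Finset.mul_sum, ← Finset.sum_add_distrib]
    refine Finset.sum_congr rfl fun k _ => ?_
    rw [estimator_affine hx]; ring
  unfold averaged
  rw [this]; ring

theorem scaled_le {M : ℝ} (hM : ∀ z, K z ≤ M) {s : ℝ} (hs : 0 < s) (x u : ℝ) :
    scaled K s x u ≤ M * s⁻¹ := by
  unfold scaled; rw [mul_comm]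
  exact mul_le_mul_of_nonneg_right (hM _) (inv_pos.2 hs).le

variable (hK : A1 K) {M : ℝ} (hM : ∀ z, K z ≤ M) (hγ : ∀ n, 1 ≤ n → 0 < γ n)
  (hh : ∀ n, 1 ≤ n → 0 < h n)
include hK hM hγ hh

/-- Eventually each update is a convex combination of the previous value and the new response. -/
theorem stepsize_mul_scaled_mem (hcon : ∀ᶠ k in atTop, γ k * (M * (h k)⁻¹) ≤ 1) :
    ∀ᶠ k in atTop, ∀ x u, 0 ≤ γ k * scaled K (h k) x u ∧ γ k * scaled K (h k) x u ≤ 1 := by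
  filter_upwards [hcon, eventually_ge_atTop 1] with k h1 h2 x u
  exact ⟨mul_nonneg (hγ k h2).le (hK.scaled_nonneg (hh k h2) x u),
    (mul_le_mul_of_nonneg_left (scaled_le hM (hh k h2) x u) (hγ k h2).le).trans h1⟩

omit hK hγ hh hM in
theorem exists_bound_estimator (hKb : ∃ M, ∀ z, |K z| ≤ M) (v : ℝ) (n : ℕ) :
    ∃ C, ∀ x, |estimator K γ h (fun _ => v) xs ys n x| ≤ C := by
  obtain ⟨M, hM⟩ := hKb
  induction n with
  | zero => exact ⟨|v|, fun x => le_rfl⟩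
  | succ n ih =>
    obtain ⟨C, hC⟩ := ih
    refine ⟨(1 + |γ (n + 1)| * (|(h (n + 1))⁻¹| * M)) * C +
      |γ (n + 1)| * (|(h (n + 1))⁻¹| * M) * |ys (n + 1)|, fun x => ?_⟩
    rw [estimator_succ]
    have h1 : |scaled K (h (n + 1)) x (xs (n + 1))| ≤ |(h (n + 1))⁻¹| * M := by
      unfold scaled; rw [abs_mul]
      exact mul_le_mul_of_nonneg_left (hM _) (abs_nonneg _)
    have h2 : |γ (n + 1) * scaled K (h (n + 1)) x (xs (n + 1))| ≤
        |γ (n + 1)| * (|(h (n + 1))⁻¹| * M) := by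
      rw [abs_mul]; exact mul_le_mul_of_nonneg_left h1 (abs_nonneg _)
    have hMn : 0 ≤ M := (abs_nonneg _).trans (hM 0)
    refine (abs_add_le _ _).trans (add_le_add ?_ ?_)
    · rw [abs_mul]
      refine mul_le_mul ((abs_sub _ _).trans ?_) (hC x) (abs_nonneg _) (by positivity)
      rw [abs_one]; linarith
    · rw [abs_mul]
      exact mul_le_mul_of_nonneg_right h2 (abs_nonneg _)

/-- Convex combinations cannot exceed the larger of the initial bound and the responses, which grow
at most logarithmically. This a priori bound starts the bootstrap. -/
theorem estimator_bounded {A : ℝ} (v : ℝ) (hcon : ∀ᶠ k in atTop, γ k * (M * (h k)⁻¹) ≤ 1)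
    (hY : ∀ᶠ k in atTop, |ys k| ≤ A * logFactor k) :
    ∃ C, ∀ᶠ n in atTop, ∀ x, |estimator K γ h (fun _ => v) xs ys n x| ≤ C * logFactor n := by
  obtain ⟨N, hN⟩ := eventually_atTop.1 ((stepsize_mul_scaled_mem hK hM hγ hh hcon).and hY)
  obtain ⟨C, hC⟩ := exists_bound_estimator (K := K) (γ := γ) (h := h) (xs := xs) (ys := ys)
    ⟨M, fun z => by rw [abs_of_nonneg (hK.nonneg z)]; exact hM z⟩ v N
  refine ⟨|C| + |A|, eventually_atTop.2 ⟨N, fun n hn => ?_⟩⟩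
  induction n, hn using Nat.le_induction with
  | base =>
    intro x
    have h1 := one_le_logFactor N
    have h2 := (hC x).trans (le_abs_self C)
    nlinarith [abs_nonneg A, abs_nonneg C]
  | succ n hn ih =>
    intro x
    have h1 := hN (n + 1) (by omega)
    obtain ⟨h2, h3⟩ := h1.1 x (xs (n + 1))
    have h4 := logFactor_mono n.le_succ
    have hl := one_le_logFactor (n + 1)
    set B := (|C| + |A|) * logFactor (n + 1)
    have h5 : |estimator K γ h (fun _ => v) xs ys n x| ≤ B :=
      (ih x).trans (mul_le_mul_of_nonneg_left h4 (by positivity))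
    have h6 : |ys (n + 1)| ≤ B :=
      h1.2.trans (mul_le_mul_of_nonneg_right (by linarith [le_abs_self A, abs_nonneg C])
        (by linarith))
    rw [estimator_succ]
    refine (abs_add_le _ _).trans ?_
    rw [abs_mul, abs_mul, abs_of_nonneg h2, abs_of_nonneg (sub_nonneg.2 h3)]
    have k1 := mul_le_mul_of_nonneg_left h5 (sub_nonneg.2 h3)
    have k2 := mul_le_mul_of_nonneg_left h6 h2
    linarith

omit hK hM hγ hh in
theorem scaled_lipschitz {L : ℝ} (hL : ∀ y z, |K y - K z| ≤ L * |y - z|) {s : ℝ} (hs : 0 < s)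
    (x y u : ℝ) : |scaled K s x u - scaled K s y u| ≤ L * (s⁻¹) ^ 2 * |x - y| := by
  unfold scaled
  rw [← mul_sub, abs_mul, abs_of_pos (inv_pos.2 hs)]
  have h1 := hL (s⁻¹ * (x - u)) (s⁻¹ * (y - u))
  have h2 : s⁻¹ * (x - u) - s⁻¹ * (y - u) = s⁻¹ * (x - y) := by ring
  rw [h2, abs_mul, abs_of_pos (inv_pos.2 hs)] at h1
  calc _ ≤ s⁻¹ * (L * (s⁻¹ * |x - y|)) := mul_le_mul_of_nonneg_left h1 (inv_pos.2 hs).le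
    _ = _ := by ring

omit hK hM hγ hh in
theorem estimator_sub (v : ℝ) (n : ℕ) (x y : ℝ) :
    estimator K γ h (fun _ => v) xs ys (n + 1) x - estimator K γ h (fun _ => v) xs ys (n + 1) y =
      (1 - γ (n + 1) * scaled K (h (n + 1)) x (xs (n + 1))) *
        (estimator K γ h (fun _ => v) xs ys n x - estimator K γ h (fun _ => v) xs ys n y) +
      γ (n + 1) * (scaled K (h (n + 1)) x (xs (n + 1)) - scaled K (h (n + 1)) y (xs (n + 1))) *
        (ys (n + 1) - estimator K γ h (fun _ => v) xs ys n y) := by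
  rw [estimator_succ, estimator_succ]; ring

theorem exists_lipschitz_estimator {L : ℝ} (hL : ∀ y z, |K y - K z| ≤ L * |y - z|) (v : ℝ) (n : ℕ) :
    ∃ C, 0 ≤ C ∧ ∀ x y, |estimator K γ h (fun _ => v) xs ys n x -
      estimator K γ h (fun _ => v) xs ys n y| ≤ C * |x - y| := by
  have hM0 : 0 ≤ M := (hK.nonneg 0).trans (hM 0)
  have hL0 : 0 ≤ L := by
    have := (abs_nonneg _).trans (hL 1 0)
    simpa using this
  induction n with
  | zero => exact ⟨0, le_rfl, fun x y => by simp [estimator]⟩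
  | succ n ih =>
    obtain ⟨C, hC0, hC⟩ := ih
    obtain ⟨B, hB⟩ := exists_bound_estimator (K := K) (γ := γ) (h := h) (xs := xs) (ys := ys)
      ⟨M, fun z => by rw [abs_of_nonneg (hK.nonneg z)]; exact hM z⟩ v n
    have hB0 : 0 ≤ B := (abs_nonneg _).trans (hB 0)
    have hg := hγ (n + 1) (by omega)
    have hs := hh (n + 1) (by omega)
    have hs' := inv_pos.2 hs
    refine ⟨(1 + γ (n + 1) * (M * (h (n + 1))⁻¹)) * C +
      γ (n + 1) * (L * ((h (n + 1))⁻¹) ^ 2) * (|ys (n + 1)| + B), by positivity, fun x y => ?_⟩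
    rw [estimator_sub]
    have h1 := scaled_le hM hs x (xs (n + 1))
    have h1' := hK.scaled_nonneg hs x (xs (n + 1))
    have h2 := scaled_lipschitz hL hs x y (xs (n + 1))
    refine (abs_add_le _ _).trans ?_
    rw [add_mul]
    refine add_le_add ?_ ?_
    · rw [abs_mul, mul_assoc]
      refine mul_le_mul ((abs_sub _ _).trans ?_) (hC x y) (abs_nonneg _) (by positivity)
      rw [abs_one, abs_mul, abs_of_pos hg, abs_of_nonneg h1']
      gcongr
    · rw [abs_mul, abs_mul, abs_of_pos hg]
      calc _ ≤ γ (n + 1) * (L * ((h (n + 1))⁻¹) ^ 2 * |x - y|) * (|ys (n + 1)| + B) := by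
            gcongr
            exact (abs_sub _ _).trans (by gcongr; exact hB y)
        _ = _ := by ring

/-- The factor `1 - γ K_h` does not increase the Lipschitz constant, and each step adds at most a
constant times `γ_n h_n⁻² log n`, which is bounded. Linear growth suffices, since the grid has mesh
of order `n⁻²`. -/
theorem estimator_lipschitz {A L D : ℝ} (hL : ∀ y z, |K y - K z| ≤ L * |y - z|) (v : ℝ)
    (hcon : ∀ᶠ k in atTop, γ k * (M * (h k)⁻¹) ≤ 1)
    (hvar : ∀ᶠ k in atTop, γ k * ((h k)⁻¹ ^ 2 * logFactor k) ≤ D)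
    (hY : ∀ᶠ k in atTop, |ys k| ≤ A * logFactor k) :
    ∃ C, 0 ≤ C ∧ ∀ n x y, |estimator K γ h (fun _ => v) xs ys n x -
      estimator K γ h (fun _ => v) xs ys n y| ≤ C * (n + 1) * |x - y| := by
  have hL0 : 0 ≤ L := by
    have := (abs_nonneg _).trans (hL 1 0)
    simpa using this
  obtain ⟨B, hB⟩ := estimator_bounded hK hM hγ hh (xs := xs) v hcon hY
  obtain ⟨N, hN⟩ := eventually_atTop.1
    ((((stepsize_mul_scaled_mem hK hM hγ hh hcon).and hY).and hvar).and hB)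
  choose c hc0 hc using
    exists_lipschitz_estimator hK hM hγ hh (xs := xs) (ys := ys) hL v
  set S := ∑ k ∈ Finset.range (N + 1), c k with hS
  have hS0 : 0 ≤ S := Finset.sum_nonneg fun k _ => hc0 k
  have hle : ∀ n ≤ N, c n ≤ S := fun n hn =>
    Finset.single_le_sum (f := c) (fun k _ => hc0 k) (Finset.mem_range.2 (by omega))
  set E := L * (|A| + |B|) * |D| with hE
  have hE0 : 0 ≤ E := by positivity
  have hstep : ∀ n, N ≤ n → ∀ x y, |estimator K γ h (fun _ => v) xs ys n x -
      estimator K γ h (fun _ => v) xs ys n y| ≤ (S + E * n) * |x - y| := by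
    intro n hn
    induction n, hn using Nat.le_induction with
    | base =>
      intro x y
      refine (hc N x y).trans (mul_le_mul_of_nonneg_right ?_ (abs_nonneg _))
      have := hle N le_rfl
      have : 0 ≤ E * N := by positivity
      linarith
    | succ n hn ih =>
      intro x y
      have hg := hγ (n + 1) (by omega)
      have hs := hh (n + 1) (by omega)
      obtain ⟨⟨⟨k1, k2⟩, k3⟩, -⟩ := hN (n + 1) (by omega)
      obtain ⟨k4, k5⟩ := k1 x (xs (n + 1))
      have k6 := (hN n hn).2 y
      have h2 := scaled_lipschitz hL hs x y (xs (n + 1))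
      have hl := one_le_logFactor (n + 1)
      rw [estimator_sub]
      have t1 : |(1 - γ (n + 1) * scaled K (h (n + 1)) x (xs (n + 1))) *
        (estimator K γ h (fun _ => v) xs ys n x - estimator K γ h (fun _ => v) xs ys n y)| ≤
          (S + E * n) * |x - y| := by
        rw [abs_mul, abs_of_nonneg (sub_nonneg.2 k5)]
        calc _ ≤ 1 * |estimator K γ h (fun _ => v) xs ys n x -
              estimator K γ h (fun _ => v) xs ys n y| := by gcongr; linarith
          _ ≤ _ := by rw [one_mul]; exact ih x y
      have t2 : |γ (n + 1) * (scaled K (h (n + 1)) x (xs (n + 1)) -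
          scaled K (h (n + 1)) y (xs (n + 1))) *
          (ys (n + 1) - estimator K γ h (fun _ => v) xs ys n y)| ≤ E * |x - y| := by
        have k7 : |ys (n + 1) - estimator K γ h (fun _ => v) xs ys n y| ≤
            (|A| + |B|) * logFactor (n + 1) := by
          have k8 := logFactor_mono n.le_succ
          have k9 := one_le_logFactor n
          refine (abs_sub _ _).trans ?_
          rw [add_mul]
          refine add_le_add (k2.trans ?_) (k6.trans ?_)
          · exact mul_le_mul_of_nonneg_right (le_abs_self A) (by linarith)
          · exact mul_le_mul (le_abs_self B) k8 (by linarith) (abs_nonneg _)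
        rw [abs_mul, abs_mul, abs_of_pos hg]
        calc _ ≤ γ (n + 1) * (L * (h (n + 1))⁻¹ ^ 2 * |x - y|) *
              ((|A| + |B|) * logFactor (n + 1)) := by gcongr
          _ = L * (|A| + |B|) * (γ (n + 1) * ((h (n + 1))⁻¹ ^ 2 * logFactor (n + 1))) *
              |x - y| := by ring
          _ ≤ L * (|A| + |B|) * |D| * |x - y| := by
              gcongr
              exact k3.trans (le_abs_self D)
      refine (abs_add_le _ _).trans ((add_le_add t1 t2).trans (le_of_eq ?_))
      push_cast; ring
  refine ⟨S + E, by positivity, fun n x y => ?_⟩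
  rcases le_total n N with hn | hn
  · refine (hc n x y).trans (mul_le_mul_of_nonneg_right ?_ (abs_nonneg _))
    have := hle n hn
    have h1 : 0 ≤ (n : ℝ) := Nat.cast_nonneg n
    nlinarith [mul_nonneg hS0 h1, mul_nonneg hE0 h1]
  · refine (hstep n hn x y).trans (mul_le_mul_of_nonneg_right ?_ (abs_nonneg _))
    have h1 : 0 ≤ (n : ℝ) := Nat.cast_nonneg n
    nlinarith [mul_nonneg hS0 h1, mul_nonneg hE0 h1]

omit hK hM hγ hh in
theorem averaged_lipschitz {w : ℕ → ℝ} (hw : ∀ n, 1 ≤ n → 0 < w n) {r₀ : ℝ → ℝ} {C : ℝ}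
    (hC0 : 0 ≤ C)
    (hC : ∀ n x y, |estimator K γ h r₀ xs ys n x - estimator K γ h r₀ xs ys n y| ≤
      C * (n + 1) * |x - y|) {n : ℕ} (hn : 1 ≤ n) (x y : ℝ) :
    |averaged K γ h w r₀ xs ys n x - averaged K γ h w r₀ xs ys n y| ≤ C * (n + 1) * |x - y| := by
  have hpos : ∀ k ∈ Finset.Icc 1 n, 0 < w k := fun k hk => hw k (Finset.mem_Icc.1 hk).1
  have hS : 0 < ∑ k ∈ Finset.Icc 1 n, w k :=
    Finset.sum_pos hpos ⟨1, Finset.mem_Icc.2 ⟨le_rfl, hn⟩⟩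
  unfold averaged
  rw [← mul_sub, ← Finset.sum_sub_distrib, abs_mul, abs_of_pos (inv_pos.2 hS),
    inv_mul_le_iff₀ hS, Finset.sum_mul]
  refine (Finset.abs_sum_le_sum_abs _ _).trans (Finset.sum_le_sum fun k hk => ?_)
  rw [← mul_sub, abs_mul, abs_of_pos (hpos k hk)]
  apply mul_le_mul_of_nonneg_left _ (hpos k hk).le
  refine (hC k x y).trans ?_
  have : (k : ℝ) ≤ n := by exact_mod_cast (Finset.mem_Icc.1 hk).2
  gcongr

end Estimator

/-! ### Passage from a grid to the whole interval. -/

/-- The centres of the cells of the partition of `(c, d)` into `n ^ 2` intervals. -/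
noncomputable def gridPoint (c d : ℝ) (n i : ℕ) : ℝ := c + (d - c) * ((i + 1 / 2) / (n : ℝ) ^ 2)

theorem gridPoint_mem {c d : ℝ} (hcd : c < d) (n : ℕ) : ∀ i < n ^ 2, gridPoint c d n i ∈ Ioo c d := by
  intro i hi
  have hi' : ((i : ℝ) + 1) ≤ (n : ℝ) ^ 2 := by exact_mod_cast hi
  have hn : (0 : ℝ) < (n : ℝ) ^ 2 := by
    have : (0 : ℝ) ≤ i := Nat.cast_nonneg i
    linarith
  have h1 : 0 < ((i : ℝ) + 1 / 2) / (n : ℝ) ^ 2 := by positivity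
  have h2 : ((i : ℝ) + 1 / 2) / (n : ℝ) ^ 2 < 1 := by rw [div_lt_one hn]; linarith
  unfold gridPoint
  constructor <;> nlinarith

theorem exists_gridPoint {c d x : ℝ} (hx : x ∈ Ioo c d) {n : ℕ} (hn : 1 ≤ n) :
    ∃ i < n ^ 2, |x - gridPoint c d n i| ≤ (d - c) / (n : ℝ) ^ 2 := by
  have hcd : 0 < d - c := by linarith [hx.1, hx.2]
  have hn' : (0 : ℝ) < (n : ℝ) ^ 2 := by positivity
  set t := (x - c) / (d - c) * (n : ℝ) ^ 2 with ht
  have ht0 : 0 ≤ t := mul_nonneg (div_nonneg (by linarith [hx.1]) hcd.le) hn'.le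
  have ht1 : t < (n : ℝ) ^ 2 := by
    have : (x - c) / (d - c) < 1 := by rw [div_lt_one hcd]; linarith [hx.2]
    nlinarith
  refine ⟨⌊t⌋₊, ?_, ?_⟩
  · have := (Nat.floor_le ht0).trans_lt ht1
    exact_mod_cast this
  · have hxt : x = c + (d - c) * (t / (n : ℝ) ^ 2) := by rw [ht]; field_simp; ring
    have h1 := Nat.floor_le ht0
    have h2 := Nat.lt_floor_add_one t
    unfold gridPoint
    have : x - (c + (d - c) * ((⌊t⌋₊ + 1 / 2) / (n : ℝ) ^ 2)) =
        (d - c) / (n : ℝ) ^ 2 * (t - (⌊t⌋₊ + 1 / 2)) := by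
      nth_rewrite 1 [hxt]; field_simp; ring
    rw [this, abs_mul, abs_of_pos (by positivity)]
    have h3 : |t - (⌊t⌋₊ + 1 / 2)| ≤ 1 := by rw [abs_le]; constructor <;> linarith
    exact mul_le_of_le_one_right (by positivity) h3

theorem sup_le_of_grid {c d : ℝ} {e : ℕ → ℝ → ℝ} {R : ℕ → ℝ} {C : ℝ} (hC : 0 ≤ C)
    (hlip : ∀ᶠ n : ℕ in atTop, ∀ x ∈ Ioo c d, ∀ y ∈ Ioo c d,
      |e n x - e n y| ≤ C * (n + 1) * |x - y|)
    (hR : ∀ᶠ n in atTop, ∀ i < n ^ 2, |e n (gridPoint c d n i)| ≤ R n) :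
    ∀ᶠ n in atTop, ∀ x ∈ Ioo c d, |e n x| ≤ R n + 2 * C * (d - c) * (n : ℝ)⁻¹ := by
  filter_upwards [hlip, hR, eventually_ge_atTop 1] with n h1 h2 h3 x hx
  have hcd : c < d := hx.1.trans hx.2
  obtain ⟨i, hi, hxi⟩ := exists_gridPoint hx h3
  have h4 := h1 x hx _ (gridPoint_mem hcd n i hi)
  have hn : (1 : ℝ) ≤ n := by exact_mod_cast h3
  have h5 : C * (n + 1) * |x - gridPoint c d n i| ≤ 2 * C * (d - c) * (n : ℝ)⁻¹ := by
    calc _ ≤ C * (n + n) * ((d - c) / (n : ℝ) ^ 2) := by gcongr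
      _ = _ := by field_simp; ring
  have h6 : e n x = (e n x - e n (gridPoint c d n i)) + e n (gridPoint c d n i) := by ring
  rw [h6]
  refine (abs_add_le _ _).trans ?_
  linarith [h2 i hi]

end Revesz

/-! ### The innovations and the linear processes they drive. -/

namespace Revesz

theorem integral_centred {E : Type*} [MeasurableSpace E] {ν : Measure E} [IsProbabilityMeasure ν]
    {φ : E → ℝ} (hφ : Measurable φ) {c : ℝ} (hc : ∀ z, |φ z| ≤ c) :
    ∫ z, (φ z - ∫ z', φ z' ∂ν) ∂ν = 0 ∧
      ∫ z, (φ z - ∫ z', φ z' ∂ν) ^ 2 ∂ν ≤ ∫ z, φ z ^ 2 ∂ν := by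
  have hi : Integrable φ ν := (integrable_const c).mono' hφ.aestronglyMeasurable
    (Eventually.of_forall hc)
  have hi2 : Integrable (fun z => φ z ^ 2) ν :=
    (integrable_const (c ^ 2)).mono' (hφ.pow_const 2).aestronglyMeasurable
      (Eventually.of_forall fun z => by
        rw [Real.norm_eq_abs, abs_pow]; exact pow_le_pow_left₀ (abs_nonneg _) (hc z) 2)
  set m := ∫ z, φ z ∂ν with hm
  constructor
  · rw [integral_sub hi (integrable_const _)]; simp [hm]
  · have h1 : (fun z => (φ z - m) ^ 2) = fun z => φ z ^ 2 - (2 * m) * φ z + m ^ 2 := by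
      ext z; ring
    have i1 : Integrable (fun z => φ z ^ 2 - (2 * m) * φ z) ν := hi2.sub (hi.const_mul _)
    rw [h1, integral_add i1 (integrable_const _), integral_sub hi2 (hi.const_mul _),
      integral_const_mul, ← hm]
    simp only [integral_const, probReal_univ, one_smul]
    nlinarith [sq_nonneg m]

/-- The centred, truncated noise at time `k` as a function of the pair observed. -/
noncomputable def noise (ν : Measure (ℝ × ℝ)) (K : ℝ → ℝ) (h : ℕ → ℝ) (r : ℝ → ℝ) (A : ℝ)
    (k : ℕ) (x : ℝ) (z : ℝ × ℝ) : ℝ :=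
  (clip (A * logFactor k) z.2 - r x) * scaled K (h k) x z.1 -
    ∫ z', (clip (A * logFactor k) z'.2 - r x) * scaled K (h k) x z'.1 ∂ν

/-- The centred kernel at time `k`, with the opposite sign. -/
noncomputable def kernelNoise (ν : Measure (ℝ × ℝ)) (K : ℝ → ℝ) (h : ℕ → ℝ)
    (k : ℕ) (x : ℝ) (z : ℝ × ℝ) : ℝ :=
  (∫ z', scaled K (h k) x z'.1 ∂ν) - scaled K (h k) x z.1

/-- The martingale increment `noise k + kernelNoise k * clip (B k) (e (k - 1))` of the error
process `e`. -/
noncomputable def innovation (ν : Measure (ℝ × ℝ)) (K : ℝ → ℝ) (h : ℕ → ℝ) (r : ℝ → ℝ) (A : ℝ)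
    (B : ℕ → ℝ) (x : ℝ) (zs : ℕ → ℝ × ℝ) (e : ℕ → ℝ) (k : ℕ) : ℝ :=
  noise ν K h r A k x (zs k) + kernelNoise ν K h k x (zs k) * clip (B k) (e (k - 1))

/-- The solution of `U n = ρ n * U (n - 1) + w n * ξ n` for `n > N`, started from `U N = 0`. -/
noncomputable def driven (N : ℕ) (ρ w ξ : ℕ → ℝ) : ℕ → ℝ
  | 0 => 0
  | n + 1 => if n < N then 0 else ρ (n + 1) * driven N ρ w ξ n + w (n + 1) * ξ (n + 1)

theorem driven_self (N : ℕ) (ρ w ξ : ℕ → ℝ) : driven N ρ w ξ N = 0 := by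
  cases N with
  | zero => rfl
  | succ N => simp [driven]

theorem driven_succ {N n : ℕ} (hn : N ≤ n) (ρ w ξ : ℕ → ℝ) :
    driven N ρ w ξ (n + 1) = ρ (n + 1) * driven N ρ w ξ n + w (n + 1) * ξ (n + 1) := by
  rw [driven, if_neg (by omega)]

/-- Supplies the initial value, uniform in `x`, for comparisons that start later than time `N`. -/
theorem exists_bound_driven {ι : Type*} {s : Set ι} {N : ℕ} {ρ ξ : ι → ℕ → ℝ} {w : ℕ → ℝ}
    (hρ : ∀ n, N < n → ∃ c, ∀ x ∈ s, |ρ x n| ≤ c) (hξ : ∀ n, N < n → ∃ c, ∀ x ∈ s, |ξ x n| ≤ c)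
    {n : ℕ} (hn : N ≤ n) : ∃ c, ∀ x ∈ s, |driven N (ρ x) w (ξ x) n| ≤ c := by
  induction n, hn using Nat.le_induction with
  | base => exact ⟨0, fun x _ => by rw [driven_self, abs_zero]⟩
  | succ n hn ih =>
    obtain ⟨c, hc⟩ := ih
    obtain ⟨c1, hc1⟩ := hρ (n + 1) (by omega)
    obtain ⟨c2, hc2⟩ := hξ (n + 1) (by omega)
    refine ⟨|c1| * c + |w (n + 1)| * c2, fun x hx => ?_⟩
    rw [driven_succ hn]
    refine (abs_add_le _ _).trans ?_
    rw [abs_mul, abs_mul]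
    exact add_le_add (mul_le_mul ((hc1 x hx).trans (le_abs_self _)) (hc x hx) (abs_nonneg _)
      (abs_nonneg _)) (mul_le_mul_of_nonneg_left (hc2 x hx) (abs_nonneg _))

section Noise

variable {ν : Measure (ℝ × ℝ)} [IsProbabilityMeasure ν] {K : ℝ → ℝ} {h : ℕ → ℝ} {f r : ℝ → ℝ}
  {A C f₀ c d M : ℝ} {B : ℕ → ℝ}
  (hmb : MomentBounds ν K h (Ioo c d) f r A C f₀) (hA : 0 ≤ A) (hcd : c < d)
  (hK : A1 K) (hM : ∀ z, K z ≤ M) (hh : ∀ n, 1 ≤ n → 0 < h n)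

omit [IsProbabilityMeasure ν] in
include hmb hcd in
theorem MomentBounds.nonneg : 0 ≤ C :=
  (abs_nonneg _).trans (hmb.abs_regression_le ((c + d) / 2) ⟨by linarith, by linarith⟩)

include hK in
theorem measurable_scaled (s x : ℝ) : Measurable (scaled K s x) := by
  have := hK.continuous.measurable
  unfold scaled
  fun_prop

include hK in
theorem measurable_truncated (k : ℕ) (x : ℝ) : Measurable
    (fun z : ℝ × ℝ => (clip (A * logFactor k) z.2 - r x) * scaled K (h k) x z.1) :=
  (((measurable_clip _).comp measurable_snd).sub_const _).mul
    ((measurable_scaled hK _ _).comp measurable_fst)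

omit [IsProbabilityMeasure ν] in
include hmb hA hcd hK hM hh in
theorem abs_truncated_le {k : ℕ} (hk : 1 ≤ k) {x : ℝ} (hx : x ∈ Ioo c d) (z : ℝ × ℝ) :
    |(clip (A * logFactor k) z.2 - r x) * scaled K (h k) x z.1| ≤
      (A + C) * M * ((h k)⁻¹ * logFactor k) := by
  have hC0 := hmb.nonneg hcd
  have hl := one_le_logFactor k
  rw [abs_mul, abs_of_nonneg (hK.scaled_nonneg (hh k hk) x z.1)]
  have h1 : |clip (A * logFactor k) z.2 - r x| ≤ (A + C) * logFactor k := by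
    refine (abs_sub _ _).trans ?_
    have := abs_clip_le (b := A * logFactor k) (by positivity) z.2
    nlinarith [hmb.abs_regression_le x hx]
  calc _ ≤ ((A + C) * logFactor k) * (M * (h k)⁻¹) :=
        mul_le_mul h1 (scaled_le hM (hh k hk) _ _) (hK.scaled_nonneg (hh k hk) _ _) (by positivity)
    _ = _ := by ring

include hmb hA hcd hK hM hh in
theorem abs_noise_le {k : ℕ} (hk : 1 ≤ k) {x : ℝ} (hx : x ∈ Ioo c d) (z : ℝ × ℝ) :
    |noise ν K h r A k x z| ≤ 2 * ((A + C) * M * ((h k)⁻¹ * logFactor k)) := by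
  have h1 := abs_truncated_le hmb hA hcd hK hM hh hk hx
  have h2 := norm_integral_le_of_norm_le (μ := ν)
    (f := fun z => (clip (A * logFactor k) z.2 - r x) * scaled K (h k) x z.1)
    (integrable_const ((A + C) * M * ((h k)⁻¹ * logFactor k))) (Eventually.of_forall h1)
  simp only [integral_const, probReal_univ, one_smul, Real.norm_eq_abs] at h2
  unfold noise
  refine (abs_sub _ _).trans ?_
  linarith [h1 z]

include hK hM hh in
theorem abs_kernelNoise_le {k : ℕ} (hk : 1 ≤ k) (x : ℝ) (z : ℝ × ℝ) :
    |kernelNoise ν K h k x z| ≤ M * (h k)⁻¹ := by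
  have hn : ∀ u, 0 ≤ scaled K (h k) x u := hK.scaled_nonneg (hh k hk) x
  have h1 : ∀ u, scaled K (h k) x u ≤ M * (h k)⁻¹ := scaled_le hM (hh k hk) x
  have h2 := norm_integral_le_of_norm_le (μ := ν) (f := fun z => scaled K (h k) x z.1)
    (integrable_const (M * (h k)⁻¹))
    (Eventually.of_forall fun z => by rw [Real.norm_eq_abs, abs_of_nonneg (hn _)]; exact h1 _)
  simp only [integral_const, probReal_univ, one_smul, Real.norm_eq_abs] at h2
  have h3 : 0 ≤ ∫ z, scaled K (h k) x z.1 ∂ν := integral_nonneg fun z => hn _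
  unfold kernelNoise
  rw [abs_le]
  constructor
  · linarith [h1 z.1]
  · linarith [hn z.1, le_abs_self (∫ z, scaled K (h k) x z.1 ∂ν)]

include hmb hA hcd hK hM hh in
theorem noise_moments {k : ℕ} (hk : 1 ≤ k) {x : ℝ} (hx : x ∈ Ioo c d) :
    ∫ z, noise ν K h r A k x z ∂ν = 0 ∧ ∫ z, noise ν K h r A k x z ^ 2 ∂ν ≤
      ∫ z, ((clip (A * logFactor k) z.2 - r x) * scaled K (h k) x z.1) ^ 2 ∂ν := by
  exact integral_centred (measurable_truncated hK k x)
    (abs_truncated_le hmb hA hcd hK hM hh hk hx)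

include hK hM hh in
theorem kernelNoise_moments {k : ℕ} (hk : 1 ≤ k) (x : ℝ) :
    ∫ z, kernelNoise ν K h k x z ∂ν = 0 ∧ ∫ z, kernelNoise ν K h k x z ^ 2 ∂ν ≤
      ∫ z, scaled K (h k) x z.1 ^ 2 ∂ν := by
  have h1 := integral_centred (ν := ν) (φ := fun z => scaled K (h k) x z.1)
    ((measurable_scaled hK _ _).comp measurable_fst) (c := M * (h k)⁻¹)
    (fun z => by
      rw [abs_of_nonneg (hK.scaled_nonneg (hh k hk) _ _)]; exact scaled_le hM (hh k hk) _ _)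
  constructor
  · have : (fun z => kernelNoise ν K h k x z) =
        fun z => -(scaled K (h k) x z.1 - ∫ z', scaled K (h k) x z'.1 ∂ν) := by
      ext z; unfold kernelNoise; ring
    rw [this, integral_neg, h1.1, neg_zero]
  · have : (fun z => kernelNoise ν K h k x z ^ 2) =
        fun z => (scaled K (h k) x z.1 - ∫ z', scaled K (h k) x z'.1 ∂ν) ^ 2 := by
      ext z; unfold kernelNoise; ring
    rw [this]; exact h1.2

include hmb hA hcd hK hM hh in
theorem exists_bound_innovation (hB : ∀ n, 1 ≤ B n) {k : ℕ} (hk : 1 ≤ k) (zs : ℕ → ℝ × ℝ)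
    (e : ℝ → ℕ → ℝ) :
    ∃ b, ∀ x ∈ Ioo c d, |innovation ν K h r A B x zs (e x) k| ≤ b := by
  refine ⟨2 * ((A + C) * M * ((h k)⁻¹ * logFactor k)) + M * (h k)⁻¹ * B k, fun x hx => ?_⟩
  have h1 := abs_noise_le hmb hA hcd hK hM hh hk hx (zs k)
  have h2 := abs_kernelNoise_le (ν := ν) hK hM hh hk x (zs k)
  have h3 := abs_clip_le (zero_le_one.trans (hB k)) (e x (k - 1))
  unfold innovation
  refine (abs_add_le _ _).trans (add_le_add h1 ?_)
  rw [abs_mul]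
  exact mul_le_mul h2 h3 (abs_nonneg _) ((abs_nonneg _).trans h2)

end Noise

section Grid

variable {Ω : Type*} [MeasurableSpace Ω] {μ : Measure Ω} [IsProbabilityMeasure μ]
  {X Y : ℕ → Ω → ℝ} {ν : Measure (ℝ × ℝ)} [IsProbabilityMeasure ν]
  {K : ℝ → ℝ} {γ h : ℕ → ℝ} {f r : ℝ → ℝ} {A C f₀ c d M : ℝ} {B : ℕ → ℝ}

omit [IsProbabilityMeasure μ] in
theorem measurable_estimator (hK : A1 K) (hX : ∀ n, Measurable (X n)) (hY : ∀ n, Measurable (Y n))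
    (r₀ : ℝ → ℝ) (x : ℝ) (n : ℕ) :
    Measurable[Filtration.natural (fun n ω => (X n ω, Y n ω))
      (fun n => ((hX n).prodMk (hY n)).stronglyMeasurable) n]
      (fun ω => estimator K γ h r₀ (fun k => X k ω) (fun k => Y k ω) n x) := by
  induction n with
  | zero => exact measurable_const
  | succ n ih =>
    set ℱ := Filtration.natural (fun n ω => (X n ω, Y n ω))
      (fun n => ((hX n).prodMk (hY n)).stronglyMeasurable) with hℱ
    have hZn : Measurable[ℱ (n + 1)] (fun ω => (X (n + 1) ω, Y (n + 1) ω)) :=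
      (Filtration.stronglyAdapted_natural
        (fun n => ((hX n).prodMk (hY n)).stronglyMeasurable) (n + 1)).measurable
    have h1 := ih.mono (ℱ.mono n.le_succ) le_rfl
    have h2 : Measurable[ℱ (n + 1)] (fun ω => scaled K (h (n + 1)) x (X (n + 1) ω)) :=
      ((measurable_scaled hK (h (n + 1)) x).comp measurable_fst).comp hZn
    have h3 : Measurable[ℱ (n + 1)] (Y (n + 1)) := measurable_snd.comp hZn
    simp only [estimator_succ]
    exact ((measurable_const.sub (h2.const_mul _)).mul h1).add ((h2.const_mul _).mul h3)

/-- Almost sure bound, on the grid, for the process driven by the innovations. -/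
theorem driven_le_on_grid (hX : ∀ n, Measurable (X n)) (hY : ∀ n, Measurable (Y n))
    (hind : iIndepFun (fun n ω => (X n ω, Y n ω)) μ)
    (hlaw : ∀ n, μ.map (fun ω => (X n ω, Y n ω)) = ν)
    (hmb : MomentBounds ν K h (Ioo c d) f r A C f₀) (hA : 0 ≤ A) (hcd : c < d)
    (hK : A1 K) (hM : ∀ z, K z ≤ M) (hh : ∀ n, 1 ≤ n → 0 < h n) (hB : ∀ n, 1 ≤ B n) (v : ℝ)
    {ρ : ℝ → ℕ → ℝ} {w T : ℕ → ℝ} (hT0 : ∀ᶠ n in atTop, 0 < T n)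
    (hTb : ∀ᶠ n in atTop, 4 * (A + C + 1) * M * (|w n| * ((h n)⁻¹ * (logFactor n + B n))) ≤ T n)
    (hT : ∀ᶠ n in atTop, ∀ x ∈ Ioo c d,
      ρ x n ^ 2 * T (n - 1) ^ 2 + 4 * (w n ^ 2 * (C * (h n)⁻¹ * B n ^ 2)) ≤ T n ^ 2) :
    ∃ N, ∀ᵐ ω ∂μ, ∀ᶠ n in atTop, ∀ i < n ^ 2,
      |driven N (ρ (gridPoint c d n i)) w (innovation ν K h r A B (gridPoint c d n i)
        (fun k => (X k ω, Y k ω)) (fun k => estimator K γ h (fun _ => v) (fun k => X k ω)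
          (fun k => Y k ω) k (gridPoint c d n i) - r (gridPoint c d n i))) n| ≤
        4 * logFactor n * T n := by
  have hC0 := hmb.nonneg hcd
  have hM0 : 0 ≤ M := (hK.nonneg 0).trans (hM 0)
  obtain ⟨N, hN⟩ := eventually_atTop.1 (((((hT0.and hTb).and hT).and hmb.sq_kernel).and
    hmb.sq_noise).and (eventually_ge_atTop 1))
  refine ⟨N, ?_⟩
  refine ae_eventually_grid (I := Ioo c d) (N := N) (U := fun x n ω =>
    driven N (ρ x) w (innovation ν K h r A B x
        (fun k => (X k ω, Y k ω)) (fun k => estimator K γ h (fun _ => v) (fun k => X k ω)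
          (fun k => Y k ω) k x - r x)) n) (fun n hn => (hN n hn).1.1.1.1.1) ?_
    (gridPoint_mem hcd)
  intro x hx n hn
  have hZ : ∀ n, Measurable (fun ω => (X n ω, Y n ω)) := fun n => (hX n).prodMk (hY n)
  have hb0 : ∀ n, N < n → 0 ≤ (h n)⁻¹ := fun n hn =>
    (inv_pos.2 (hh n (hN n hn.le).2)).le
  refine (exp_moment_le (Z := fun n ω => (X n ω, Y n ω)) hZ hind hlaw (N := N)
    (U := fun n ω => driven N (ρ x) w (innovation ν K h r A B x (fun k => (X k ω, Y k ω))
      (fun k => estimator K γ h (fun _ => v) (fun k => X k ω) (fun k => Y k ω) k x - r x)) n)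
    -- The multiplier of the kernel noise at time `n + 1` is the error at time `n`, hence a function
    -- of the past; the clipping makes it bounded.
    (p := fun n ω => clip (B (n + 1)) (estimator K γ h (fun _ => v) (fun k => X k ω)
          (fun k => Y k ω) n x - r x))
    (F := fun k => noise ν K h r A k x) (G := fun k => kernelNoise ν K h k x)
    -- This single `b` dominates both the truncated noise, at most `2(A + C) M h⁻¹ log`, and the
    -- kernel noise times the clipping level, at most `M h⁻¹ B`.
    (ρ := ρ x) (w := w) (b := fun n => 2 * (A + C + 1) * M * ((h n)⁻¹ * (logFactor n + B n)))
    (B := B) (v := fun n => C * (h n)⁻¹ * B n ^ 2) (T := T)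
    (fun ω => driven_self _ _ _ _) ?_ ?_ ?_ ?_ ?_ ?_ ?_ ?_ ?_ ?_ ?_ ?_ ?_ ?_ ?_ n hn).2
  · intro n hn ω
    rw [driven_succ hn, innovation, Nat.add_sub_cancel]
  · intro n
    exact (measurable_clip _).comp
      ((measurable_estimator hK hX hY (fun _ => v) x n).sub_const _)
  · intro n
    exact (measurable_truncated hK n x).sub_const _
  · intro n
    exact ((measurable_scaled hK _ _).comp measurable_fst).const_sub _
  · intro n _ ω
    exact abs_clip_le (zero_le_one.trans (hB _)) _
  · intro n hn z
    refine (abs_noise_le hmb hA hcd hK hM hh (hN n hn.le).2 hx z).trans ?_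
    have := hb0 n hn
    have hl := one_le_logFactor n
    have hBn := hB n
    have : (h n)⁻¹ * logFactor n ≤ (h n)⁻¹ * (logFactor n + B n) := by gcongr; linarith
    calc 2 * ((A + C) * M * ((h n)⁻¹ * logFactor n)) =
        2 * (A + C) * M * ((h n)⁻¹ * logFactor n) := by ring
      _ ≤ _ := mul_le_mul (by linarith) this (by positivity) (by positivity)
  · intro n hn z
    have := hb0 n hn
    have hl := one_le_logFactor n
    have hBn := hB n
    calc |kernelNoise ν K h n x z| * B n ≤ M * (h n)⁻¹ * B n :=
          mul_le_mul_of_nonneg_right (abs_kernelNoise_le hK hM hh (hN n hn.le).2 x z)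
            (by linarith)
      _ = 1 * M * ((h n)⁻¹ * (0 + B n)) := by ring
      _ ≤ 2 * (A + C + 1) * M * ((h n)⁻¹ * (logFactor n + B n)) := by
          gcongr <;> linarith
  · exact fun n hn => (noise_moments hmb hA hcd hK hM hh (hN n hn.le).2 hx).1
  · exact fun n hn => (kernelNoise_moments hK hM hh (hN n hn.le).2 x).1
  · intro n hn
    have h1 := (noise_moments hmb hA hcd hK hM hh (hN n hn.le).2 hx).2
    have h2 := (hN n hn.le).1.2 x hx
    have h3 : 1 ≤ B n ^ 2 := one_le_pow₀ (hB n)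
    have h4 : 0 ≤ C * (h n)⁻¹ := mul_nonneg hC0 (hb0 n hn)
    exact (h1.trans h2).trans (le_mul_of_one_le_right h4 h3)
  · intro n hn
    have h1 := (kernelNoise_moments (ν := ν) hK hM hh (hN n hn.le).2 x).2
    have h2 := (hN n hn.le).1.1.2 x hx
    rw [mul_comm]
    exact mul_le_mul_of_nonneg_right (h1.trans h2) (sq_nonneg _)
  · exact fun n hn => (hN n hn).1.1.1.1.1.le
  · intro n hn
    refine le_trans (le_of_eq ?_) (hN (n + 1) (by omega)).1.1.1.1.2
    ring
  · exact fun n hn => (hN (n + 1) (by omega)).1.1.1.2 x hx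
  · exact fun n hn => mul_nonneg (mul_nonneg hC0 (hb0 n hn)) (sq_nonneg _)

end Grid

end Revesz

/-! ### Uniform rate of the non-averaged estimator. -/

namespace Revesz

/-- Growth conditions on the stepsize `γ` and the bandwidth `h`. -/
structure Design (γ h : ℕ → ℝ) (α a : ℝ) : Prop where
  step : GS γ (-α)
  band : GS h (-a)
  diverges : Tendsto (fun n : ℕ => (n : ℝ) * γ n) atTop atTop
  a_pos : 0 < a
  two_mul_lt : 2 * a < α
  le_one : α ≤ 1

namespace Design

variable {γ h : ℕ → ℝ} {α a : ℝ} (hD : Design γ h α a)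
include hD

theorem tendsto_step : Tendsto γ atTop (𝓝 0) :=
  hD.step.evGS.tendsto_zero (by linarith [hD.a_pos, hD.two_mul_lt])

theorem step_nonneg : ∀ᶠ n in atTop, 0 ≤ γ n :=
  hD.step.evGS.1.mono fun _ hn => hn.le

theorem tendsto_variance : Tendsto (fun n => γ n * (h n)⁻¹ * logFactor n ^ 2) atTop (𝓝 0) :=
  ((hD.step.evGS.mul hD.band.evGS.inv).mul (evGS_logFactor.pow 2)).tendsto_zero
    (by linarith [hD.a_pos, hD.two_mul_lt])

theorem step_mul_inv_band_le (M : ℝ) : ∀ᶠ k in atTop, γ k * (M * (h k)⁻¹) ≤ 1 := by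
  have h1 : Tendsto (fun n => M * (γ n * (h n)⁻¹)) atTop (𝓝 (M * 0)) :=
    ((hD.step.evGS.mul hD.band.evGS.inv).tendsto_zero
      (by linarith [hD.a_pos, hD.two_mul_lt])).const_mul M
  rw [mul_zero] at h1
  filter_upwards [h1.eventually_lt_const one_pos] with n hn
  linarith

theorem step_mul_sq_inv_band_le :
    ∃ D, ∀ᶠ k in atTop, γ k * ((h k)⁻¹ ^ 2 * logFactor k) ≤ D :=
  (hD.step.evGS.mul ((hD.band.evGS.inv.pow 2).mul evGS_logFactor)).eventually_le_of_neg
    (by push_cast; linarith [hD.a_pos, hD.two_mul_lt])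

/-- The loss in passing from the grid to the interval is `O(1/n)`; it is absorbed by the bias since
`2a < 1`. -/
theorem inv_natCast_le : ∃ D, 0 ≤ D ∧ ∀ᶠ n : ℕ in atTop, (n : ℝ)⁻¹ ≤ D * h n ^ 2 := by
  obtain ⟨D, hC⟩ := (EvGS.natCast.inv.mul (hD.band.evGS.pow 2).inv).eventually_le_of_neg
    (by push_cast; linarith [hD.a_pos, hD.two_mul_lt, hD.le_one])
  refine ⟨|D|, abs_nonneg D, ?_⟩
  filter_upwards [hC, hD.band.evGS.1] with n h1 h2
  have : (n : ℝ)⁻¹ = ((n : ℝ)⁻¹ * (h n ^ 2)⁻¹) * h n ^ 2 := by field_simp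
  rw [this]
  exact mul_le_mul_of_nonneg_right (h1.trans (le_abs_self D)) (sq_nonneg _)

end Design

/-- Error of the estimator started from the constant `v`. -/
noncomputable def err (K : ℝ → ℝ) (γ h : ℕ → ℝ) (v : ℝ) (r : ℝ → ℝ) (zs : ℕ → ℝ × ℝ) (x : ℝ)
    (n : ℕ) : ℝ :=
  estimator K γ h (fun _ => v) (fun k => (zs k).1) (fun k => (zs k).2) n x - r x

section Deterministic

variable {ν : Measure (ℝ × ℝ)} [IsProbabilityMeasure ν] {K : ℝ → ℝ} {γ h : ℕ → ℝ}
  {f r : ℝ → ℝ} {A C f₀ c d M α a : ℝ} {B : ℕ → ℝ} {zs : ℕ → ℝ × ℝ} {v : ℝ}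

-- Once `Y` and the error lie below their truncation levels, both clippings are inactive and the
-- recursion splits exactly into contraction, innovation and remainder.
omit [IsProbabilityMeasure ν] in
theorem err_step (hmb : MomentBounds ν K h (Ioo c d) f r A C f₀)
    (hY : ∀ᶠ k in atTop, |(zs k).2| ≤ A * logFactor k)
    (he : ∀ᶠ n in atTop, ∀ x ∈ Ioo c d, |err K γ h v r zs x n| ≤ B (n + 1)) :
    ∀ᶠ n in atTop, ∀ x ∈ Ioo c d, ∃ β,
      |β| ≤ C * h (n + 1) ^ 2 * (1 + |err K γ h v r zs x n|) ∧
      err K γ h v r zs x (n + 1) = (1 - γ (n + 1) * f x) * err K γ h v r zs x n +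
        γ (n + 1) * (innovation ν K h r A B x zs (err K γ h v r zs x) (n + 1) + β) := by
  filter_upwards [(tendsto_add_atTop_nat 1).eventually hY, he,
    (tendsto_add_atTop_nat 1).eventually hmb.mean_kernel,
    (tendsto_add_atTop_nat 1).eventually hmb.mean_noise] with n h1 h2 h3 h4 x hx
  -- The remainder `β` collects the two means: the smoothing bias of the density multiplied by the
  -- current error, and the mean of the truncated noise.
  refine ⟨(f x - ∫ z, scaled K (h (n + 1)) x z.1 ∂ν) * err K γ h v r zs x n +
    ∫ z, (clip (A * logFactor (n + 1)) z.2 - r x) * scaled K (h (n + 1)) x z.1 ∂ν, ?_, ?_⟩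
  · refine (abs_add_le _ _).trans ?_
    rw [abs_mul, abs_sub_comm]
    have k1 := mul_le_mul_of_nonneg_right (h3 x hx) (abs_nonneg (err K γ h v r zs x n))
    linarith [h4 x hx]
  · rw [innovation, Nat.add_sub_cancel, clip_of_abs_le (h2 x hx)]
    simp only [noise, kernelNoise]
    rw [clip_of_abs_le h1]
    simp only [err, estimator_succ]
    ring

/-- The error minus the driven process obeys the same contraction with forcing only `γ β`, so it is
`O(h_n² B_n)` by comparison, uniformly in `x`. The driven process need be bounded only on the grid,
because the Lipschitz bound is applied to the full error afterwards. -/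
theorem err_bound_of_grid (hmb : MomentBounds ν K h (Ioo c d) f r A C f₀) (hA : 0 ≤ A)
    (hcd : c < d) (hK : A1 K) (hM : ∀ z, K z ≤ M) {L : ℝ} (hL : ∀ y z, |K y - K z| ≤ L * |y - z|)
    (hD : Design γ h α a) (hB1 : ∀ n, 1 ≤ B n) (hB : EvGS B 0) {N : ℕ} {κ : ℝ}
    (hY : ∀ᶠ k in atTop, |(zs k).2| ≤ A * logFactor k)
    (he : ∀ᶠ n in atTop, ∀ x ∈ Ioo c d, |err K γ h v r zs x n| ≤ B (n + 1))
    (hgrid : ∀ᶠ n in atTop, ∀ i < n ^ 2,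
      |driven N (fun k => 1 - γ k * f (gridPoint c d n i)) γ
        (innovation ν K h r A B (gridPoint c d n i) zs (err K γ h v r zs (gridPoint c d n i))) n| ≤
        4 * logFactor n * (κ * (√(γ n * (h n)⁻¹) * B n))) :
    ∃ C', ∀ᶠ n in atTop, ∀ x ∈ Ioo c d,
      |err K γ h v r zs x n| ≤ C' * ((√(γ n * (h n)⁻¹) * logFactor n + h n ^ 2) * B n) := by
  have hC0 := hmb.nonneg hcd
  have hf₀ := hmb.pos
  have hγp := hD.step.1
  have hhp := hD.band.1
  set V : ℕ → ℝ := fun n => h n ^ 2 * B n with hV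
  have hVgs : EvGS V (2 * -a + 0) := by
    have := (hD.band.evGS.pow 2).mul hB
    exact_mod_cast this
  have hdrift := hVgs.drift_of_tendsto hD.step_nonneg hD.diverges hf₀ hD.tendsto_step
  have hsmall : ∀ᶠ n in atTop, (C + f₀) * γ n < 1 := by
    have : Tendsto (fun n => (C + f₀) * γ n) atTop (𝓝 ((C + f₀) * 0)) :=
      hD.tendsto_step.const_mul _
    rw [mul_zero] at this
    exact this.eventually_lt_const one_pos
  have hstep := err_step hmb hY he
  obtain ⟨N₀, hN₀⟩ := eventually_atTop.1 (((hdrift.and hsmall).and hstep).and he)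
  set N₁ := max N₀ (max N 1) with hN₁
  set U : ℝ → ℕ → ℝ := fun x => driven N (fun k => 1 - γ k * f x) γ
    (innovation ν K h r A B x zs (err K γ h v r zs x)) with hU
  have hUb : ∃ b, ∀ x ∈ Ioo c d, |U x N₁| ≤ b := by
    refine exists_bound_driven (fun n hn => ⟨1 + γ n * C, fun x hx => ?_⟩)
      (fun n hn => exists_bound_innovation hmb hA hcd hK hM hhp hB1 (by omega) zs _) (by omega)
    have hg := hγp n (by omega)
    have hfx := hf₀.trans_le (hmb.le_density x hx)
    refine (abs_sub _ _).trans ?_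
    rw [abs_one, abs_of_pos (mul_pos hg hfx)]
    have := mul_le_mul_of_nonneg_left (hmb.density_le x hx) hg.le
    linarith
  obtain ⟨b, hb⟩ := hUb
  have hV1 : 0 < V N₁ := mul_pos (pow_pos (hhp N₁ (by omega)) 2) (by linarith [hB1 N₁])
  -- Chosen so that `κ₁ * 2C ≤ f₀/2`, the part of the contraction left over by the drift of `V`.
  set κ₁ := f₀ / (4 * (C + 1)) with hκ₁
  have hκ₁0 : 0 < κ₁ := by positivity
  set C₁ := max ((B (N₁ + 1) + b) / V N₁) κ₁⁻¹ with hC₁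
  have hrem : ∀ n, N₁ ≤ n → ∀ x ∈ Ioo c d, |err K γ h v r zs x n - U x n| ≤ C₁ * V n := by
    intro n hn x hx
    refine le_mul_of_recursion (u := fun n => |err K γ h v r zs x n - U x n|) (V := V)
      (ρ := fun n => 1 - f₀ * γ n) (d := fun n => γ n * (2 * C * V n)) (N := N₁) (κ := κ₁)
      (C := C₁) hκ₁0 ?_ ?_ ?_ ?_ ?_ (le_max_right _ _) n hn
    · intro n hn
      have := (hN₀ n (by omega)).1.1.2
      have hg := hγp n (by omega)
      nlinarith
    · intro n hn
      have hg := hγp n (by omega)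
      have := hB1 n
      simp only [hV]
      positivity
    · intro n hn
      have h1 := (hN₀ n (by omega)).1.1.1
      have hg := hγp n (by omega)
      have hVn : 0 ≤ V n := mul_nonneg (sq_nonneg _) (zero_le_one.trans (hB1 n))
      have h2 : κ₁ * (γ n * (2 * C * V n)) ≤ f₀ / 2 * γ n * V n := by
        have : κ₁ * (2 * C) ≤ f₀ / 2 := by
          rw [hκ₁, div_mul_eq_mul_div, div_le_div_iff₀ (by positivity) two_pos]
          nlinarith
        calc κ₁ * (γ n * (2 * C * V n)) = (κ₁ * (2 * C)) * γ n * V n := by ring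
          _ ≤ _ := by gcongr
      linarith
    · intro n hn
      obtain ⟨m, rfl⟩ : ∃ m, n = m + 1 := ⟨n - 1, by omega⟩
      simp only [Nat.add_sub_cancel]
      obtain ⟨⟨⟨-, -⟩, h2⟩, h3⟩ := hN₀ m (by omega)
      have hsm := (hN₀ (m + 1) (by omega)).1.1.2
      obtain ⟨β, hβ, heq⟩ := h2 x hx
      have hg := hγp (m + 1) (by omega)
      have hUs : U x (m + 1) = (1 - γ (m + 1) * f x) * U x m + γ (m + 1) *
          innovation ν K h r A B x zs (err K γ h v r zs x) (m + 1) :=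
        driven_succ (by omega) _ _ _
      have hfl := hmb.le_density x hx
      have hfu := hmb.density_le x hx
      have k1 : 0 ≤ 1 - γ (m + 1) * f x := by
        have := mul_le_mul_of_nonneg_left hfu hg.le
        nlinarith
      have k2 : 1 - γ (m + 1) * f x ≤ 1 - f₀ * γ (m + 1) := by
        have := mul_le_mul_of_nonneg_left hfl hg.le
        linarith
      have k3 : err K γ h v r zs x (m + 1) - U x (m + 1) =
          (1 - γ (m + 1) * f x) * (err K γ h v r zs x m - U x m) + γ (m + 1) * β := by
        rw [heq, hUs]; ring
      rw [k3]
      refine (abs_add_le _ _).trans ?_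
      rw [abs_mul, abs_mul, abs_of_nonneg k1, abs_of_pos hg]
      refine add_le_add (mul_le_mul_of_nonneg_right k2 (abs_nonneg _))
        (mul_le_mul_of_nonneg_left (hβ.trans ?_) hg.le)
      have k4 := h3 x hx
      have k5 := hB1 (m + 1)
      have : 0 ≤ C * h (m + 1) ^ 2 := by positivity
      calc C * h (m + 1) ^ 2 * (1 + |err K γ h v r zs x m|) ≤
            C * h (m + 1) ^ 2 * (B (m + 1) + B (m + 1)) := by gcongr
        _ = _ := by simp only [hV]; ring
    · have h1 := (hN₀ N₁ (le_max_left _ _)).2 x hx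
      have h2 := hb x hx
      have h3 : |err K γ h v r zs x N₁ - U x N₁| ≤ B (N₁ + 1) + b :=
        (abs_sub _ _).trans (add_le_add h1 h2)
      calc _ ≤ (B (N₁ + 1) + b) / V N₁ * V N₁ := by rwa [div_mul_cancel₀ _ hV1.ne']
        _ ≤ _ := mul_le_mul_of_nonneg_right (le_max_left _ _) hV1.le
  obtain ⟨D₁, hD₁⟩ := hD.step_mul_sq_inv_band_le
  obtain ⟨D₂, hD₂0, hD₂⟩ := hD.inv_natCast_le
  obtain ⟨C₂, hC₂0, hC₂⟩ := estimator_lipschitz hK hM hγp hhp (xs := fun k => (zs k).1)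
    (ys := fun k => (zs k).2) hL v (hD.step_mul_inv_band_le M) hD₁ hY
  have hlip : ∀ᶠ n : ℕ in atTop, ∀ x ∈ Ioo c d, ∀ y ∈ Ioo c d,
      |err K γ h v r zs x n - err K γ h v r zs y n| ≤ (C₂ + C) * (n + 1) * |x - y| := by
    refine Eventually.of_forall fun n x hx y hy => ?_
    have h1 := hC₂ n x y
    have h2 := hmb.regression_lipschitz x hx y hy
    have h3 : err K γ h v r zs x n - err K γ h v r zs y n =
        (estimator K γ h (fun _ => v) (fun k => (zs k).1) (fun k => (zs k).2) n x -
          estimator K γ h (fun _ => v) (fun k => (zs k).1) (fun k => (zs k).2) n y) -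
        (r x - r y) := by unfold err; ring
    rw [h3]
    refine (abs_sub _ _).trans ((add_le_add h1 h2).trans ?_)
    have : C * |x - y| ≤ C * (n + 1) * |x - y| := by
      gcongr
      have : (0 : ℝ) ≤ n := Nat.cast_nonneg n
      nlinarith
    linarith
  have hR : ∀ᶠ n in atTop, ∀ i < n ^ 2, |err K γ h v r zs (gridPoint c d n i) n| ≤
      C₁ * V n + 4 * logFactor n * (κ * (√(γ n * (h n)⁻¹) * B n)) := by
    filter_upwards [hgrid, eventually_ge_atTop N₁] with n h1 h2 i hi
    have h3 := hrem n h2 _ (gridPoint_mem hcd n i hi)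
    have h4 := h1 i hi
    have h5 : err K γ h v r zs (gridPoint c d n i) n =
      (err K γ h v r zs (gridPoint c d n i) n - U (gridPoint c d n i) n) +
        U (gridPoint c d n i) n := by ring
    rw [h5]
    exact (abs_add_le _ _).trans (add_le_add h3 h4)
  have hsup := sup_le_of_grid (e := fun n x => err K γ h v r zs x n) (by positivity) hlip hR
  set E := 2 * (C₂ + C) * (d - c) with hE
  have hE0 : 0 ≤ E := mul_nonneg (by positivity) (by linarith)
  refine ⟨C₁ + 4 * |κ| + E * D₂, ?_⟩
  filter_upwards [hsup, hD₂] with n h1 h2 x hx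
  refine (h1 x hx).trans ?_
  have hl := one_le_logFactor n
  have hBn := hB1 n
  set s := √(γ n * (h n)⁻¹) with hs
  have hs0 : 0 ≤ s := Real.sqrt_nonneg _
  have hC₁0 : 0 ≤ C₁ := (inv_pos.2 hκ₁0).le.trans (le_max_right _ _)
  have t1 : C₁ * V n ≤ C₁ * ((s * logFactor n + h n ^ 2) * B n) := by
    simp only [hV]; gcongr
    have : 0 ≤ s * logFactor n := by positivity
    linarith
  have t2 : 4 * logFactor n * (κ * (s * B n)) ≤
      4 * |κ| * ((s * logFactor n + h n ^ 2) * B n) := by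
    calc 4 * logFactor n * (κ * (s * B n)) ≤ 4 * logFactor n * (|κ| * (s * B n)) := by
          gcongr; exact le_abs_self κ
      _ = 4 * |κ| * ((s * logFactor n + 0) * B n) := by ring
      _ ≤ _ := by gcongr; exact sq_nonneg _
  have t3 : E * (n : ℝ)⁻¹ ≤ E * D₂ * ((s * logFactor n + h n ^ 2) * B n) := by
    calc E * (n : ℝ)⁻¹ ≤ E * (D₂ * h n ^ 2) := by gcongr
      _ = E * D₂ * ((0 + h n ^ 2) * 1) := by ring
      _ ≤ _ := by gcongr; positivity
  linarith

end Deterministic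

section Rate

variable {Ω : Type*} [MeasurableSpace Ω] {μ : Measure Ω} [IsProbabilityMeasure μ]
  {X Y : ℕ → Ω → ℝ} {ν : Measure (ℝ × ℝ)} [IsProbabilityMeasure ν]
  {K : ℝ → ℝ} {γ h : ℕ → ℝ} {f r : ℝ → ℝ} {A C f₀ c d M L α a τ : ℝ}

omit [IsProbabilityMeasure ν] in
theorem ae_eventually_abs_le (hX : ∀ n, Measurable (X n)) (hY : ∀ n, Measurable (Y n))
    (hlaw : ∀ n, μ.map (fun ω => (X n ω, Y n ω)) = ν) (hτ : 0 < τ)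
    (hexp : Integrable (fun z : ℝ × ℝ => Real.exp (τ * |z.2|)) ν) :
    ∀ᵐ ω ∂μ, ∀ᶠ k in atTop, |Y k ω| ≤ 4 / τ * logFactor k := by
  have hem : Measurable (fun z : ℝ × ℝ => Real.exp (τ * |z.2|)) := by fun_prop
  set m := ∫ z, Real.exp (τ * |z.2|) ∂ν with hm
  have hm0 : 0 ≤ m := integral_nonneg fun z => (Real.exp_pos _).le
  have hsum : (∑' n, μ {ω | 1 ≤ n ∧ 4 / τ * logFactor n ≤ |Y n ω|}) ≠ ⊤ := by
    have h1 : ∀ n : ℕ, μ {ω | 1 ≤ n ∧ 4 / τ * logFactor n ≤ |Y n ω|} ≤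
        ENNReal.ofReal (m * ((n : ℝ) ^ 4)⁻¹) := by
      intro n
      by_cases hn : 1 ≤ n
      · simp only [hn, true_and]
        rw [← ofReal_measureReal (measure_ne_top μ _)]
        apply ENNReal.ofReal_le_ofReal
        have hp : Measurable (fun ω => (X n ω, Y n ω)) := (hX n).prodMk (hY n)
        have hi : Integrable (fun ω => Real.exp (τ * |Y n ω|)) μ := by
          rw [← hlaw n] at hexp
          exact (integrable_map_measure hem.aestronglyMeasurable hp.aemeasurable).1 hexp
        have he : mgf (fun ω => |Y n ω|) μ τ = m := by
          rw [hm, ← hlaw n, integral_map hp.aemeasurable hem.aestronglyMeasurable]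
          rfl
        have h2 := measure_ge_le_exp_mul_mgf (μ := μ) (X := fun ω => |Y n ω|)
          (4 / τ * logFactor n) hτ.le hi
        rw [he] at h2
        refine h2.trans ?_
        rw [mul_comm]
        apply mul_le_mul_of_nonneg_left _ hm0
        refine le_trans (Real.exp_le_exp.2 ?_) (exp_neg_four_logFactor_le hn)
        have : -τ * (4 / τ * logFactor n) = -(4 * logFactor n) := by field_simp
        rw [this]; linarith
      · simp [hn]
    refine ne_top_of_le_ne_top ?_ (ENNReal.tsum_le_tsum h1)
    exact ((Real.summable_nat_pow_inv.2 (by norm_num)).mul_left m).tsum_ofReal_ne_top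
  filter_upwards [ae_eventually_notMem hsum] with ω hω
  filter_upwards [hω, eventually_ge_atTop 1] with n h1 h2
  by_contra hcon
  exact h1 ⟨h2, (not_le.1 hcon).le⟩

variable (hX : ∀ n, Measurable (X n)) (hY : ∀ n, Measurable (Y n))
  (hind : iIndepFun (fun n ω => (X n ω, Y n ω)) μ)
  (hlaw : ∀ n, μ.map (fun ω => (X n ω, Y n ω)) = ν)
  (hmb : MomentBounds ν K h (Ioo c d) f r A C f₀) (hA : 0 ≤ A) (hcd : c < d)
  (hK : A1 K) (hM : ∀ z, K z ≤ M) (hL : ∀ y z, |K y - K z| ≤ L * |y - z|)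
  (hD : Design γ h α a) (v : ℝ)
include hX hY hind hlaw hmb hA hcd hK hM hL hD

/-- One bootstrap step: an a priori bound `B` on the error is improved to the target rate times `B`.
The innovations are clipped at `B`, so the exceptional null set does not depend on whether the a
priori bound holds. -/
theorem err_bound_of_bound {B : ℕ → ℝ} (hB1 : ∀ n, 1 ≤ B n) (hB : EvGS B 0)
    (hYb : ∀ᵐ ω ∂μ, ∀ᶠ k in atTop, |Y k ω| ≤ A * logFactor k) :
    ∀ᵐ ω ∂μ, (∀ᶠ n in atTop, ∀ x ∈ Ioo c d,
        |err K γ h v r (fun k => (X k ω, Y k ω)) x n| ≤ B (n + 1)) →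
      ∃ C', ∀ᶠ n in atTop, ∀ x ∈ Ioo c d, |err K γ h v r (fun k => (X k ω, Y k ω)) x n| ≤
        C' * ((√(γ n * (h n)⁻¹) * logFactor n + h n ^ 2) * B n) := by
  have hC0 := hmb.nonneg hcd
  have hf₀ := hmb.pos
  have hM0 : 0 ≤ M := (hK.nonneg 0).trans (hM 0)
  -- the squared scale is `κ₀` times `V`
  set V : ℕ → ℝ := fun n => γ n * (h n)⁻¹ * B n ^ 2 with hV
  have hVgs : EvGS V (-α + - -a + 2 * 0) := by
    have := (hD.step.evGS.mul hD.band.evGS.inv).mul (hB.pow 2)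
    exact_mod_cast this
  -- The first summand makes the variance `4 C γ V` fit into the spare contraction `κ₀ (f₀/2) γ V`.
  -- The second makes `T` exceed the largest increments, whose square is that constant times `γ h⁻¹
  -- log² n` times `V`, with `γ h⁻¹ log² n → 0`.
  set κ₀ := 8 * C / f₀ + (8 * (A + C + 1) * M) ^ 2 + 1 with hκ₀
  have hκ₀0 : 0 < κ₀ := by positivity
  set T : ℕ → ℝ := fun n => √κ₀ * (√(γ n * (h n)⁻¹) * B n) with hT
  have hTsq : ∀ᶠ n in atTop, T n ^ 2 = κ₀ * V n := by
    filter_upwards [eventually_ge_atTop 1] with n hn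
    have h1 : 0 ≤ γ n * (h n)⁻¹ :=
      mul_nonneg (hD.step.1 n hn).le (inv_pos.2 (hD.band.1 n hn)).le
    simp only [hT, hV]
    rw [mul_pow, mul_pow, Real.sq_sqrt hκ₀0.le, Real.sq_sqrt h1]
  have hTpos : ∀ᶠ n in atTop, 0 < T n := by
    filter_upwards [eventually_ge_atTop 1] with n hn
    have h1 : 0 < γ n * (h n)⁻¹ := mul_pos (hD.step.1 n hn) (inv_pos.2 (hD.band.1 n hn))
    exact mul_pos (Real.sqrt_pos.2 hκ₀0) (mul_pos (Real.sqrt_pos.2 h1) (by linarith [hB1 n]))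
  have hsmall : ∀ᶠ n in atTop, (C + f₀) * γ n < 1 := by
    have : Tendsto (fun n => (C + f₀) * γ n) atTop (𝓝 ((C + f₀) * 0)) :=
      hD.tendsto_step.const_mul _
    rw [mul_zero] at this
    exact this.eventually_lt_const one_pos
  have hTb : ∀ᶠ n in atTop,
      4 * (A + C + 1) * M * (|γ n| * ((h n)⁻¹ * (logFactor n + B n))) ≤ T n := by
    filter_upwards [hTsq, hTpos, eventually_ge_atTop 1,
      hD.tendsto_variance.eventually_lt_const one_pos] with n h1 h2 h3 h4
    have hg := hD.step.1 n h3
    have hh := inv_pos.2 (hD.band.1 n h3)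
    have hl := one_le_logFactor n
    have hBn := hB1 n
    apply le_of_sq_le_sq _ h2.le
    rw [h1, abs_of_pos hg]
    have k1 : logFactor n + B n ≤ 2 * (logFactor n * B n) := by nlinarith
    calc (4 * (A + C + 1) * M * (γ n * ((h n)⁻¹ * (logFactor n + B n)))) ^ 2
        ≤ (4 * (A + C + 1) * M * (γ n * ((h n)⁻¹ * (2 * (logFactor n * B n))))) ^ 2 := by
          gcongr
      _ = (8 * (A + C + 1) * M) ^ 2 * (γ n * (h n)⁻¹ * logFactor n ^ 2) *
          (γ n * (h n)⁻¹ * B n ^ 2) := by ring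
      _ ≤ κ₀ * 1 * (γ n * (h n)⁻¹ * B n ^ 2) := by
          gcongr
          rw [hκ₀]
          have : 0 ≤ 8 * C / f₀ := by positivity
          linarith
      _ = κ₀ * V n := by rw [mul_one]
  have hTr : ∀ᶠ n in atTop, ∀ x ∈ Ioo c d, (1 - γ n * f x) ^ 2 * T (n - 1) ^ 2 +
      4 * (γ n ^ 2 * (C * (h n)⁻¹ * B n ^ 2)) ≤ T n ^ 2 := by
    filter_upwards [hTsq, (tendsto_sub_atTop_nat 1).eventually hTsq, hVgs.eventually_pos_pred,
      eventually_ge_atTop 1, hVgs.drift_of_tendsto hD.step_nonneg hD.diverges hf₀ hD.tendsto_step,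
      hsmall] with n h1 h2 h3 h4 h5 h6 x hx
    have hg := hD.step.1 n h4
    have hh := inv_pos.2 (hD.band.1 n h4)
    have hfl := hmb.le_density x hx
    have hfu := hmb.density_le x hx
    rw [h1, h2]
    have k1 : 0 ≤ 1 - γ n * f x := by
      have := mul_le_mul_of_nonneg_left hfu hg.le
      nlinarith
    have k2 : 1 - γ n * f x ≤ 1 - f₀ * γ n := by
      have := mul_le_mul_of_nonneg_left hfl hg.le
      linarith
    have k3 : (1 - γ n * f x) ^ 2 ≤ 1 - f₀ * γ n := by
      have : 0 ≤ γ n * f x := mul_nonneg hg.le (hf₀.le.trans hfl)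
      nlinarith
    have k4 : 0 ≤ V n := by simp only [hV]; positivity
    have k5 : 4 * (γ n ^ 2 * (C * (h n)⁻¹ * B n ^ 2)) = 4 * C * γ n * V n := by
      simp only [hV]; ring
    have k6 : 4 * C ≤ κ₀ * (f₀ / 2) := by
      have e1 : 8 * C / f₀ ≤ κ₀ := by rw [hκ₀]; linarith [sq_nonneg (8 * (A + C + 1) * M)]
      rw [div_le_iff₀ hf₀] at e1
      linarith
    calc _ ≤ (1 - f₀ * γ n) * (κ₀ * V (n - 1)) + 4 * C * γ n * V n := by
          rw [k5]; gcongr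
      _ = κ₀ * ((1 - f₀ * γ n) * V (n - 1)) + 4 * C * (γ n * V n) := by ring
      _ ≤ κ₀ * ((1 - f₀ / 2 * γ n) * V n) + κ₀ * (f₀ / 2) * (γ n * V n) := by
          gcongr
      _ = κ₀ * V n := by ring
  obtain ⟨N, hN⟩ := driven_le_on_grid (γ := γ) (B := B) hX hY hind hlaw hmb hA hcd hK hM
    hD.band.1 hB1 v (ρ := fun x k => 1 - γ k * f x) (w := γ) (T := T) hTpos hTb hTr
  filter_upwards [hN, hYb] with ω h1 h2 h3
  exact err_bound_of_grid hmb hA hcd hK hM hL hD hB1 hB h2 h3 h1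

/-- Almost sure uniform rate of the non-averaged estimator. -/
theorem err_rate (hYb : ∀ᵐ ω ∂μ, ∀ᶠ k in atTop, |Y k ω| ≤ A * logFactor k) :
    ∀ᵐ ω ∂μ, ∃ C', ∀ᶠ n in atTop, ∀ x ∈ Ioo c d,
      |err K γ h v r (fun k => (X k ω, Y k ω)) x n| ≤
        C' * (√(γ n * (h n)⁻¹) * logFactor n + h n ^ 2) := by
  have hlog : Tendsto logFactor atTop atTop :=
    tendsto_atTop_add_const_left _ _ (Real.tendsto_log_atTop.comp tendsto_natCast_atTop_atTop)
  -- The a priori bound is `C₁ log n` with a random constant, so the deterministic level `log² n` is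
  -- used: it eventually exceeds all of them.
  have r1 := err_bound_of_bound hX hY hind hlaw hmb hA hcd hK hM hL hD v
    (B := fun n => logFactor n ^ 2) (fun n => one_le_pow₀ (one_le_logFactor n))
    (by simpa using evGS_logFactor.pow 2) hYb
  have r2 := err_bound_of_bound hX hY hind hlaw hmb hA hcd hK hM hL hD v
    (B := fun _ => 1) (fun n => le_rfl) (EvGS.const one_pos) hYb
  filter_upwards [r1, r2, hYb] with ω h1 h2 h3
  have hb := estimator_bounded hK hM hD.step.1 hD.band.1 (xs := fun k => X k ω)
    (ys := fun k => Y k ω) v (hD.step_mul_inv_band_le M) h3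
  obtain ⟨C₁, hC₁⟩ := hb
  obtain ⟨C₂, hC₂⟩ := h1 (by
    filter_upwards [hC₁, hlog.eventually_ge_atTop (C₁ + C)] with n k1 k2 x hx
    have k3 := logFactor_mono n.le_succ
    have k4 := one_le_logFactor n
    have k5 : |err K γ h v r (fun k => (X k ω, Y k ω)) x n| ≤ C₁ * logFactor n + C :=
      (abs_sub _ _).trans (add_le_add (k1 x) (hmb.abs_regression_le x hx))
    have hC0 := hmb.nonneg hcd
    calc _ ≤ C₁ * logFactor n + C := k5
      _ ≤ (C₁ + C) * logFactor n := by nlinarith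
      _ ≤ logFactor n * logFactor n := by gcongr
      _ ≤ logFactor (n + 1) ^ 2 := by
          rw [sq]
          exact mul_le_mul k3 k3 (by linarith) (by linarith [one_le_logFactor (n + 1)]))
  -- The extra `log² n` does not prevent the first bound from tending to zero; the error is
  -- eventually below 1 and a second pass with `B = 1` removes it.
  have hsm : Tendsto (fun n => C₂ * ((√(γ n * (h n)⁻¹) * logFactor n + h n ^ 2) *
      logFactor n ^ 2)) atTop (𝓝 (C₂ * 0)) := by
    apply Tendsto.const_mul
    have e1 := (((hD.step.evGS.mul hD.band.evGS.inv).sqrt.mul evGS_logFactor).mul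
      (evGS_logFactor.pow 2)).tendsto_zero (by linarith [hD.a_pos, hD.two_mul_lt])
    have e2 := ((hD.band.evGS.pow 2).mul (evGS_logFactor.pow 2)).tendsto_zero
      (by push_cast; linarith [hD.a_pos])
    have := e1.add e2
    simpa only [add_mul, add_zero] using this
  rw [mul_zero] at hsm
  obtain ⟨C₃, hC₃⟩ := h2 (by
    filter_upwards [hC₂, hsm.eventually_lt_const one_pos] with n k1 k2 x hx
    exact (k1 x hx).trans k2.le)
  exact ⟨C₃, by simpa only [mul_one] using hC₃⟩

end Rate

end Revesz

/-! ### Averaging: summation by parts and the uniform rate. -/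

namespace Revesz

theorem EvGS.pred_le {v : ℕ → ℝ} {e : ℝ} (hv : EvGS v e) :
    ∀ᶠ n : ℕ in atTop, v (n - 1) ≤ 2 * v n := by
  filter_upwards [hv.1, hv.tendsto_ratio.eventually_lt_const one_lt_two] with n h1 h2
  exact ((div_lt_iff₀ h1).1 h2).le

/-- Partial sums of a sequence of `GS(e)` dominate `n v_n`. -/
theorem GS.natCast_mul_le_sum {v : ℕ → ℝ} {e : ℝ} (hv : GS v e) :
    ∃ C, 0 < C ∧ ∀ᶠ n : ℕ in atTop, n * v n ≤ C * ∑ k ∈ Finset.Icc 1 n, v k := by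
  have h1 := (EvGS.natCast.mul hv.evGS).abs_sub_le
  set κ := (|1 + e| + 1)⁻¹ with hκ
  have hκ0 : 0 < κ := by positivity
  obtain ⟨N, hN⟩ := eventually_atTop.1 (h1.and (eventually_ge_atTop 1))
  have hpos : ∀ n, 1 ≤ n → 0 < ∑ k ∈ Finset.Icc 1 n, v k := fun n hn =>
    Finset.sum_pos (fun k hk => hv.1 k (Finset.mem_Icc.1 hk).1) ⟨1, Finset.mem_Icc.2 ⟨le_rfl, hn⟩⟩
  have hN1 := (hN N le_rfl).2
  have hSN := hpos N hN1
  refine ⟨max (N * v N / ∑ k ∈ Finset.Icc 1 N, v k) κ⁻¹,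
    lt_max_of_lt_right (inv_pos.2 hκ0), eventually_atTop.2 ⟨N, ?_⟩⟩
  refine le_mul_of_recursion (u := fun n => n * v n) (V := fun n => ∑ k ∈ Finset.Icc 1 n, v k)
    (ρ := fun _ => 1) (d := fun n => (|1 + e| + 1) * v n) (N := N) (κ := κ) hκ0
    (fun _ _ => zero_le_one) ?_ ?_ ?_ ?_ (le_max_right _ _)
  · intro n hn
    have := hv.1 n (by omega)
    positivity
  · intro n hn
    obtain ⟨m, rfl⟩ : ∃ m, n = m + 1 := ⟨n - 1, by omega⟩
    simp only [Nat.add_sub_cancel]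
    rw [Finset.sum_Icc_succ_top (by omega), ← mul_assoc, hκ, inv_mul_cancel₀ (by positivity),
      one_mul, one_mul]
  · intro n hn
    obtain ⟨h2, h3⟩ := hN n hn.le
    have h4 : (n : ℝ) ≠ 0 := by positivity
    rw [mul_div_cancel_left₀ _ h4] at h2
    linarith [(abs_le.1 h2).2]
  · calc (N : ℝ) * v N = N * v N / (∑ k ∈ Finset.Icc 1 N, v k) * ∑ k ∈ Finset.Icc 1 N, v k := by
          field_simp
      _ ≤ _ := mul_le_mul_of_nonneg_right (le_max_left _ _) hSN.le

/-- The rate `√(1 / (n h_n)) (1 + log n) + h_n²`. -/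
noncomputable def rate (h : ℕ → ℝ) (n : ℕ) : ℝ :=
  √((n : ℝ)⁻¹ * (h n)⁻¹) * logFactor n + h n ^ 2

section Averaged

variable {γ h w : ℕ → ℝ} {α a q : ℝ}

/-- The two summands of `n w_n rate_n` have exponents `(1 + a)/2 - q` and `1 - 2a - q`, positive
exactly by the condition on `q`. Hence sums of terms `O(w_k rate_k)` are `O(n w_n rate_n)`. -/
theorem rate_drift (hD : Design γ h α a) (hw : GS w (-q)) (hq : q < min (1 - 2 * a) ((1 + a) / 2)) :
    ∃ δ, 0 < δ ∧ ∀ᶠ n : ℕ in atTop, ((n - 1 : ℕ) : ℝ) * w (n - 1) * rate h (n - 1) +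
      δ * (w n * rate h n) ≤ n * w n * rate h n := by
  have hq1 := hq.trans_le (min_le_left _ _)
  have hq2 := hq.trans_le (min_le_right _ _)
  have g1 := ((EvGS.natCast.mul hw.evGS).mul
    ((EvGS.natCast.inv.mul hD.band.evGS.inv).sqrt.mul evGS_logFactor))
  have g2 := ((EvGS.natCast.mul hw.evGS).mul (hD.band.evGS.pow 2))
  push_cast at g2
  set δ := min ((1 - 2 * a - q) / 2) (((1 + a) / 2 - q) / 2) with hδ
  have hδ0 : 0 < δ := lt_min (by linarith) (by linarith)
  have d1 := g1.le_of_drift (δ := δ) ((min_le_right _ _).trans_lt (by linarith))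
  have d2 := g2.le_of_drift (δ := δ) ((min_le_left _ _).trans_lt (by linarith))
  refine ⟨δ, hδ0, ?_⟩
  filter_upwards [d1, d2, eventually_ge_atTop 1] with n h1 h2 h3
  have hn : (n : ℝ) ≠ 0 := by positivity
  unfold rate
  have e1 : (1 - δ / n) * (n * w n * (√((n : ℝ)⁻¹ * (h n)⁻¹) * logFactor n)) =
      n * w n * (√((n : ℝ)⁻¹ * (h n)⁻¹) * logFactor n) -
        δ * (w n * (√((n : ℝ)⁻¹ * (h n)⁻¹) * logFactor n)) := by field_simp
  have e2 : (1 - δ / n) * (n * w n * h n ^ 2) = n * w n * h n ^ 2 - δ * (w n * h n ^ 2) := by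
    field_simp
  rw [e1] at h1
  rw [e2] at h2
  linarith

/-- Since `γ/h = (nγ)/(nh)` and eventually `nγ ≥ 1`, one has `√(nγ) ≤ nγ`. This is what keeps the
terms with factor `w_n/γ_n` from summation by parts within `n w_n rate_n`. -/
theorem err_rate_le (hD : Design γ h α a) : ∀ᶠ n : ℕ in atTop,
    √(γ n * (h n)⁻¹) * logFactor n + h n ^ 2 ≤ n * γ n * rate h n := by
  filter_upwards [hD.diverges.eventually_ge_atTop 1, eventually_ge_atTop 1] with n h1 h2
  have hn : (0 : ℝ) < n := by positivity
  have hh := inv_pos.2 (hD.band.1 n h2)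
  have hl := one_le_logFactor n
  have h3 : √(γ n * (h n)⁻¹) ≤ n * γ n * √((n : ℝ)⁻¹ * (h n)⁻¹) := by
    have e : γ n * (h n)⁻¹ = (n * γ n) * ((n : ℝ)⁻¹ * (h n)⁻¹) := by field_simp
    rw [e, Real.sqrt_mul (by linarith)]
    apply mul_le_mul_of_nonneg_right _ (Real.sqrt_nonneg _)
    rw [Real.sqrt_le_left (by linarith)]
    nlinarith
  unfold rate
  have h4 := mul_le_mul_of_nonneg_right h3 (zero_le_one.trans hl)
  nlinarith [sq_nonneg (h n)]

variable {ν : Measure (ℝ × ℝ)} [IsProbabilityMeasure ν] {K : ℝ → ℝ}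
  {f r : ℝ → ℝ} {A C f₀ c d M L : ℝ} {zs : ℕ → ℝ × ℝ} {v : ℝ}

/-- Weighted sum of the errors. -/
noncomputable def weightedErr (K : ℝ → ℝ) (γ h w : ℕ → ℝ) (v : ℝ) (r : ℝ → ℝ)
    (zs : ℕ → ℝ × ℝ) (x : ℝ) (n : ℕ) : ℝ :=
  ∑ k ∈ Finset.Icc 1 n, w k * err K γ h v r zs x k

theorem averaged_sub_eq (hw : ∀ n, 1 ≤ n → 0 < w n) {n : ℕ} (hn : 1 ≤ n) (x : ℝ) :
    averaged K γ h w (fun _ => v) (fun k => (zs k).1) (fun k => (zs k).2) n x - r x =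
      (∑ k ∈ Finset.Icc 1 n, w k)⁻¹ * weightedErr K γ h w v r zs x n := by
  have hS : 0 < ∑ k ∈ Finset.Icc 1 n, w k :=
    Finset.sum_pos (fun k hk => hw k (Finset.mem_Icc.1 hk).1) ⟨1, Finset.mem_Icc.2 ⟨le_rfl, hn⟩⟩
  have : weightedErr K γ h w v r zs x n = (∑ k ∈ Finset.Icc 1 n, w k *
      estimator K γ h (fun _ => v) (fun k => (zs k).1) (fun k => (zs k).2) k x) -
      (∑ k ∈ Finset.Icc 1 n, w k) * r x := by
    unfold weightedErr err
    rw [Finset.sum_mul, ← Finset.sum_sub_distrib]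
    exact Finset.sum_congr rfl fun k _ => by ring
  rw [this]
  unfold averaged
  field_simp

-- With `S = ∑ w_k e_k` and `U` the martingale part, `D = f S - U + cf e` has increments `w β + (Δ
-- cf) e`, free of noise. As `Δ cf = O(w_n/(n γ_n))`, they are `O(w_n rate_n)`, so `D = O(n w_n
-- rate_n)`. The terms `U` and `cf e` have the same order, and `f ≥ f₀` gives the bound on `S`.
set_option maxHeartbeats 1000000 in
theorem averaged_bound_of_grid (hmb : MomentBounds ν K h (Ioo c d) f r A C f₀) (hA : 0 ≤ A)
    (hcd : c < d) (hK : A1 K) (hM : ∀ z, K z ≤ M) (hL : ∀ y z, |K y - K z| ≤ L * |y - z|)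
    (hD : Design γ h α a) (hw : GS w (-q)) (hq : q < min (1 - 2 * a) ((1 + a) / 2))
    {N : ℕ} {κ C₃ : ℝ} (hκ : 0 ≤ κ)
    (hY : ∀ᶠ k in atTop, |(zs k).2| ≤ A * logFactor k)
    (he : ∀ᶠ n in atTop, ∀ x ∈ Ioo c d, |err K γ h v r zs x n| ≤
      C₃ * (√(γ n * (h n)⁻¹) * logFactor n + h n ^ 2))
    (hgrid : ∀ᶠ n in atTop, ∀ i < n ^ 2,
      |driven N (fun _ => 1) w
        (innovation ν K h r A (fun _ => 1) (gridPoint c d n i) zs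
          (err K γ h v r zs (gridPoint c d n i))) n| ≤
        4 * logFactor n * (κ * (n * w n * √((n : ℝ)⁻¹ * (h n)⁻¹)))) :
    ∃ C', ∀ᶠ n in atTop, ∀ x ∈ Ioo c d,
      |averaged K γ h w (fun _ => v) (fun k => (zs k).1) (fun k => (zs k).2) n x - r x| ≤
        C' * rate h n := by
  have hC0 := hmb.nonneg hcd
  have hf₀ := hmb.pos
  have hγp := hD.step.1
  have hhp := hD.band.1
  set E : ℕ → ℝ := fun n => √(γ n * (h n)⁻¹) * logFactor n + h n ^ 2 with hE
  have hE0 : ∀ n, 0 ≤ E n := fun n => by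
    have := one_le_logFactor n
    simp only [hE]; positivity
  have hm0 : ∀ n, 0 ≤ rate h n := fun n => by
    have := one_le_logFactor n
    unfold rate; positivity
  have g1 := (hD.step.evGS.mul hD.band.evGS.inv).sqrt.mul evGS_logFactor
  have g2 := hD.band.evGS.pow 2
  have hEpred : ∀ᶠ n in atTop, E (n - 1) ≤ 2 * E n := by
    filter_upwards [g1.pred_le, g2.pred_le] with n h1 h2
    simp only [hE]; linarith
  have hEto : Tendsto (fun n => C₃ * E n) atTop (𝓝 (C₃ * (0 + 0))) :=
    ((g1.tendsto_zero (by linarith [hD.a_pos, hD.two_mul_lt])).add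
      (g2.tendsto_zero (by push_cast; linarith [hD.a_pos]))).const_mul C₃
  rw [add_zero, mul_zero] at hEto
  -- The known rate tends to zero, so clipping at the constant level 1 is eventually inactive.
  have he1 : ∀ᶠ n in atTop, ∀ x ∈ Ioo c d, |err K γ h v r zs x n| ≤ (fun _ => (1 : ℝ)) (n + 1) := by
    filter_upwards [he, hEto.eventually_lt_const one_pos] with n h1 h2 x hx
    exact (h1 x hx).trans h2.le
  obtain ⟨δ, hδ, hdrift⟩ := rate_drift hD hw hq
  have hΔ1 := (hw.evGS.mul hD.step.evGS.inv).abs_sub_le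
  have hΔ2 := hw.evGS.abs_sub_le
  set k1 := |(-q + - -α)| + 1 with hk1
  set k2 := |(-q)| + 1 with hk2
  have hstep := err_step (B := fun _ => 1) hmb hY he1
  obtain ⟨N₀, hN₀⟩ := eventually_atTop.1 ((((((((hEpred.and hdrift).and hΔ1).and hΔ2).and
    (hD.tendsto_step.eventually_lt_const one_pos)).and (err_rate_le hD)).and hstep).and he1).and he)
  set N₁ := max N₀ (max N 1) with hN₁
  set U : ℝ → ℕ → ℝ := fun x => driven N (fun _ => 1) w
    (innovation ν K h r A (fun _ => 1) x zs (err K γ h v r zs x)) with hU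
  -- Summation by parts produces `w/γ`; the correction `-f w` appears because `S` sums `w_k e_k`,
  -- whereas the recursion expresses `e_{k-1}`.
  set cf : ℝ → ℕ → ℝ := fun x n => w n * (γ n)⁻¹ - f x * w n with hcf
  set S : ℝ → ℕ → ℝ := weightedErr K γ h w v r zs with hS
  set D : ℝ → ℕ → ℝ := fun x n => f x * S x n - U x n + cf x n * err K γ h v r zs x n with hDd
  have hfabs : ∀ x ∈ Ioo c d, |f x| ≤ C := fun x hx => by
    rw [abs_of_pos (hf₀.trans_le (hmb.le_density x hx))]; exact hmb.density_le x hx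
  obtain ⟨b, hb⟩ : ∃ b, ∀ x ∈ Ioo c d, |D x N₁| ≤ b := by
    obtain ⟨b₁, hb₁⟩ : ∃ b, ∀ x ∈ Ioo c d, |U x N₁| ≤ b :=
      exists_bound_driven (fun n hn => ⟨1, fun x hx => by rw [abs_one]⟩)
        (fun n hn => exists_bound_innovation hmb hA hcd hK hM hhp (fun _ => le_rfl) (by omega)
          zs _) (by omega)
    choose b₂ hb₂ using fun n => exists_bound_estimator (K := K) (γ := γ) (h := h)
      (xs := fun k => (zs k).1) (ys := fun k => (zs k).2)
      ⟨M, fun z => by rw [abs_of_nonneg (hK.nonneg z)]; exact hM z⟩ v n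
    have hb₃ : ∀ n, ∀ x ∈ Ioo c d, |err K γ h v r zs x n| ≤ b₂ n + C := fun n x hx =>
      (abs_sub _ _).trans (add_le_add (hb₂ n x) (hmb.abs_regression_le x hx))
    refine ⟨C * (∑ k ∈ Finset.Icc 1 N₁, |w k| * (b₂ k + C)) + b₁ +
      (|w N₁ * (γ N₁)⁻¹| + C * |w N₁|) * (b₂ N₁ + C), fun x hx => ?_⟩
    have t1 : |S x N₁| ≤ ∑ k ∈ Finset.Icc 1 N₁, |w k| * (b₂ k + C) := by
      refine (Finset.abs_sum_le_sum_abs _ _).trans (Finset.sum_le_sum fun k _ => ?_)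
      rw [abs_mul]
      exact mul_le_mul_of_nonneg_left (hb₃ k x hx) (abs_nonneg _)
    have t2 : |cf x N₁| ≤ |w N₁ * (γ N₁)⁻¹| + C * |w N₁| := by
      refine (abs_sub _ _).trans ?_
      rw [abs_mul (f x)]
      gcongr
      exact hfabs x hx
    simp only [hDd]
    refine (abs_add_le _ _).trans (add_le_add ((abs_sub _ _).trans (add_le_add ?_ (hb₁ x hx))) ?_)
    · rw [abs_mul]
      exact mul_le_mul (hfabs x hx) t1 (abs_nonneg _) hC0
    · rw [abs_mul]
      exact mul_le_mul t2 (hb₃ N₁ x hx) (abs_nonneg _) ((abs_nonneg _).trans t2)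
  set V : ℕ → ℝ := fun n => n * w n * rate h n with hV
  have hV1 : 0 < V N₁ := by
    have h1 := hw.1 N₁ (by omega)
    have h2 := hhp N₁ (by omega)
    have h3 := one_le_logFactor N₁
    have h4 : (0 : ℝ) < N₁ := by
      have : 0 < N₁ := by omega
      exact_mod_cast this
    simp only [hV, rate]; positivity
  -- The term `2C` bounds the bias, as `1 + |e| ≤ 2`. The other term is the variation of `cf` times
  -- the previous error, the factor 2 paying for the index shift in `E`.
  set c4 := 2 * C + (k1 + C * k2) * (|C₃| * 2) with hc4
  have hk1p : 0 < k1 := by positivity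
  have hk2p : 0 < k2 := by positivity
  have hc40 : 0 ≤ c4 := by positivity
  set κ₁ := δ / (c4 + 1) with hκ₁
  have hκ₁0 : 0 < κ₁ := by positivity
  set C₁ := max (b / V N₁) κ₁⁻¹ with hC₁
  have hrem : ∀ n, N₁ ≤ n → ∀ x ∈ Ioo c d, |D x n| ≤ C₁ * V n := by
    intro n hn x hx
    refine le_mul_of_recursion (u := fun n => |D x n|) (V := V)
      (ρ := fun n => 1) (d := fun n => c4 * (w n * rate h n)) (N := N₁) (κ := κ₁)
      (C := C₁) hκ₁0 (fun _ _ => zero_le_one) ?_ ?_ ?_ ?_ (le_max_right _ _) n hn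
    · intro n hn
      have := hw.1 n (by omega)
      have := hm0 n
      positivity
    · intro n hn
      have h1 := (hN₀ n (by omega)).1.1.1.1.1.1.1.2
      have hwn := hw.1 n (by omega)
      have hmn := hm0 n
      have h2 : κ₁ * (c4 * (w n * rate h n)) ≤ δ * (w n * rate h n) := by
        rw [← mul_assoc]
        apply mul_le_mul_of_nonneg_right _ (by positivity)
        rw [hκ₁, div_mul_eq_mul_div, div_le_iff₀ (by positivity)]
        nlinarith
      simp only [hV]
      linarith
    · intro n hn
      obtain ⟨m, rfl⟩ : ∃ m, n = m + 1 := ⟨n - 1, by omega⟩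
      simp only [Nat.add_sub_cancel]
      obtain ⟨⟨⟨⟨⟨⟨⟨⟨p1, -⟩, p2⟩, p3⟩, p4⟩, p5⟩, -⟩, -⟩, -⟩ := hN₀ (m + 1) (by omega)
      obtain ⟨⟨⟨-, p6⟩, p7⟩, p8⟩ := hN₀ m (by omega)
      simp only [Nat.add_sub_cancel] at p1 p2 p3
      obtain ⟨β, hβ, heq⟩ := p6 x hx
      have q7 := p7 x hx
      have q8 := p8 x hx
      simp only at q7
      have hg := hγp (m + 1) (by omega)
      have hg' := inv_pos.2 hg
      have hwn := hw.1 (m + 1) (by omega)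
      have hmn := hm0 (m + 1)
      have hUs : U x (m + 1) = 1 * U x m + w (m + 1) *
          innovation ν K h r A (fun _ => 1) x zs (err K γ h v r zs x) (m + 1) :=
        driven_succ (by omega) _ _ _
      have hSs : S x (m + 1) = S x m + w (m + 1) * err K γ h v r zs x (m + 1) :=
        Finset.sum_Icc_succ_top (by omega) _
      have hDs : D x (m + 1) = D x m +
          (w (m + 1) * β + (cf x (m + 1) - cf x m) * err K γ h v r zs x m) := by
        have h9 : w (m + 1) * (γ (m + 1))⁻¹ * err K γ h v r zs x (m + 1) =
            (w (m + 1) * (γ (m + 1))⁻¹ - f x * w (m + 1)) * err K γ h v r zs x m +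
            w (m + 1) * (innovation ν K h r A (fun _ => 1) x zs (err K γ h v r zs x) (m + 1) +
              β) := by
          rw [heq]; field_simp
        simp only [hDd, hcf]
        rw [hSs, hUs]
        linear_combination h9
      rw [hDs, one_mul]
      refine (abs_add_le _ _).trans (add_le_add le_rfl ((abs_add_le _ _).trans ?_))
      have t1 : |w (m + 1) * β| ≤ 2 * C * (w (m + 1) * rate h (m + 1)) := by
        rw [abs_mul, abs_of_pos hwn]
        have : C * h (m + 1) ^ 2 * (1 + |err K γ h v r zs x m|) ≤ C * rate h (m + 1) * (1 + 1) := by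
          gcongr
          unfold rate
          have := one_le_logFactor (m + 1)
          have : 0 ≤ √(((m + 1 : ℕ) : ℝ)⁻¹ * (h (m + 1))⁻¹) * logFactor (m + 1) := by positivity
          linarith
        calc w (m + 1) * |β| ≤ w (m + 1) * (C * rate h (m + 1) * (1 + 1)) := by
              gcongr; exact hβ.trans this
          _ = _ := by ring
      have hM1 : (0 : ℝ) < ((m + 1 : ℕ) : ℝ) := by positivity
      have t2 : |cf x (m + 1) - cf x m| ≤
          (k1 + C * k2) * (w (m + 1) * (γ (m + 1))⁻¹ / ((m + 1 : ℕ) : ℝ)) := by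
        have e : cf x (m + 1) - cf x m = (w (m + 1) * (γ (m + 1))⁻¹ - w m * (γ m)⁻¹) -
            f x * (w (m + 1) - w m) := by simp only [hcf]; ring
        rw [e]
        refine (abs_sub _ _).trans ?_
        rw [add_mul, abs_mul]
        refine add_le_add p2 ?_
        rw [mul_assoc]
        refine mul_le_mul (hfabs x hx) (p3.trans ?_) (abs_nonneg _) hC0
        gcongr
        exact le_mul_of_one_le_right hwn.le ((one_le_inv₀ hg).2 p4.le)
      have t3 : |err K γ h v r zs x m| ≤ |C₃| * 2 * E (m + 1) := by
        calc _ ≤ C₃ * E m := q8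
          _ ≤ |C₃| * E m := by gcongr; exacts [hE0 m, le_abs_self _]
          _ ≤ |C₃| * (2 * E (m + 1)) := by gcongr
          _ = _ := by ring
      have t4 : w (m + 1) * (γ (m + 1))⁻¹ / ((m + 1 : ℕ) : ℝ) * E (m + 1) ≤
          w (m + 1) * rate h (m + 1) := by
        calc _ ≤ w (m + 1) * (γ (m + 1))⁻¹ / ((m + 1 : ℕ) : ℝ) *
              (((m + 1 : ℕ) : ℝ) * γ (m + 1) * rate h (m + 1)) := by gcongr
          _ = _ := by field_simp
      have t5 : |(cf x (m + 1) - cf x m) * err K γ h v r zs x m| ≤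
          (k1 + C * k2) * (|C₃| * 2) * (w (m + 1) * rate h (m + 1)) := by
        rw [abs_mul]
        calc _ ≤ (k1 + C * k2) * (w (m + 1) * (γ (m + 1))⁻¹ / ((m + 1 : ℕ) : ℝ)) *
              (|C₃| * 2 * E (m + 1)) := mul_le_mul t2 t3 (abs_nonneg _) (by positivity)
          _ = (k1 + C * k2) * (|C₃| * 2) *
              (w (m + 1) * (γ (m + 1))⁻¹ / ((m + 1 : ℕ) : ℝ) * E (m + 1)) := by ring
          _ ≤ _ := by gcongr
      rw [hc4]
      linarith
    · calc |D x N₁| ≤ b / V N₁ * V N₁ := by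
            rw [div_mul_cancel₀ _ hV1.ne']; exact hb x hx
        _ ≤ _ := mul_le_mul_of_nonneg_right (le_max_left _ _) hV1.le
  have hC₁0 : 0 ≤ C₁ := (inv_pos.2 hκ₁0).le.trans (le_max_right _ _)
  obtain ⟨C₇, hC₇0, hC₇⟩ := hw.natCast_mul_le_sum
  set C₆ := C₁ + 4 * κ + (1 + C) * |C₃| with hC₆
  have hC₆0 : 0 ≤ C₆ := by positivity
  have hR : ∀ᶠ n in atTop, ∀ i < n ^ 2,
      |averaged K γ h w (fun _ => v) (fun k => (zs k).1) (fun k => (zs k).2) n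
        (gridPoint c d n i) - r (gridPoint c d n i)| ≤ C₆ * C₇ / f₀ * rate h n := by
    filter_upwards [hgrid, hC₇, eventually_ge_atTop N₁, eventually_ge_atTop 1]
      with n p1 p2 p3 p3' i hi
    have hx := gridPoint_mem hcd n i hi
    set x := gridPoint c d n i with hxd
    obtain ⟨⟨⟨⟨-, p4⟩, p5⟩, p7⟩, p8⟩ := hN₀ n (by omega)
    have hg := hγp n (by omega)
    have hg' := inv_pos.2 hg
    have hwn := hw.1 n (by omega)
    have hmn := hm0 n
    have hl := one_le_logFactor n
    have hn0 : (0 : ℝ) < n := by positivity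
    have hfl := hmb.le_density x hx
    have hQ : 0 < ∑ k ∈ Finset.Icc 1 n, w k := Finset.sum_pos
      (fun k hk => hw.1 k (Finset.mem_Icc.1 hk).1) ⟨1, Finset.mem_Icc.2 ⟨le_rfl, p3'⟩⟩
    have s1 := hrem n p3 x hx
    have s2 : |U x n| ≤ 4 * κ * V n := by
      refine (p1 i hi).trans ?_
      calc 4 * logFactor n * (κ * (n * w n * √((n : ℝ)⁻¹ * (h n)⁻¹))) =
            4 * κ * (n * w n * (√((n : ℝ)⁻¹ * (h n)⁻¹) * logFactor n + 0)) := by ring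
        _ ≤ _ := by
          simp only [hV, rate]
          gcongr
          exact sq_nonneg _
    have s3 : |cf x n * err K γ h v r zs x n| ≤ (1 + C) * |C₃| * V n := by
      have u1 : |cf x n| ≤ (1 + C) * (w n * (γ n)⁻¹) := by
        refine (abs_sub _ _).trans ?_
        rw [abs_of_pos (mul_pos hwn hg'), abs_mul, abs_of_pos hwn, add_mul, one_mul]
        have := le_mul_of_one_le_right hwn.le
          ((one_le_inv₀ hg).2 (hN₀ n (by omega)).1.1.1.1.2.le)
        have := mul_le_mul (hfabs x hx) this hwn.le hC0
        linarith
      have u2 : |err K γ h v r zs x n| ≤ |C₃| * E n :=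
        (p8 x hx).trans (mul_le_mul_of_nonneg_right (le_abs_self _) (hE0 n))
      rw [abs_mul]
      calc _ ≤ (1 + C) * (w n * (γ n)⁻¹) * (|C₃| * (n * γ n * rate h n)) :=
            mul_le_mul u1 (u2.trans (mul_le_mul_of_nonneg_left (hN₀ n (by omega)).1.1.1.2
              (abs_nonneg _))) (abs_nonneg _) (by positivity)
        _ = _ := by simp only [hV]; field_simp
    have s4 : f₀ * |S x n| ≤ C₆ * V n := by
      have e : f x * S x n = D x n + U x n - cf x n * err K γ h v r zs x n := by
        simp only [hDd]; ring
      calc f₀ * |S x n| ≤ f x * |S x n| := by gcongr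
        _ = |f x * S x n| := by rw [abs_mul, abs_of_pos (hf₀.trans_le hfl)]
        _ ≤ |D x n| + |U x n| + |cf x n * err K γ h v r zs x n| := by
          rw [e]
          exact (abs_sub _ _).trans (add_le_add (abs_add_le _ _) le_rfl)
        _ ≤ _ := by rw [hC₆]; linarith
    rw [averaged_sub_eq hw.1 p3', abs_mul, abs_of_pos (inv_pos.2 hQ), inv_mul_le_iff₀ hQ]
    have s5 : |S x n| ≤ C₆ * V n / f₀ := by rw [le_div_iff₀ hf₀]; linarith
    refine s5.trans ?_
    calc C₆ * V n / f₀ = C₆ / f₀ * rate h n * (n * w n) := by simp only [hV]; ring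
      _ ≤ C₆ / f₀ * rate h n * (C₇ * ∑ k ∈ Finset.Icc 1 n, w k) := by gcongr
      _ = _ := by ring
  obtain ⟨D₁, hD₁⟩ := hD.step_mul_sq_inv_band_le
  obtain ⟨D₂, hD₂0, hD₂⟩ := hD.inv_natCast_le
  obtain ⟨C₂, hC₂0, hC₂⟩ := estimator_lipschitz hK hM hγp hhp (xs := fun k => (zs k).1)
    (ys := fun k => (zs k).2) hL v (hD.step_mul_inv_band_le M) hD₁ hY
  have hlip : ∀ᶠ n : ℕ in atTop, ∀ x ∈ Ioo c d, ∀ y ∈ Ioo c d,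
      |(averaged K γ h w (fun _ => v) (fun k => (zs k).1) (fun k => (zs k).2) n x - r x) -
        (averaged K γ h w (fun _ => v) (fun k => (zs k).1) (fun k => (zs k).2) n y - r y)| ≤
        (C₂ + C) * (n + 1) * |x - y| := by
    filter_upwards [eventually_ge_atTop 1] with n hn x hx y hy
    have h1 := averaged_lipschitz hw.1 hC₂0 hC₂ hn x y
    have h2 := hmb.regression_lipschitz x hx y hy
    rw [sub_sub_sub_comm]
    refine (abs_sub _ _).trans ((add_le_add h1 h2).trans ?_)
    have : C * |x - y| ≤ C * (n + 1) * |x - y| := by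
      gcongr
      have : (0 : ℝ) ≤ n := Nat.cast_nonneg n
      nlinarith
    linarith
  have hsup := sup_le_of_grid (e := fun n x => averaged K γ h w (fun _ => v) (fun k => (zs k).1)
    (fun k => (zs k).2) n x - r x) (by positivity) hlip hR
  set F := 2 * (C₂ + C) * (d - c) with hF
  have hF0 : 0 ≤ F := mul_nonneg (by positivity) (by linarith)
  refine ⟨C₆ * C₇ / f₀ + F * D₂, ?_⟩
  filter_upwards [hsup, hD₂] with n h1 h2 x hx
  refine (h1 x hx).trans ?_
  have hl := one_le_logFactor n
  have t3 : F * (n : ℝ)⁻¹ ≤ F * D₂ * rate h n := by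
    calc F * (n : ℝ)⁻¹ ≤ F * (D₂ * h n ^ 2) := by gcongr
      _ = F * D₂ * (0 + h n ^ 2) := by ring
      _ ≤ _ := by unfold rate; gcongr; positivity
  linarith

end Averaged

section AlmostSure

variable {Ω : Type*} [MeasurableSpace Ω] {μ : Measure Ω} [IsProbabilityMeasure μ]
  {X Y : ℕ → Ω → ℝ} {ν : Measure (ℝ × ℝ)} [IsProbabilityMeasure ν]
  {K : ℝ → ℝ} {γ h w : ℕ → ℝ} {f r : ℝ → ℝ} {A C f₀ c d M L α a q : ℝ}

/-- Almost sure uniform rate of the averaged estimator started from a constant. -/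
theorem averaged_rate (hX : ∀ n, Measurable (X n)) (hY : ∀ n, Measurable (Y n))
    (hind : iIndepFun (fun n ω => (X n ω, Y n ω)) μ)
    (hlaw : ∀ n, μ.map (fun ω => (X n ω, Y n ω)) = ν)
    (hmb : MomentBounds ν K h (Ioo c d) f r A C f₀) (hA : 0 ≤ A) (hcd : c < d)
    (hK : A1 K) (hM : ∀ z, K z ≤ M) (hL : ∀ y z, |K y - K z| ≤ L * |y - z|)
    (hD : Design γ h α a) (hw : GS w (-q)) (hq : q < min (1 - 2 * a) ((1 + a) / 2)) (v : ℝ)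
    (hYb : ∀ᵐ ω ∂μ, ∀ᶠ k in atTop, |Y k ω| ≤ A * logFactor k) :
    ∀ᵐ ω ∂μ, ∃ C', ∀ᶠ n in atTop, ∀ x ∈ Ioo c d,
      |averaged K γ h w (fun _ => v) (fun k => X k ω) (fun k => Y k ω) n x - r x| ≤
        C' * rate h n := by
  have hC0 := hmb.nonneg hcd
  have hM0 : 0 ≤ M := (hK.nonneg 0).trans (hM 0)
  have hq2 := hq.trans_le (min_le_right _ _)
  set V : ℕ → ℝ := fun n => (n * w n) ^ 2 * ((n : ℝ)⁻¹ * (h n)⁻¹) with hV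
  have hVgs := ((EvGS.natCast.mul hw.evGS).pow 2).mul (EvGS.natCast.inv.mul hD.band.evGS.inv)
  push_cast at hVgs
  -- The exponent of `V`, positive because `q < (1 + a)/2`. Without contraction (`ρ = 1`), the
  -- growth of `V` alone has to absorb the variance `4 C w²/h`; half of this exponent is used.
  set e := 1 - 2 * q + a with he
  have he0 : 0 < e := by linarith
  have hdr := hVgs.le_of_drift (δ := e / 2) (by linarith)
  set κ₀ := 8 * C / e + (8 * (A + C + 1) * M) ^ 2 + 1 with hκ₀
  have hκ₀0 : 0 < κ₀ := by positivity
  set T : ℕ → ℝ := fun n => √κ₀ * (n * w n * √((n : ℝ)⁻¹ * (h n)⁻¹)) with hT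
  have hTsq : ∀ᶠ n in atTop, T n ^ 2 = κ₀ * V n := by
    filter_upwards [eventually_ge_atTop 1] with n hn
    have h1 : 0 ≤ (n : ℝ)⁻¹ * (h n)⁻¹ :=
      mul_nonneg (by positivity) (inv_pos.2 (hD.band.1 n hn)).le
    simp only [hT, hV]
    rw [mul_pow, mul_pow _ (√_), Real.sq_sqrt hκ₀0.le, Real.sq_sqrt h1]
  have hTpos : ∀ᶠ n in atTop, 0 < T n := by
    filter_upwards [eventually_ge_atTop 1] with n hn
    have h1 := inv_pos.2 (hD.band.1 n hn)
    have h2 := hw.1 n hn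
    have h3 : (0 : ℝ) < n := by positivity
    simp only [hT]; positivity
  have hsmall := ((EvGS.natCast.inv.mul hD.band.evGS.inv).mul
    (evGS_logFactor.pow 2)).tendsto_zero (by
      push_cast; linarith [hD.a_pos, hD.two_mul_lt, hD.le_one])
  have hTb : ∀ᶠ n in atTop,
      4 * (A + C + 1) * M * (|w n| * ((h n)⁻¹ * (logFactor n + 1))) ≤ T n := by
    filter_upwards [hTsq, hTpos, eventually_ge_atTop 1, hsmall.eventually_lt_const one_pos]
      with n h1 h2 h3 h4
    have hwn := hw.1 n h3
    have hh := inv_pos.2 (hD.band.1 n h3)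
    have hl := one_le_logFactor n
    have hn : (0 : ℝ) < n := by positivity
    apply le_of_sq_le_sq _ h2.le
    rw [h1, abs_of_pos hwn]
    calc (4 * (A + C + 1) * M * (w n * ((h n)⁻¹ * (logFactor n + 1)))) ^ 2
        ≤ (4 * (A + C + 1) * M * (w n * ((h n)⁻¹ * (2 * logFactor n)))) ^ 2 := by
          gcongr; linarith
      -- The largest increment squared is `V` times a constant times `log² n / (n h_n)`, which tends
      -- to zero since `a < 1`.
      _ = (8 * (A + C + 1) * M) ^ 2 * ((n : ℝ)⁻¹ * (h n)⁻¹ * logFactor n ^ 2) * V n := by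
          simp only [hV]; field_simp; ring
      _ ≤ κ₀ * 1 * V n := by
          have hVn : 0 ≤ V n := by simp only [hV]; positivity
          gcongr
          rw [hκ₀]
          have : 0 ≤ 8 * C / e := by positivity
          linarith
      _ = κ₀ * V n := by rw [mul_one]
  have hTr : ∀ᶠ n in atTop, ∀ x ∈ Ioo c d, (1 : ℝ) ^ 2 * T (n - 1) ^ 2 +
      4 * (w n ^ 2 * (C * (h n)⁻¹ * (1 : ℝ) ^ 2)) ≤ T n ^ 2 := by
    filter_upwards [hTsq, (tendsto_sub_atTop_nat 1).eventually hTsq, hdr,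
      eventually_ge_atTop 1] with n h1 h2 h3 h4 x _
    have hh := inv_pos.2 (hD.band.1 n h4)
    have hn : (0 : ℝ) < n := by positivity
    have hVn : e / 2 / n * V n = e / 2 * (w n ^ 2 * (h n)⁻¹) := by
      simp only [hV]; field_simp
    have h5 : 4 * C ≤ κ₀ * (e / 2) := by
      have e1 : 8 * C / e ≤ κ₀ := by rw [hκ₀]; linarith [sq_nonneg (8 * (A + C + 1) * M)]
      rw [div_le_iff₀ he0] at e1
      linarith
    have h6 : V (n - 1) ≤ (1 - e / 2 / n) * V n := h3
    have h7 := mul_le_mul_of_nonneg_left h6 hκ₀0.le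
    have h8 := mul_le_mul_of_nonneg_right h5 (show 0 ≤ w n ^ 2 * (h n)⁻¹ by positivity)
    rw [h1, h2]
    have h9 : κ₀ * ((1 - e / 2 / n) * V n) = κ₀ * V n - κ₀ * (e / 2) * (w n ^ 2 * (h n)⁻¹) := by
      rw [sub_mul, hVn]; ring
    linarith
  obtain ⟨N, hN⟩ := driven_le_on_grid (γ := γ) (B := fun _ => 1) hX hY hind hlaw hmb hA hcd hK hM
    hD.band.1 (fun _ => le_rfl) v (ρ := fun _ _ => 1) (w := w) (T := T) hTpos hTb hTr
  filter_upwards [hN, hYb, err_rate hX hY hind hlaw hmb hA hcd hK hM hL hD v hYb]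
    with ω h1 h2 ⟨C₃, h3⟩
  exact averaged_bound_of_grid (zs := fun k => (X k ω, Y k ω)) hmb hA hcd hK hM hL hD hw hq
    (Real.sqrt_nonneg κ₀) h2 h3 h1

end AlmostSure

end Revesz

/-! ### General bounded initial values and comparison of the two terms of the rate. -/

namespace Revesz

theorem supIsBigO_of_le {c d : ℝ} (hcd : c < d) {u : ℕ → ℝ → ℝ} {v m : ℕ → ℝ} {C C' : ℝ}
    (hu : ∀ᶠ n in atTop, ∀ x ∈ Ioo c d, |u n x| ≤ C * m n)
    (hm : ∀ᶠ n in atTop, 0 ≤ m n ∧ m n ≤ C' * v n) : SupIsBigO (Ioo c d) u v := by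
  have hne : (Ioo c d).Nonempty := nonempty_Ioo.2 hcd
  constructor
  · filter_upwards [hu] with n hn
    refine ⟨C * m n, ?_⟩
    rintro _ ⟨x, hx, rfl⟩
    exact hn x hx
  · refine IsBigO.of_bound (|C| * |C'|) ?_
    filter_upwards [hu, hm] with n h1 h2
    have h3 : sSup ((fun x => |u n x|) '' Ioo c d) ≤ C * m n := by
      apply csSup_le (hne.image _)
      rintro _ ⟨x, hx, rfl⟩
      exact h1 x hx
    have h4 : 0 ≤ sSup ((fun x => |u n x|) '' Ioo c d) := by
      apply Real.sSup_nonneg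
      rintro _ ⟨x, hx, rfl⟩
      exact abs_nonneg _
    rw [Real.norm_eq_abs, Real.norm_eq_abs, abs_of_nonneg h4]
    calc _ ≤ C * m n := h3
      _ ≤ |C| * m n := mul_le_mul_of_nonneg_right (le_abs_self C) h2.1
      _ ≤ |C| * (|C'| * |v n|) := by
        gcongr
        refine h2.2.trans ((le_abs_self _).trans (le_of_eq (abs_mul _ _)))
      _ = _ := by ring

theorem abs_le_of_affine {l p q B : ℝ} (hl0 : 0 ≤ l) (hl1 : l ≤ 1) (hp : |p| ≤ B) (hq : |q| ≤ B) :
    |l * p + (1 - l) * q| ≤ B := by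
  refine (abs_add_le _ _).trans ?_
  rw [abs_mul, abs_mul, abs_of_nonneg hl0, abs_of_nonneg (sub_nonneg.2 hl1)]
  have := mul_le_mul_of_nonneg_left hp hl0
  have := mul_le_mul_of_nonneg_left hq (sub_nonneg.2 hl1)
  linarith

/-- Eventual positivity of the quotient forces `log ∑ γ_k > 0` at some `N`. The partial sums
increase, so this logarithm stays bounded below and `n γ_n` is at least a positive multiple of the
quotient. -/
theorem A5.tendsto {γ : ℕ → ℝ} {α a : ℝ} (hA5 : A5 γ α a) (hγ : ∀ n, 1 ≤ n → 0 < γ n) :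
    Tendsto (fun n : ℕ => (n : ℝ) * γ n) atTop atTop := by
  have h1 := hA5.stepsize
  set S : ℕ → ℝ := fun n => ∑ k ∈ Finset.Icc 1 n, γ k with hS
  have hmono : ∀ m n, m ≤ n → S m ≤ S n := fun m n hmn =>
    Finset.sum_le_sum_of_subset_of_nonneg (Finset.Icc_subset_Icc_right hmn)
      fun k hk _ => (hγ k (Finset.mem_Icc.1 hk).1).le
  obtain ⟨N, hN⟩ := eventually_atTop.1 ((h1.eventually_gt_atTop 0).and (eventually_ge_atTop 1))
  have hlog : 0 < Real.log (S N) := by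
    obtain ⟨h2, h3⟩ := hN N le_rfl
    have h4 : (0 : ℝ) < N * γ N := mul_pos (by exact_mod_cast h3) (hγ N h3)
    exact inv_pos.1 ((mul_pos_iff_of_pos_left h4).1 h2)
  have hSN : 0 < S N := Finset.sum_pos (fun k hk => hγ k (Finset.mem_Icc.1 hk).1)
    ⟨1, Finset.mem_Icc.2 ⟨le_rfl, (hN N le_rfl).2⟩⟩
  refine tendsto_atTop_mono' _ ?_ (h1.const_mul_atTop hlog)
  filter_upwards [eventually_ge_atTop N] with n hn
  have h5 : Real.log (S N) ≤ Real.log (S n) := Real.log_le_log hSN (hmono N n hn)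
  have h6 : 0 < Real.log (S n) := hlog.trans_le h5
  have h7 := (hN n hn).1
  calc Real.log (S N) * (n * γ n * (Real.log (S n))⁻¹) ≤
        Real.log (S n) * (n * γ n * (Real.log (S n))⁻¹) := mul_le_mul_of_nonneg_right h5 h7.le
    _ = n * γ n := by field_simp

/-- Almost sure uniform rate of the averaged estimator, for a bounded initial value. -/
theorem averaged_rate_of_bounded {Ω : Type*} [MeasurableSpace Ω] (μ : Measure Ω) [IsProbabilityMeasure μ]
    (X Y : ℕ → Ω → ℝ) (g : ℝ → ℝ → ℝ) (hXY : IIDWithDensity μ X Y g)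
    (K : ℝ → ℝ) (γ h w : ℕ → ℝ) (α a q : ℝ)
    (c d : ℝ) (hcd : c < d)
    (hf : 0 < ⨅ x : Set.Ioo c d, Revesz.marginal g x)
    (r₀ : ℝ → ℝ) (hr₀ : ∃ C, ∀ x ∈ Set.Ioo c d, |r₀ x| ≤ C)
    (hA1 : Revesz.A1 K) (hA2 : Revesz.A2 γ h α a)
    (hA3 : ∀ x ∈ Set.Ioo c d, Revesz.A3 g x)
    (hA4 : Revesz.A4 μ (Y 0) K g α a)
    (hA5 : Revesz.A5 γ α a) (hA6 : Revesz.A6 w q a) :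
    ∀ᵐ ω ∂μ, ∃ C, ∀ᶠ n in atTop, ∀ x ∈ Ioo c d,
      |averaged K γ h w r₀ (fun k => X k ω) (fun k => Y k ω) n x - regression g x| ≤
        C * rate h n := by
  have hα := hA2.alpha_mem
  have ha1 := hA4.a_mem
  have ha2 := hA2.a_mem
  have hD : Design γ h α a := ⟨hA2.stepsize, hA2.bandwidth, hA5.tendsto hA2.stepsize.1,
    by linarith [ha1.1, hα.2], by linarith [ha2.2, ha1.1, hα.2], hα.2⟩
  have hpm : ∀ n, Measurable (fun ω => (X n ω, Y n ω)) := fun n =>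
    (hXY.measurable_X n).prodMk (hXY.measurable_Y n)
  have hlaw : ∀ n, μ.map (fun ω => (X n ω, Y n ω)) = pairLaw g := hXY.law
  have hprob : IsProbabilityMeasure (pairLaw g) := by
    rw [← hlaw 0]; exact Measure.isProbabilityMeasure_map (hpm 0).aemeasurable
  obtain ⟨τ, hτ, hexp⟩ := hA4.exp_moment
  have hexp' : Integrable (fun z : ℝ × ℝ => Real.exp (τ * |z.2|)) (pairLaw g) := by
    rw [← hlaw 0]
    have hem : Measurable (fun z : ℝ × ℝ => Real.exp (τ * |z.2|)) := by fun_prop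
    exact (integrable_map_measure hem.aestronglyMeasurable (hpm 0).aemeasurable).2 hexp
  obtain ⟨C, f₀, hmb⟩ := momentBounds hA1 hA2.bandwidth (by linarith [ha2.2, hα.2])
    hXY.density_measurable hXY.density_nonneg hcd hf hA3 hτ hexp'
  obtain ⟨M, hM⟩ := hA1.bounded
  obtain ⟨L, hL⟩ := hA4.lipschitz
  have hL' : ∀ y z, |K y - K z| ≤ L * |y - z| := fun y z => by
    have := hL.dist_le_mul y z
    rwa [Real.dist_eq, Real.dist_eq] at this
  have hYb := ae_eventually_abs_le hXY.measurable_X hXY.measurable_Y hlaw hτ hexp'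
  have key := fun v => averaged_rate hXY.measurable_X hXY.measurable_Y hXY.indep hlaw hmb
    (by positivity) hcd hA1 hM hL' hD hA6.weights hA6.q_lt v hYb
  obtain ⟨C₀, hC₀⟩ := hr₀
  set R := |C₀| + 1 with hR
  have hR0 : 0 < R := by positivity
  -- Only two constant initial values are needed, so the exceptional set is a union of two null sets
  -- although the weight `l` depends on `x`.
  filter_upwards [key R, key (-R)] with ω ⟨C₁, h1⟩ ⟨C₂, h2⟩
  refine ⟨max C₁ C₂, ?_⟩
  filter_upwards [h1, h2] with n k1 k2 x hx
  have hm : 0 ≤ rate h n := by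
    have := one_le_logFactor n
    unfold rate; positivity
  have hrx := abs_le.1 ((hC₀ x hx).trans (le_abs_self C₀))
  set l := (r₀ x + R) / (2 * R) with hl
  have hl0 : 0 ≤ l := div_nonneg (by linarith) (by linarith)
  have hl1 : l ≤ 1 := by rw [hl, div_le_one (by linarith)]; linarith
  have haff : r₀ x = l * (fun _ : ℝ => R) x + (1 - l) * (fun _ : ℝ => -R) x := by
    simp only [hl]; field_simp; ring
  rw [averaged_affine (r₁ := fun _ => R) (r₂ := fun _ => -R) haff]
  have e : ∀ p s : ℝ, l * p + (1 - l) * s - regression g x =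
      l * (p - regression g x) + (1 - l) * (s - regression g x) := fun p s => by ring
  rw [e]
  exact abs_le_of_affine hl0 hl1
    ((k1 x hx).trans (mul_le_mul_of_nonneg_right (le_max_left _ _) hm))
    ((k2 x hx).trans (mul_le_mul_of_nonneg_right (le_max_right _ _) hm))

/-- Dividing `n h⁵ ≤ C log² n` by `n h` gives `h⁴ ≤ C log² n / (n h)`; the square root is the
required domination. The constant 2 comes from `1 + log n ≤ 2 log n`. -/
theorem rate_le_mul_log {h : ℕ → ℝ} (hh : ∀ n, 1 ≤ n → 0 < h n) {C : ℝ}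
    (hC : ∀ n : ℕ, 2 ≤ n → (n : ℝ) * h n ^ 5 / Real.log n ^ 2 ≤ C) : ∀ᶠ n : ℕ in atTop,
    0 ≤ rate h n ∧ rate h n ≤ (2 + √C) * (√((n : ℝ)⁻¹ * (h n)⁻¹) * Real.log n) := by
  have hlog : Tendsto (fun n : ℕ => Real.log n) atTop atTop :=
    Real.tendsto_log_atTop.comp tendsto_natCast_atTop_atTop
  filter_upwards [eventually_ge_atTop 2, hlog.eventually_ge_atTop 1] with n h1 h2
  have hn : (0 : ℝ) < n := by positivity
  have hp := hh n (by omega)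
  have hl := one_le_logFactor n
  have hC' := hC n h1
  have hC0 : 0 ≤ C := le_trans (by positivity) hC'
  refine ⟨by unfold rate; positivity, ?_⟩
  have h3 : h n ^ 2 ≤ √C * (√((n : ℝ)⁻¹ * (h n)⁻¹) * Real.log n) := by
    apply le_of_sq_le_sq _ (by positivity)
    rw [mul_pow, mul_pow, Real.sq_sqrt hC0, Real.sq_sqrt (by positivity)]
    rw [div_le_iff₀ (by positivity)] at hC'
    calc (h n ^ 2) ^ 2 = (n * h n ^ 5) * ((n : ℝ)⁻¹ * (h n)⁻¹) := by field_simp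
      _ ≤ (C * Real.log n ^ 2) * ((n : ℝ)⁻¹ * (h n)⁻¹) := by gcongr
      _ = _ := by ring
  have h4 : logFactor n ≤ 2 * Real.log n := by unfold logFactor; linarith
  have h5 := mul_le_mul_of_nonneg_left h4 (Real.sqrt_nonneg ((n : ℝ)⁻¹ * (h n)⁻¹))
  unfold rate
  linarith

/-- Eventually `n h⁵ ≥ log² n`, that is `log² n / (n h) ≤ h⁴`, so the stochastic term is at most `2
h²`. -/
theorem rate_le_mul_sq {h : ℕ → ℝ} (hh : ∀ n, 1 ≤ n → 0 < h n)
    (hC : Tendsto (fun n : ℕ => (n : ℝ) * h n ^ 5 / Real.log n ^ 2) atTop atTop) :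
    ∀ᶠ n : ℕ in atTop, 0 ≤ rate h n ∧ rate h n ≤ 3 * h n ^ 2 := by
  have hlog : Tendsto (fun n : ℕ => Real.log n) atTop atTop :=
    Real.tendsto_log_atTop.comp tendsto_natCast_atTop_atTop
  filter_upwards [eventually_ge_atTop 2, hlog.eventually_ge_atTop 1, hC.eventually_ge_atTop 1]
    with n h1 h2 h3
  have hn : (0 : ℝ) < n := by positivity
  have hp := hh n (by omega)
  have hl := one_le_logFactor n
  refine ⟨by unfold rate; positivity, ?_⟩
  have h4 : √((n : ℝ)⁻¹ * (h n)⁻¹) * Real.log n ≤ h n ^ 2 := by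
    apply le_of_sq_le_sq _ (by positivity)
    rw [mul_pow, Real.sq_sqrt (by positivity)]
    rw [le_div_iff₀ (by positivity), one_mul] at h3
    calc (n : ℝ)⁻¹ * (h n)⁻¹ * Real.log n ^ 2 ≤ (n : ℝ)⁻¹ * (h n)⁻¹ * (n * h n ^ 5) := by gcongr
      _ = _ := by field_simp
  have h5 : logFactor n ≤ 2 * Real.log n := by unfold logFactor; linarith
  have h6 := mul_le_mul_of_nonneg_left h5 (Real.sqrt_nonneg ((n : ℝ)⁻¹ * (h n)⁻¹))
  unfold rate
  linarith

end Revesz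

theorem theorem6 {Ω : Type*} [MeasurableSpace Ω] (μ : Measure Ω) [IsProbabilityMeasure μ]
    (X Y : ℕ → Ω → ℝ) (g : ℝ → ℝ → ℝ) (hXY : Revesz.IIDWithDensity μ X Y g)
    (K : ℝ → ℝ) (γ h w : ℕ → ℝ) (α a q : ℝ)
    (c d : ℝ) (hcd : c < d)
    (hf : 0 < ⨅ x : Set.Ioo c d, Revesz.marginal g x)
    (r₀ : ℝ → ℝ) (hr₀ : ∃ C, ∀ x ∈ Set.Ioo c d, |r₀ x| ≤ C)
    (hA1 : Revesz.A1 K) (hA2 : Revesz.A2 γ h α a)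
    (hA3 : ∀ x ∈ Set.Ioo c d, Revesz.A3 g x)
    (hA4 : Revesz.A4 μ (Y 0) K g α a)
    (hA5 : Revesz.A5 γ α a) (hA6 : Revesz.A6 w q a) :
    ((∃ C, ∀ n : ℕ, 2 ≤ n → (n : ℝ) * h n ^ 5 / Real.log n ^ 2 ≤ C) →
      (3 * a + 3) / 4 < α →
      ∀ᵐ ω ∂μ, Revesz.SupIsBigO (Set.Ioo c d)
        (fun n x => Revesz.averaged K γ h w r₀ (fun k => X k ω) (fun k => Y k ω) n x -
          Revesz.regression g x)
        (fun n => Real.sqrt ((n : ℝ)⁻¹ * (h n)⁻¹) * Real.log n)) ∧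
    (Tendsto (fun n : ℕ => (n : ℝ) * h n ^ 5 / Real.log n ^ 2) atTop atTop →
      (a ∈ Set.Icc (α / 5) (1 / 5) → (4 * a + 1) / 2 < α) →
      ∀ᵐ ω ∂μ, Revesz.SupIsBigO (Set.Ioo c d)
        (fun n x => Revesz.averaged K γ h w r₀ (fun k => X k ω) (fun k => Y k ω) n x -
          Revesz.regression g x)
        (fun n => h n ^ 2)) := by
  have key := Revesz.averaged_rate_of_bounded μ X Y g hXY K γ h w α a q c d hcd hf r₀ hr₀
    hA1 hA2 hA3 hA4 hA5 hA6
  have hh := hA2.bandwidth.1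
  constructor
  · rintro ⟨C, hC⟩ -
    filter_upwards [key] with ω ⟨C₁, h1⟩
    exact Revesz.supIsBigO_of_le hcd h1 (Revesz.rate_le_mul_log hh hC)
  · intro hC _
    filter_upwards [key] with ω ⟨C₁, h1⟩
    exact Revesz.supIsBigO_of_le hcd h1 (Revesz.rate_le_mul_sq hh hC)
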